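/- Let $(M,g)$ be a smooth locally conformally flat semi-Riemannian manifold of arbitrary signature $(r,s)$ ($r$ minus signs, $s$ plus signs) and dimension $n=r+s\ge 3$: every point has a neighbourhood $V$ with a smooth positive function $\Omega$ on $V$ such that $\Omega^{-2}g$ is flat on $V$, i.e. locally isometric to $\mathbb{R}^{r,s}$. Let $L_g=\frac{1}{n-2}\big(\mathrm{Ric}_g-\frac{\mathrm{Scal}_g}{2(n-1)}g\big)$ be the Schouten tensor and $\nabla$ the Levi-Civita derivative of $g$. Fix $p\in M$; capital Latin indices $C,D,\dots$ of tensors are components in an arbitrary chart around $p$. A conformal Killing vector (CKV) of $g$ on an open set $U$ is a smooth vector field $\xi$ on $U$ with $\pounds_\xi g=2\Psi_\xi g$ for some function $\Psi_\xi$ on $U$. Then for every sufficiently small connected open neighbourhood $U$ of $p$ (that is, for all those contained in a suitable open neighbourhood $U_0$ of $p$; in particular for the simply connected ones) the following holds. 1. There is a unique smooth positive function $\Omega$ on $U$ with $$\mathrm{Hess}_g\Omega=\frac{1}{2\Omega}|\mathrm{grad}_g\Omega|_g^2\,g-\Omega L_g,\qquad \Omega|_p=1,\qquad d\Omega|_p=0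 .$$ The metric $g_E:=\Omega^{-2}g$ is flat on $U$, and $\Omega$ is also the unique smooth positive function on $U$ with $\Omega|_p=1$, $d\Omega|_p=0$ such that $\Omega^{-2}g$ is flat on $U$. 2. There are $n$ linearly independent smooth functions $Y^1,\dots,Y^n$ on $U$ with $\mathrm{Hess}_{g_E}Y^A=0$ and $Y^A|_p=0$. For any such functions, the matrix $h^{AB}:=g_E(\mathrm{grad}_{g_E}Y^A,\mathrm{grad}_{g_E}Y^B)$ is constant on $U$ and invertible, with inverse denoted $h_{AB}$, and the matrix $A^{A}{}_{C}:=\nabla_CY^A|_p$ is invertible, with inverse denoted $B^{C}{}_{B}$, i.e. $A^A{}_CB^C{}_B=\delta^A{}_B$. Put $Y^0:=1$ and $Y^{n+1}:=\frac12h_{AB}Y^AY^B$. For all $\alpha,\beta\in\{0,1,\dots,n+1\}$ the vector field $$\zeta^{\alpha\beta}:=Y^\alpha\,\mathrm{grad}_{g_E}Y^\beta-Y^\beta\,\mathrm{grad}_{g_E}Y^\alpha$$ is a CKV of $(U,g)$. 3. For any such functions $Y^A$ and any CKV $\xi$ of $(U,g)$, with $\pounds_\xi g=2\Psi_\xi g$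 and $\boldsymbol\xi:=g(\xi,\cdot)$, put $$\widehat\xi_C:=\xi_C|_p,\quad \widehat\omega_{CD}:=\tfrac12(d\boldsymbol\xi)_{CD}|_p=\nabla_{[C}\xi_{D]}|_p,\quad \widehat\Psi:=\Psi_\xi|_p,\quad \widehat W_C:=\big(\nabla_C\Psi_\xi+\xi^D(L_g)_{CD}\big)|_p .$$ Then on $U$ $$\xi=\tfrac12F_{\alpha\beta}\,\zeta^{\alpha\beta}=F_{\alpha\beta}\,\Omega^2\,Y^\alpha\,\mathrm{grad}_gY^\beta ,$$ where $F_{\alpha\beta}=-F_{\beta\alpha}$ are the constants given, for $A,B\in\{1,\dots,n\}$, by $$F_{0B}=B^{C}{}_{B}\,\widehat\xi_C,\qquad F_{AB}=\widehat\omega_{CD}\,B^{C}{}_{A}B^{D}{}_{B},\qquad F_{A\,n+1}=\widehat W_C\,B^{C}{}_{A},\qquad F_{0\,n+1}=\widehat\Psi .$$ -/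

import Mathlib

open scoped Manifold ContDiff Topology

noncomputable section

namespace CKV

/-- The model space `ℝⁿ`. -/
abbrev Model (n : ℕ) : Type := EuclideanSpace ℝ (Fin n)

section Calculus

variable {n : ℕ} {M : Type*} [TopologicalSpace M] [ChartedSpace (Model n) M]

variable (M) in
/-- A (not necessarily symmetric, smooth or nondegenerate) field of bilinear forms on the tangent
spaces of `M`. -/
abbrev BilinField : Type _ :=
  ∀ x : M, TangentSpace (𝓡 n) x →L[ℝ] TangentSpace (𝓡 n) x →L[ℝ] ℝ

variable (M) in
/-- A (not necessarily smooth) vector field on `M`. -/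
abbrev VectorField : Type _ := ∀ x : M, TangentSpace (𝓡 n) x

/-- `diag (-1, …, -1, 1, …, 1)` with `r` entries `-1`, the pseudo-Euclidean metric of
signature `(r, n - r)`. -/
def eta (n r : ℕ) : Matrix (Fin n) (Fin n) ℝ :=
  Matrix.diagonal fun i => if (i : ℕ) < r then -1 else 1

/-! ### Coordinates

`e` is a chart of `M`; all index expressions below refer to its coordinates and are meaningful at
the points of `e.source`. -/

/-- The coordinate vector field `∂_i` of the chart `e`. -/
def coordVec (e : OpenPartialHomeomorph M (Model n)) (i : Fin n) : VectorField (n := n) M :=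
  fun x => mfderiv (𝓘(ℝ, Model n)) (𝓡 n) e.symm (e x) (EuclideanSpace.single i (1 : ℝ))

/-- The partial derivative `∂_i f` of a function in the chart `e`. -/
def pd (e : OpenPartialHomeomorph M (Model n)) (i : Fin n) (f : M → ℝ) : M → ℝ :=
  fun x => fderiv ℝ (f ∘ e.symm) (e x) (EuclideanSpace.single i (1 : ℝ))

/-- The component `ξ^i` of a vector field in the chart `e`. -/
def vecComp (e : OpenPartialHomeomorph M (Model n)) (ξ : VectorField (n := n) M) (i : Fin n) :
    M → ℝ :=
  fun x => (show Model n from mfderiv (𝓡 n) (𝓘(ℝ, Model n)) e x (ξ x)) i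

/-- The matrix `g_{ij} = g(∂_i, ∂_j)`. -/
def comp (e : OpenPartialHomeomorph M (Model n)) (g : BilinField (n := n) M) (x : M) :
    Matrix (Fin n) (Fin n) ℝ :=
  Matrix.of fun i j => g x (coordVec e i x) (coordVec e j x)

/-- The inverse metric `g^{ij}`. -/
def compInv (e : OpenPartialHomeomorph M (Model n)) (g : BilinField (n := n) M) (x : M) :
    Matrix (Fin n) (Fin n) ℝ :=
  (comp e g x)⁻¹

/-- `ξ_i = g(ξ, ∂_i)`, the components of the covector `g(ξ, ·)`. -/
def lower (e : OpenPartialHomeomorph M (Model n)) (g : BilinField (n := n) M)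
    (ξ : VectorField (n := n) M) (i : Fin n) : M → ℝ :=
  fun x => g x (ξ x) (coordVec e i x)

/-- Christoffel symbols `Γ^k_{ij} = ½ g^{kl} (∂_i g_{jl} + ∂_j g_{il} - ∂_l g_{ij})`. -/
def christoffel (e : OpenPartialHomeomorph M (Model n)) (g : BilinField (n := n) M)
    (k i j : Fin n) : M → ℝ :=
  fun x => (1 / 2 : ℝ) * ∑ l, compInv e g x k l *
    (pd e i (fun y => comp e g y j l) x + pd e j (fun y => comp e g y i l) x
      - pd e l (fun y => comp e g y i j) x)

/-- Ricci tensor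
`Ric_{ij} = ∂_k Γ^k_{ij} - ∂_j Γ^k_{ik} + Γ^k_{kl} Γ^l_{ij} - Γ^k_{jl} Γ^l_{ik}`
(positive on round spheres). -/
def ricci (e : OpenPartialHomeomorph M (Model n)) (g : BilinField (n := n) M)
    (i j : Fin n) : M → ℝ :=
  fun x => ∑ k, (pd e k (christoffel e g k i j) x - pd e j (christoffel e g k i k) x
    + ∑ l, (christoffel e g k k l x * christoffel e g l i j x
      - christoffel e g k j l x * christoffel e g l i k x))

/-- Scalar curvature. -/
def scal (e : OpenPartialHomeomorph M (Model n)) (g : BilinField (n := n) M) : M → ℝ :=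
  fun x => ∑ i, ∑ j, compInv e g x i j * ricci e g i j x

/-- Schouten tensor `L_g = (Ric_g - Scal_g / (2 (n - 1)) g) / (n - 2)`. -/
def schouten (e : OpenPartialHomeomorph M (Model n)) (g : BilinField (n := n) M)
    (i j : Fin n) : M → ℝ :=
  fun x => (1 / ((n : ℝ) - 2)) *
    (ricci e g i j x - scal e g x / (2 * ((n : ℝ) - 1)) * comp e g x i j)

/-- The Hessian `∇_i ∇_j f = ∂_i ∂_j f - Γ^k_{ij} ∂_k f`. -/
def hess (e : OpenPartialHomeomorph M (Model n)) (g : BilinField (n := n) M) (f : M → ℝ)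
    (i j : Fin n) : M → ℝ :=
  fun x => pd e i (pd e j f) x - ∑ k, christoffel e g k i j x * pd e k f x

/-- The scalar product `⟨grad f, grad f'⟩ = g^{ij} ∂_i f ∂_j f'`. -/
def gradInner (e : OpenPartialHomeomorph M (Model n)) (g : BilinField (n := n) M)
    (f f' : M → ℝ) : M → ℝ :=
  fun x => ∑ i, ∑ j, compInv e g x i j * pd e i f x * pd e j f' x

/-- The gradient `grad f = g^{ij} ∂_j f ∂_i`. -/
def grad (e : OpenPartialHomeomorph M (Model n)) (g : BilinField (n := n) M) (f : M → ℝ) :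
    VectorField (n := n) M :=
  fun x => ∑ i, (∑ j, compInv e g x i j * pd e j f x) • coordVec e i x

/-- The Lie derivative
`(£_ξ g)_{ij} = ξ^k ∂_k g_{ij} + g_{kj} ∂_i ξ^k + g_{ik} ∂_j ξ^k`. -/
def lieMetric (e : OpenPartialHomeomorph M (Model n)) (g : BilinField (n := n) M)
    (ξ : VectorField (n := n) M) (i j : Fin n) : M → ℝ :=
  fun x => ∑ k, (vecComp e ξ k x * pd e k (fun y => comp e g y i j) x
    + comp e g x k j * pd e i (vecComp e ξ k) x + comp e g x i k * pd e j (vecComp e ξ k) x)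

/-- `ξ` is a smooth conformal Killing vector of `g` on `U` (inside the domain of the chart `e`)
with `£_ξ g = 2 Ψ g`. -/
structure IsConformalKilling [IsManifold (𝓡 n) ∞ M] (e : OpenPartialHomeomorph M (Model n))
    (g : BilinField (n := n) M) (U : Set M) (ξ : VectorField (n := n) M) (Ψ : M → ℝ) : Prop where
  smooth : ContMDiffOn (𝓡 n) (𝓡 n).tangent ∞
    (fun x => (⟨x, ξ x⟩ : TangentBundle (𝓡 n) M)) U
  lie : ∀ x ∈ U, ∀ i j, lieMetric e g ξ i j x = 2 * Ψ x * comp e g x i j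

/-! ### Semi-Riemannian metrics and conformal flatness -/

/-- The conformally rescaled metric `Ω⁻² g`. -/
def rescale (Ω : M → ℝ) (g : BilinField (n := n) M) : BilinField (n := n) M :=
  fun x => ((Ω x) ^ 2)⁻¹ • g x

/-- Smooth positive function on `U`. -/
structure IsConformalFactor (U : Set M) (Ω : M → ℝ) : Prop where
  smooth : ContMDiffOn (𝓡 n) 𝓘(ℝ, ℝ) ∞ Ω U
  pos : ∀ x ∈ U, 0 < Ω x

/-- `g` is a smooth semi-Riemannian metric on `M` of signature `(r, n - r)`: `r` minus signs. -/
structure IsSemiRiemannianMetric [IsManifold (𝓡 n) ∞ M] (r : ℕ) (g : BilinField (n := n) M) :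
    Prop where
  symm : ∀ x v w, g x v w = g x w v
  signature : ∀ x, ∃ b : Module.Basis (Fin n) ℝ (TangentSpace (𝓡 n) x),
    ∀ i j, g x (b i) (b j) = eta n r i j
  smooth : ContMDiff (𝓡 n) ((𝓡 n).prod 𝓘(ℝ, Model n →L[ℝ] Model n →L[ℝ] ℝ)) ∞
    (fun x => Bundle.TotalSpace.mk' (Model n →L[ℝ] Model n →L[ℝ] ℝ)
      (E := fun x : M => TangentSpace (𝓡 n) x →L[ℝ] TangentSpace (𝓡 n) x →L[ℝ] ℝ) x (g x))

/-- `g` is flat on `V`: every point of `V` has a neighbourhood in `V` isometric to an open subset of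
the pseudo-Euclidean space of signature `(r, n - r)`, that is, the domain of a smooth chart (with
Cartesian coordinates) in which the metric components are `eta n r`. -/
def IsFlatOn (r : ℕ) (g : BilinField (n := n) M) (V : Set M) : Prop :=
  ∀ q ∈ V, ∃ φ ∈ IsManifold.maximalAtlas (𝓡 n) ∞ M, q ∈ φ.source ∧ φ.source ⊆ V ∧
    ∀ x ∈ φ.source, comp φ g x = eta n r

/-- `g` is locally conformally flat: near every point it is conformal to a flat metric. -/
def IsLocallyConformallyFlat (r : ℕ) (g : BilinField (n := n) M) : Prop :=
  ∀ q : M, ∃ V : Set M, IsOpen V ∧ q ∈ V ∧ ∃ Ω : M → ℝ,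
    IsConformalFactor (n := n) V Ω ∧ IsFlatOn r (rescale Ω g) V

/-- `Ω` is a smooth positive function on `U` with `Ω|_p = 1` and `dΩ|_p = 0`. -/
structure IsNormalizedFactor (e : OpenPartialHomeomorph M (Model n)) (U : Set M) (p : M)
    (Ω : M → ℝ) : Prop extends IsConformalFactor (n := n) U Ω where
  value : Ω p = 1
  deriv : ∀ i, pd e i Ω p = 0

/-- The equation `Hess_g Ω = |grad_g Ω|²_g / (2 Ω) g - Ω L_g` on `U`. -/
def SolvesHessEq (e : OpenPartialHomeomorph M (Model n)) (g : BilinField (n := n) M) (U : Set M)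
    (Ω : M → ℝ) : Prop :=
  ∀ x ∈ U, ∀ i j, hess e g Ω i j x =
    1 / (2 * Ω x) * gradInner e g Ω Ω x * comp e g x i j - Ω x * schouten e g i j x

/-! ### The functions `Y^α` and the vector fields `ζ^{αβ}` -/

/-- `Y^1, …, Y^n` are linearly independent smooth functions on `U` with vanishing Hessian with
respect to `gE` and vanishing at `p`. -/
structure IsAffineSystem (e : OpenPartialHomeomorph M (Model n)) (gE : BilinField (n := n) M)
    (U : Set M) (p : M) (Y : Fin n → M → ℝ) : Prop where
  smooth : ∀ A, ContMDiffOn (𝓡 n) 𝓘(ℝ, ℝ) ∞ (Y A) U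
  linearIndependent : LinearIndependent ℝ fun A (x : U) => Y A x
  hess_eq_zero : ∀ A, ∀ x ∈ U, ∀ i j, hess e gE (Y A) i j x = 0
  zero_at : ∀ A, Y A p = 0

/-- `h^{AB} = ⟨grad Y^A, grad Y^B⟩`, for the metric `gE`. -/
def hMat (e : OpenPartialHomeomorph M (Model n)) (gE : BilinField (n := n) M)
    (Y : Fin n → M → ℝ) (x : M) : Matrix (Fin n) (Fin n) ℝ :=
  Matrix.of fun A B => gradInner e gE (Y A) (Y B) x

/-- The index `A ∈ {1, …, n}` among the indices `0, 1, …, n, n + 1`. -/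
def mid (A : Fin n) : Fin (n + 2) := A.castSucc.succ

/-- `Y^0 = 1`, `Y^A`, and `Y^{n+1} = ½ h_{AB} Y^A Y^B`, with `h_{AB}` the inverse of `h^{AB}`. -/
def extend (e : OpenPartialHomeomorph M (Model n)) (gE : BilinField (n := n) M)
    (Y : Fin n → M → ℝ) : Fin (n + 2) → M → ℝ :=
  Fin.cons (fun _ => 1) (Fin.snoc (α := fun _ => M → ℝ) Y
    (fun x => (1 / 2 : ℝ) * ∑ A, ∑ B, (hMat e gE Y x)⁻¹ A B * Y A x * Y B x))

/-- `ζ^{αβ} = Y^α grad Y^β - Y^β grad Y^α`, with gradients of the metric `gE`. -/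
def zeta (e : OpenPartialHomeomorph M (Model n)) (gE : BilinField (n := n) M)
    (Y : Fin n → M → ℝ) (α β : Fin (n + 2)) : VectorField (n := n) M :=
  fun x => extend e gE Y α x • grad e gE (extend e gE Y β) x
    - extend e gE Y β x • grad e gE (extend e gE Y α) x

/-- `A^A_C = ∂_C Y^A |_p`. -/
def jac (e : OpenPartialHomeomorph M (Model n)) (Y : Fin n → M → ℝ) (p : M) :
    Matrix (Fin n) (Fin n) ℝ :=
  Matrix.of fun A C => pd e C (Y A) p

/-- `ω_{CD} = ½ (dξ)_{CD} = ½ (∂_C ξ_D - ∂_D ξ_C)` (which is `∇_{[C} ξ_{D]}`). -/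
def omegaHat (e : OpenPartialHomeomorph M (Model n)) (g : BilinField (n := n) M)
    (ξ : VectorField (n := n) M) (p : M) (C D : Fin n) : ℝ :=
  (1 / 2 : ℝ) * (pd e C (lower e g ξ D) p - pd e D (lower e g ξ C) p)

/-- `W_C = (∇_C Ψ + ξ^D (L_g)_{CD}) |_p`. -/
def WHat (e : OpenPartialHomeomorph M (Model n)) (g : BilinField (n := n) M)
    (ξ : VectorField (n := n) M) (Ψ : M → ℝ) (p : M) (C : Fin n) : ℝ :=
  pd e C Ψ p + ∑ D, vecComp e ξ D p * schouten e g C D p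

end Calculus

end CKV

end

/-!
All objects in the statement are tensorial: their components in two charts differ by the Jacobian
matrix of the change of coordinates (`IsMetricOn.schoutenMat_chain`, `IsMetricOn.hessMat_chain`,
`IsMetricOn.lieMetric_chain`, `IsMetricOn.omegaHat_chain`, `IsMetricOn.WHat_chain`). The only hard
part of this is the Ricci tensor: the transformation law of the Christoffel symbols follows from the
uniqueness of the Levi-Civita connection, and differentiating that law gives the covariance of the
curvature (`IsMetricOn.transMat_mul_curvMat`). Hence every claim may be checked in one well-chosen
chart.

The chart is one in which `g = Ω² η`, with `Ω = 1` and `dΩ = 0` at `p`. Local conformal flatness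
provides a chart with `g = Ω₀² η`; a special conformal transformation
`x ↦ (x + ½⟨x, x⟩b) / (1 + ⟨b, x⟩ + ¼⟨b, b⟩⟨x, x⟩)` followed by a homothety multiplies `η` by a
function which can be given any positive value and any differential at `p`
(`IsConfFlatChart.exists_normalized`).

In such a chart put `υ = d log Ω`. The Schouten tensor is `-∂υ + υ ⊗ υ - ½⟨υ, υ⟩η`
(`IsConfFlatChart.schouten_eq`), from which the Hessian equation for `Ω` is immediate. A second
solution has the form `uΩ` with `∂ᵢ∂ⱼu = ⟨du, du⟩/(2u) ηᵢⱼ`; differentiating `⟨du, du⟩/u` shows that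
it is constant, so it vanishes when `du = 0` at `p`, and `u` is constant
(`IsConfFlatChart.eq_of_solvesHessEq`). As the factor of any flat rescaling solves the Hessian
equation too, both uniqueness claims follow.

The functions with vanishing Hessian for `Ω⁻² g = η` are the affine functions of the coordinates,
so `Y^A = A^A_j x^j` with an invertible matrix, where `x` are the coordinates centred at `p`, and
`Y^{n+1} = ½⟨x, x⟩`. A field `ξ` is conformal Killing exactly when its flat covector components
satisfy `∂ᵢvⱼ + ∂ⱼvᵢ = 2σηᵢⱼ` with `σ = Ψ - ξ(log Ω)`. Taking `v = Y^α dY^β - Y^β dY^α` shows that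
the fields `ζ^{αβ}` are conformal Killing. Conversely, for `n ≥ 3` the equation forces `∂∂σ = 0`,
and integrating twice expresses `v` as a quadratic polynomial in `x` determined by `v`, `dv`, `σ`
and `dσ` at `p` (`IsChartOn.liouville`). By the normalization of `Ω` these four are `ξ̂`, `ω̂`,
`Ψ̂` and `Ŵ` (`IsConfFlatChart.WHat_eq`), and comparing coefficients gives the constants `F_{αβ}`
(`sum_skewCoeff`, `IsConformalKilling.eq_sum_grad`).
-/

set_option linter.unusedSectionVars false

noncomputable section

namespace CKV

/-! ### Calculus in the coordinates of a chart -/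

section ChartCalculus

variable {n : ℕ} {M : Type*} [TopologicalSpace M] [ChartedSpace (Model n) M]

/-- `U` is an open subset of the domain of the smooth chart `e`. -/
structure IsChartOn (e : OpenPartialHomeomorph M (Model n)) (U : Set M) : Prop where
  mem : e ∈ IsManifold.maximalAtlas (𝓡 n) ∞ M
  isOpen : IsOpen U
  subset : U ⊆ e.source

variable (n) in
/-- `f` is a smooth real function on `U`. -/
abbrev SmoothFn (U : Set M) (f : M → ℝ) : Prop := ContMDiffOn (𝓡 n) 𝓘(ℝ, ℝ) ∞ f U

variable {e φ : OpenPartialHomeomorph M (Model n)} {U : Set M} {f f' : M → ℝ} {x : M}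

theorem IsChartOn.mono (h : IsChartOn e U) {V : Set M} (hV : IsOpen V) (hVU : V ⊆ U) :
    IsChartOn e V :=
  ⟨h.mem, hV, hVU.trans h.subset⟩

theorem IsChartOn.mem_nhds (h : IsChartOn e U) (hx : x ∈ U) : U ∈ 𝓝 x := h.isOpen.mem_nhds hx

theorem IsChartOn.contDiffAt (h : IsChartOn e U) (hf : SmoothFn n U f) (hx : x ∈ U) :
    ContDiffAt ℝ ∞ (f ∘ e.symm) (e x) := by
  have hx' := h.subset hx
  have h1 : ContMDiffAt (𝓡 n) (𝓡 n) ∞ e.symm (e x) :=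
    contMDiffAt_symm_of_mem_maximalAtlas h.mem (e.map_source hx')
  have h2 : ContMDiffAt (𝓡 n) 𝓘(ℝ, ℝ) ∞ f (e.symm (e x)) := by
    rw [e.left_inv hx']
    exact hf.contMDiffAt (h.mem_nhds hx)
  exact contMDiffAt_iff_contDiffAt.1 (h2.comp (e x) h1)

theorem IsChartOn.differentiableAt (h : IsChartOn e U) (hf : SmoothFn n U f) (hx : x ∈ U) :
    DifferentiableAt ℝ (f ∘ e.symm) (e x) :=
  (h.contDiffAt hf hx).differentiableAt (by simp)

theorem pd_congr_nhds (hx : x ∈ e.source) (hff' : f =ᶠ[𝓝 x] f') (i : Fin n) :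
    pd e i f x = pd e i f' x := by
  unfold pd
  have : f ∘ e.symm =ᶠ[𝓝 (e x)] f' ∘ e.symm := by
    have ht : Filter.Tendsto e.symm (𝓝 (e x)) (𝓝 x) := by
      simpa [e.left_inv hx] using (e.continuousAt_symm (e.map_source hx)).tendsto
    exact ht.eventually hff'
  rw [this.fderiv_eq]

theorem IsChartOn.pd_congr (h : IsChartOn e U) (hff' : Set.EqOn f f' U) (hx : x ∈ U) (i : Fin n) :
    pd e i f x = pd e i f' x :=
  pd_congr_nhds (h.subset hx) (Filter.eventuallyEq_of_mem (h.mem_nhds hx) hff') i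

@[simp] theorem pd_const (e : OpenPartialHomeomorph M (Model n)) (i : Fin n) (c : ℝ) :
    pd e i (fun _ : M => c) x = 0 := by
  have : ((fun _ : M => c) ∘ e.symm) = fun _ => c := rfl
  simp [pd, this]

theorem IsChartOn.pd_add (h : IsChartOn e U) (hf : SmoothFn n U f) (hf' : SmoothFn n U f')
    (hx : x ∈ U) (i : Fin n) :
    pd e i (fun y => f y + f' y) x = pd e i f x + pd e i f' x := by
  have : ((fun y => f y + f' y) ∘ e.symm) = (f ∘ e.symm) + (f' ∘ e.symm) := rfl
  simp only [pd, this]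
  rw [fderiv_add (h.differentiableAt hf hx) (h.differentiableAt hf' hx)]
  rfl

theorem IsChartOn.pd_sub (h : IsChartOn e U) (hf : SmoothFn n U f) (hf' : SmoothFn n U f')
    (hx : x ∈ U) (i : Fin n) :
    pd e i (fun y => f y - f' y) x = pd e i f x - pd e i f' x := by
  have : ((fun y => f y - f' y) ∘ e.symm) = (f ∘ e.symm) - (f' ∘ e.symm) := rfl
  simp only [pd, this]
  rw [fderiv_sub (h.differentiableAt hf hx) (h.differentiableAt hf' hx)]
  rfl

theorem IsChartOn.pd_mul (h : IsChartOn e U) (hf : SmoothFn n U f) (hf' : SmoothFn n U f')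
    (hx : x ∈ U) (i : Fin n) :
    pd e i (fun y => f y * f' y) x = pd e i f x * f' x + f x * pd e i f' x := by
  have : ((fun y => f y * f' y) ∘ e.symm) = (f ∘ e.symm) * (f' ∘ e.symm) := rfl
  simp only [pd, this]
  rw [fderiv_mul (h.differentiableAt hf hx) (h.differentiableAt hf' hx)]
  simp [e.left_inv (h.subset hx)]
  ring

theorem pd_const_mul (c : ℝ) (i : Fin n) :
    pd e i (fun y => c * f y) x = c * pd e i f x := by
  have : ((fun y => c * f y) ∘ e.symm) = c • (f ∘ e.symm) := rfl
  simp only [pd, this]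
  rw [fderiv_const_smul_field]
  rfl

theorem pd_mul_const (c : ℝ) (i : Fin n) :
    pd e i (fun y => f y * c) x = pd e i f x * c := by
  simp only [mul_comm _ c, pd_const_mul]

theorem SmoothFn.sum {ι : Type*} {s : Finset ι} {f : ι → M → ℝ}
    (hf : ∀ a ∈ s, SmoothFn n U (f a)) : SmoothFn n U (fun y => ∑ a ∈ s, f a y) :=
  contMDiffOn_finsetSum hf

theorem SmoothFn.const (c : ℝ) : SmoothFn n U (fun _ : M => c) := contMDiffOn_const

theorem SmoothFn.inv (hf : SmoothFn n U f) (h0 : ∀ x ∈ U, f x ≠ 0) :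
    SmoothFn n U (fun y => (f y)⁻¹) :=
  ContMDiffOn.inv₀ hf h0

theorem SmoothFn.div (hf : SmoothFn n U f) (hf' : SmoothFn n U f') (h0 : ∀ x ∈ U, f' x ≠ 0) :
    SmoothFn n U (fun y => f y / f' y) := by
  simp only [div_eq_mul_inv]
  exact ContMDiffOn.mul hf (SmoothFn.inv hf' h0)

theorem SmoothFn.mul (hf : SmoothFn n U f) (hf' : SmoothFn n U f') :
    SmoothFn n U (fun y => f y * f' y) :=
  ContMDiffOn.mul hf hf'

theorem SmoothFn.add (hf : SmoothFn n U f) (hf' : SmoothFn n U f') :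
    SmoothFn n U (fun y => f y + f' y) :=
  ContMDiffOn.add hf hf'

theorem SmoothFn.sub (hf : SmoothFn n U f) (hf' : SmoothFn n U f') :
    SmoothFn n U (fun y => f y - f' y) :=
  ContMDiffOn.sub hf hf'

theorem SmoothFn.pow (hf : SmoothFn n U f) (k : ℕ) : SmoothFn n U (fun y => f y ^ k) :=
  ContMDiffOn.pow hf k

theorem IsChartOn.pd_sum (h : IsChartOn e U) {ι : Type*} {s : Finset ι} {f : ι → M → ℝ}
    (hf : ∀ a ∈ s, SmoothFn n U (f a)) (hx : x ∈ U) (i : Fin n) :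
    pd e i (fun y => ∑ a ∈ s, f a y) x = ∑ a ∈ s, pd e i (f a) x := by
  have : ((fun y => ∑ a ∈ s, f a y) ∘ e.symm) = fun z => ∑ a ∈ s, (f a ∘ e.symm) z := rfl
  simp only [pd, this]
  rw [fderiv_fun_sum fun a ha => h.differentiableAt (hf a ha) hx]
  simp

theorem IsChartOn.pd_inv (h : IsChartOn e U) (hf : SmoothFn n U f) (h0 : ∀ x ∈ U, f x ≠ 0)
    (hx : x ∈ U) (i : Fin n) :
    pd e i (fun y => (f y)⁻¹) x = -pd e i f x / f x ^ 2 := by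
  have h1 : pd e i (fun y => f y * (f y)⁻¹) x = 0 := by
    rw [h.pd_congr (f' := fun _ => 1) (fun y hy => mul_inv_cancel₀ (h0 y hy)) hx, pd_const]
  rw [h.pd_mul hf (SmoothFn.inv hf h0) hx] at h1
  have := h0 x hx
  field_simp at h1 ⊢
  linarith

theorem IsChartOn.pd_div (h : IsChartOn e U) (hf : SmoothFn n U f) (hf' : SmoothFn n U f')
    (h0 : ∀ x ∈ U, f' x ≠ 0) (hx : x ∈ U) (i : Fin n) :
    pd e i (fun y => f y / f' y) x = (pd e i f x * f' x - f x * pd e i f' x) / f' x ^ 2 := by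
  simp only [div_eq_mul_inv]
  rw [h.pd_mul hf (SmoothFn.inv hf' h0) hx, h.pd_inv hf' h0 hx]
  have := h0 x hx
  field_simp
  ring

theorem IsChartOn.pd_sq (h : IsChartOn e U) (hf : SmoothFn n U f)
    (hx : x ∈ U) (i : Fin n) :
    pd e i (fun y => f y ^ 2) x = 2 * f x * pd e i f x := by
  simp only [pow_two]
  rw [h.pd_mul hf hf hx]
  ring

theorem IsChartOn.smooth_comp (h : IsChartOn e U) {F : Model n → ℝ}
    (hF : ∀ x ∈ U, ContDiffAt ℝ ∞ F (e x)) : SmoothFn n U (fun x => F (e x)) := by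
  intro x hx
  have h1 : ContMDiffAt (𝓡 n) (𝓡 n) ∞ e x :=
    contMDiffAt_of_mem_maximalAtlas h.mem (h.subset hx)
  exact (ContMDiffAt.comp x (hF x hx).contMDiffAt h1).contMDiffWithinAt

theorem IsChartOn.smooth_pd (h : IsChartOn e U) (hf : SmoothFn n U f) (i : Fin n) :
    SmoothFn n U (pd e i f) := by
  refine h.smooth_comp
    (F := fun y => fderiv ℝ (f ∘ e.symm) y (EuclideanSpace.single i (1 : ℝ))) fun x hx => ?_
  exact ((h.contDiffAt hf hx).fderiv_right (m := ∞) (by simp)).clm_apply contDiffAt_const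

theorem IsChartOn.pd_comm (h : IsChartOn e U) (hf : SmoothFn n U f) (hx : x ∈ U) (i j : Fin n) :
    pd e i (pd e j f) x = pd e j (pd e i f) x := by
  have hc := h.contDiffAt hf hx
  have hs : IsSymmSndFDerivAt ℝ (f ∘ e.symm) (e x) :=
    hc.isSymmSndFDerivAt (by simpa using ENat.LEInfty.out)
  have hd : DifferentiableAt ℝ (fderiv ℝ (f ∘ e.symm)) (e x) :=
    (hc.fderiv_right (m := 1) (by norm_cast)).differentiableAt (by simp)
  have key : ∀ k l : Fin n, pd e k (pd e l f) x =
      fderiv ℝ (fderiv ℝ (f ∘ e.symm)) (e x) (EuclideanSpace.single k 1)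
        (EuclideanSpace.single l 1) := by
    intro k l
    have hx' := e.map_source (h.subset hx)
    have : (pd e l f ∘ e.symm) =ᶠ[𝓝 (e x)]
        fun y => fderiv ℝ (f ∘ e.symm) y (EuclideanSpace.single l (1 : ℝ)) := by
      filter_upwards [e.open_target.mem_nhds hx'] with y hy
      simp [pd, e.right_inv hy]
    rw [pd, this.fderiv_eq, fderiv_clm_apply hd (differentiableAt_const _)]
    simp
  rw [key, key]
  exact hs _ _

/-- The `a`-th coordinate function of a chart. -/
def coordFn (φ : OpenPartialHomeomorph M (Model n)) (a : Fin n) : M → ℝ := fun x => φ x a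

theorem IsChartOn.smooth_coordFn (h : IsChartOn φ U) (a : Fin n) : SmoothFn n U (coordFn φ a) :=
  h.smooth_comp (F := fun y => y a) fun _ _ => by fun_prop

/-- The Jacobian matrix `∂_i φ^a` of the coordinates of `φ` with respect to those of `e`. -/
def transMat (e φ : OpenPartialHomeomorph M (Model n)) (x : M) : Matrix (Fin n) (Fin n) ℝ :=
  Matrix.of fun a i => pd e i (coordFn φ a) x

theorem sum_smul_single (v : Model n) : ∑ a, v a • EuclideanSpace.single a (1 : ℝ) = v := by
  ext i
  simp [Pi.single_apply]

/-- The chain rule for a change of coordinates. -/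
theorem IsChartOn.pd_chain (he : IsChartOn e U) (hφ : IsChartOn φ U) (hf : SmoothFn n U f)
    (hx : x ∈ U) (i : Fin n) :
    pd e i f x = ∑ a, transMat e φ x a i * pd φ a f x := by
  have hx' := hφ.subset hx
  have hxe := he.subset hx
  have hev : f ∘ e.symm =ᶠ[𝓝 (e x)] (f ∘ φ.symm) ∘ (φ ∘ e.symm) := by
    have ht : Filter.Tendsto e.symm (𝓝 (e x)) (𝓝 x) := by
      simpa [e.left_inv hxe] using (e.continuousAt_symm (e.map_source hxe)).tendsto
    filter_upwards [ht.eventually (hφ.mem_nhds hx)] with y hy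
    simp [φ.left_inv (hφ.subset hy)]
  have hT : DifferentiableAt ℝ (φ ∘ e.symm) (e x) := by
    rw [differentiableAt_euclidean]
    exact fun a => he.differentiableAt (hφ.smooth_coordFn a) hx
  have hE : (φ ∘ e.symm) (e x) = φ x := by simp [e.left_inv hxe]
  have hF : DifferentiableAt ℝ (f ∘ φ.symm) ((φ ∘ e.symm) (e x)) := by
    rw [hE]; exact hφ.differentiableAt hf hx
  rw [pd, hev.fderiv_eq, fderiv_comp _ hF hT, hE]
  simp only [ContinuousLinearMap.comp_apply]
  set v := fderiv ℝ (φ ∘ e.symm) (e x) (EuclideanSpace.single i (1 : ℝ)) with hv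
  have hva : ∀ a, v a = transMat e φ x a i := by
    intro a
    have : (coordFn φ a ∘ e.symm) = (EuclideanSpace.proj a : Model n →L[ℝ] ℝ) ∘ (φ ∘ e.symm) := rfl
    simp only [transMat, Matrix.of_apply, pd, this]
    rw [fderiv_comp _ (ContinuousLinearMap.differentiableAt _) hT, ContinuousLinearMap.fderiv]
    rfl
  conv_lhs => rw [← sum_smul_single v]
  simp [hva, pd]

theorem IsChartOn.pd_coordFn (h : IsChartOn φ U) (hx : x ∈ U) (i a : Fin n) :
    pd φ i (coordFn φ a) x = if a = i then 1 else 0 := by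
  have hx' := h.subset hx
  have : (coordFn φ a ∘ φ.symm) =ᶠ[𝓝 (φ x)] (EuclideanSpace.proj a : Model n →L[ℝ] ℝ) := by
    filter_upwards [φ.open_target.mem_nhds (φ.map_source hx')] with y hy
    simp [coordFn, φ.right_inv hy]
  rw [pd, this.fderiv_eq, ContinuousLinearMap.fderiv]
  simp [PiLp.single_apply]

theorem IsChartOn.transMat_mul (he : IsChartOn e U) (hφ : IsChartOn φ U) (hx : x ∈ U) :
    transMat φ e x * transMat e φ x = 1 := by
  ext a i
  have := he.pd_chain hφ (he.smooth_coordFn a) hx i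
  rw [he.pd_coordFn hx] at this
  simp only [Matrix.mul_apply, Matrix.one_apply, this]
  exact Finset.sum_congr rfl fun b _ => mul_comm _ _

theorem IsChartOn.isUnit_transMat (he : IsChartOn e U) (hφ : IsChartOn φ U) (hx : x ∈ U) :
    IsUnit (transMat e φ x).det :=
  Matrix.isUnit_det_of_left_inverse (he.transMat_mul hφ hx)

/-- A smooth function with vanishing partial derivatives on a connected set is constant. -/
theorem IsChartOn.eq_of_pd_eq_zero (h : IsChartOn φ U) (hc : IsPreconnected U)
    (hf : SmoothFn n U f) (h0 : ∀ x ∈ U, ∀ i, pd φ i f x = 0) {x y : M} (hx : x ∈ U) (hy : y ∈ U) :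
    f x = f y := by
  have ho : IsOpen (φ '' U) := φ.isOpen_image_of_subset_source h.isOpen h.subset
  have hpc : IsPreconnected (φ '' U) := hc.image _ (φ.continuousOn.mono h.subset)
  have := ho.is_const_of_fderiv_eq_zero (f := f ∘ φ.symm) (𝕜 := ℝ) hpc
    (by
      rintro _ ⟨z, hz, rfl⟩
      exact (h.differentiableAt hf hz).differentiableWithinAt)
    (by
      rintro _ ⟨z, hz, rfl⟩
      ext v
      rw [← sum_smul_single v, map_sum]
      have := h0 z hz
      simp only [pd] at this
      simp [this])
    (Set.mem_image_of_mem φ hx) (Set.mem_image_of_mem φ hy)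
  simpa [φ.left_inv (h.subset hx), φ.left_inv (h.subset hy)] using this

end ChartCalculus

/-! ### Vector fields and bilinear forms in the coordinates of a chart -/

section Fields

variable {n : ℕ} {M : Type*} [TopologicalSpace M] [ChartedSpace (Model n) M]
  [IsManifold (𝓡 n) ∞ M]

variable {e φ : OpenPartialHomeomorph M (Model n)} {U : Set M} {f f' : M → ℝ} {x : M}

theorem IsChartOn.mdifferentiableAt (h : IsChartOn e U) (hx : x ∈ U) :
    MDifferentiableAt (𝓡 n) (𝓡 n) e x :=
  (contMDiffAt_of_mem_maximalAtlas h.mem (h.subset hx)).mdifferentiableAt (by simp)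

theorem IsChartOn.mdifferentiableAt_symm (h : IsChartOn e U) (hx : x ∈ U) :
    MDifferentiableAt (𝓡 n) (𝓡 n) e.symm (e x) :=
  (contMDiffAt_symm_of_mem_maximalAtlas h.mem (e.map_source (h.subset hx))).mdifferentiableAt
    (by simp)

theorem IsChartOn.mfderiv_symm_mfderiv (h : IsChartOn e U) (hx : x ∈ U)
    (v : TangentSpace (𝓡 n) x) :
    mfderiv (𝓡 n) (𝓡 n) e.symm (e x) (mfderiv (𝓡 n) (𝓡 n) e x v) = v := by
  have hm : e.MDifferentiable (𝓡 n) (𝓡 n) :=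
    ⟨(contMDiffOn_of_mem_maximalAtlas h.mem).mdifferentiableOn (by simp),
      (contMDiffOn_symm_of_mem_maximalAtlas h.mem).mdifferentiableOn (by simp)⟩
  have := hm.symm_comp_deriv (h.subset hx)
  exact DFunLike.congr_fun this v

theorem IsChartOn.eq_sum_vecComp (h : IsChartOn e U) (hx : x ∈ U) (ξ : VectorField (n := n) M) :
    ξ x = ∑ i, vecComp e ξ i x • coordVec e i x := by
  set v : Model n := mfderiv (𝓡 n) (𝓡 n) e x (ξ x) with hv
  have h1 : ξ x = mfderiv (𝓡 n) (𝓡 n) e.symm (e x) v := (h.mfderiv_symm_mfderiv hx (ξ x)).symm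
  have h2 : mfderiv (𝓡 n) (𝓡 n) e.symm (e x) (∑ i, v i • EuclideanSpace.single i (1 : ℝ))
      = ∑ i, v i • coordVec e i x := by
    erw [map_sum]
    refine Finset.sum_congr rfl fun i _ => ?_
    erw [map_smul]
    rfl
  have h3 : (∑ i, v i • EuclideanSpace.single i (1 : ℝ)) = v := sum_smul_single v
  rw [h1]
  refine Eq.trans ?_ h2
  exact congrArg _ h3.symm

theorem IsChartOn.vecComp_coordVec (he : IsChartOn e U) (hφ : IsChartOn φ U) (hx : x ∈ U)
    (i a : Fin n) : vecComp φ (coordVec e i) a x = transMat e φ x a i := by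
  have h1 : mfderiv (𝓡 n) (𝓡 n) (φ ∘ e.symm) (e x) =
      (mfderiv (𝓡 n) (𝓡 n) φ (e.symm (e x))).comp (mfderiv (𝓡 n) (𝓡 n) e.symm (e x)) := by
    refine mfderiv_comp (e x) ?_ (he.mdifferentiableAt_symm hx)
    rw [e.left_inv (he.subset hx)]
    exact hφ.mdifferentiableAt hx
  have hT : DifferentiableAt ℝ (φ ∘ e.symm) (e x) := by
    rw [differentiableAt_euclidean]
    exact fun a => he.differentiableAt (hφ.smooth_coordFn a) hx
  have : (coordFn φ a ∘ e.symm) = (EuclideanSpace.proj a : Model n →L[ℝ] ℝ) ∘ (φ ∘ e.symm) := rfl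
  simp only [transMat, Matrix.of_apply, pd, this]
  rw [fderiv_comp _ (ContinuousLinearMap.differentiableAt _) hT, ContinuousLinearMap.fderiv,
    ← mfderiv_eq_fderiv]
  erw [h1]
  rw [e.left_inv (he.subset hx)]
  rfl

theorem vecComp_sum {ι : Type*} (s : Finset ι) (c : ι → ℝ) (X : ι → VectorField (n := n) M)
    (i : Fin n) :
    vecComp e (fun y => ∑ a ∈ s, c a • X a y) i x = ∑ a ∈ s, c a * vecComp e (X a) i x := by
  unfold vecComp
  simp only [map_sum, map_smul]
  erw [WithLp.ofLp_sum, Finset.sum_apply]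
  rfl

theorem vecComp_congr {ξ ζ : VectorField (n := n) M} (h : ξ x = ζ x) (i : Fin n) :
    vecComp e ξ i x = vecComp e ζ i x := by
  simp only [vecComp, h]

theorem IsChartOn.vecComp_chain (he : IsChartOn e U) (hφ : IsChartOn φ U) (hx : x ∈ U)
    (ξ : VectorField (n := n) M) (a : Fin n) :
    vecComp φ ξ a x = ∑ i, transMat e φ x a i * vecComp e ξ i x := by
  rw [vecComp_congr (ζ := fun y => ∑ i, vecComp e ξ i x • coordVec e i y) (he.eq_sum_vecComp hx ξ),
    vecComp_sum]
  exact Finset.sum_congr rfl fun i _ => by rw [he.vecComp_coordVec hφ hx, mul_comm]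

theorem IsChartOn.coordVec_chain (he : IsChartOn e U) (hφ : IsChartOn φ U) (hx : x ∈ U)
    (i : Fin n) : coordVec e i x = ∑ a, transMat e φ x a i • coordVec φ a x := by
  rw [hφ.eq_sum_vecComp hx (coordVec e i)]
  exact Finset.sum_congr rfl fun a _ => by rw [he.vecComp_coordVec hφ hx]

theorem IsChartOn.vecComp_sum_coordVec (h : IsChartOn e U) (hx : x ∈ U) (c : Fin n → M → ℝ)
    (i : Fin n) : vecComp e (fun y => ∑ a, c a y • coordVec e a y) i x = c i x := by
  rw [vecComp_congr (ζ := fun y => ∑ a, c a x • coordVec e a y) rfl, vecComp_sum]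
  simp [h.vecComp_coordVec h hx, transMat, h.pd_coordFn hx]

/-- `ξ` is a smooth vector field on `U`. -/
abbrev SmoothField (U : Set M) (ξ : VectorField (n := n) M) : Prop :=
  ContMDiffOn (𝓡 n) (𝓡 n).tangent ∞ (fun x => (⟨x, ξ x⟩ : TangentBundle (𝓡 n) M)) U

theorem IsChartOn.smooth_vecComp (h : IsChartOn e U) {ξ : VectorField (n := n) M}
    (hξ : SmoothField U ξ) (i : Fin n) : SmoothFn n U (vecComp e ξ i) := by
  have h1 := (contMDiffOn_of_mem_maximalAtlas h.mem).contMDiffOn_tangentMapWithin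
    (m := ∞) (by simp) e.open_source.uniqueMDiffOn
  have h2 := h1.comp hξ (fun y hy => h.subset hy)
  have h3 := (contMDiff_snd_tangentBundle_modelSpace (Model n) (𝓡 n) (n := ∞)).comp_contMDiffOn h2
  have h4 : ContMDiff 𝓘(ℝ, Model n) 𝓘(ℝ, ℝ) ∞ (fun v : Model n => v i) :=
    (EuclideanSpace.proj i : Model n →L[ℝ] ℝ).contMDiff
  refine (h4.comp_contMDiffOn h3).congr fun y hy => ?_
  have h5 : mfderivWithin (𝓡 n) (𝓡 n) e e.source y = mfderiv (𝓡 n) (𝓡 n) e y :=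
    mfderivWithin_of_isOpen e.open_source (h.subset hy)
  exact congrArg (fun L => (show Model n from L (ξ y)) i) h5.symm

theorem IsChartOn.smooth_coordVec (h : IsChartOn e U) (i : Fin n) :
    SmoothField U (coordVec e i) := by
  have h1 := (contMDiffOn_symm_of_mem_maximalAtlas h.mem).contMDiffOn_tangentMapWithin
    (m := ∞) (by simp) e.open_target.uniqueMDiffOn
  have h0 : ContMDiffOn 𝓘(ℝ, Model n) 𝓘(ℝ, Model n).tangent ∞ (fun y : Model n =>
      (⟨y, (EuclideanSpace.single i (1 : ℝ) : Model n)⟩ : TangentBundle 𝓘(ℝ, Model n) (Model n)))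
      e.target := fun y _ => contMDiffWithinAt_vectorSpace_iff_contDiffWithinAt
    (V := fun _ : Model n => EuclideanSpace.single i (1 : ℝ)) |>.2 contDiffWithinAt_const
  have h2 := (h1.comp h0 (fun y hy => hy)).comp
    ((contMDiffOn_of_mem_maximalAtlas h.mem).mono h.subset) (fun y hy => e.map_source (h.subset hy))
  refine h2.congr fun y hy => ?_
  have hy' := h.subset hy
  simp only [Function.comp_apply, tangentMapWithin]
  rw [mfderivWithin_of_isOpen e.open_target (e.map_source hy')]
  unfold coordVec
  rw [e.left_inv hy']

theorem IsChartOn.smoothField_sum (h : IsChartOn e U) {c : Fin n → M → ℝ}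
    (hc : ∀ i, SmoothFn n U (c i)) : SmoothField U (fun y => ∑ i, c i y • coordVec e i y) :=
  ContMDiffOn.sum_section fun i _ => (hc i).smul_section (h.smooth_coordVec i)

variable {g : BilinField (n := n) M}

theorem IsChartOn.comp_chain (he : IsChartOn e U) (hφ : IsChartOn φ U) (hx : x ∈ U) :
    comp e g x = (transMat e φ x).transpose * comp φ g x * transMat e φ x := by
  ext i j
  simp only [comp, Matrix.of_apply, Matrix.mul_apply, Matrix.transpose_apply]
  rw [he.coordVec_chain hφ hx i, he.coordVec_chain hφ hx j]
  simp only [map_sum, map_smul, sum_apply, smul_apply,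
    smul_eq_mul, Finset.mul_sum, Finset.sum_mul]
  refine Finset.sum_congr rfl fun a _ => Finset.sum_congr rfl fun b _ => by ring

theorem IsChartOn.lower_eq (he : IsChartOn e U) (hx : x ∈ U) (ξ : VectorField (n := n) M)
    (i : Fin n) : lower e g ξ i x = ∑ k, vecComp e ξ k x * comp e g x k i := by
  unfold lower
  rw [he.eq_sum_vecComp hx ξ]
  simp [comp]

theorem IsChartOn.lower_chain (he : IsChartOn e U) (hφ : IsChartOn φ U) (hx : x ∈ U)
    (ξ : VectorField (n := n) M) (i : Fin n) :
    lower e g ξ i x = ∑ a, transMat e φ x a i * lower φ g ξ a x := by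
  unfold lower
  rw [he.coordVec_chain hφ hx]
  simp

theorem IsChartOn.ext_vecComp (he : IsChartOn e U) (hx : x ∈ U) {ξ ζ : VectorField (n := n) M}
    (h : ∀ i, vecComp e ξ i x = vecComp e ζ i x) : ξ x = ζ x := by
  rw [he.eq_sum_vecComp hx ξ, he.eq_sum_vecComp hx ζ]
  simp [h]

end Fields

/-! ### Matrix-valued functions -/

section MatrixCalculus

variable {n : ℕ} {M : Type*} [TopologicalSpace M] [ChartedSpace (Model n) M]

variable {e φ : OpenPartialHomeomorph M (Model n)} {U : Set M} {f f' : M → ℝ} {x : M}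
  {A B : M → Matrix (Fin n) (Fin n) ℝ}

/-- The entries of the matrix-valued function `A` are smooth on `U`. -/
def SmoothMat (U : Set M) (A : M → Matrix (Fin n) (Fin n) ℝ) : Prop :=
  ∀ a b, SmoothFn n U (fun y => A y a b)

/-- The entrywise partial derivative `∂_i A` of a matrix-valued function. -/
def pdMat (e : OpenPartialHomeomorph M (Model n)) (i : Fin n) (A : M → Matrix (Fin n) (Fin n) ℝ)
    (x : M) : Matrix (Fin n) (Fin n) ℝ :=
  Matrix.of fun a b => pd e i (fun y => A y a b) x

/-- The differential of `f`, as the vector of its partial derivatives in the chart `e`. -/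
def dVec (e : OpenPartialHomeomorph M (Model n)) (f : M → ℝ) (x : M) : Fin n → ℝ :=
  fun i => pd e i f x

theorem SmoothMat.mul (hA : SmoothMat U A) (hB : SmoothMat U B) :
    SmoothMat U (fun y => A y * B y) := fun a b => by
  simp only [Matrix.mul_apply]
  exact SmoothFn.sum fun c _ => SmoothFn.mul (hA a c) (hB c b)

theorem SmoothMat.transpose (hA : SmoothMat U A) : SmoothMat U (fun y => (A y).transpose) :=
  fun a b => hA b a

theorem SmoothMat.sum_smul {ι : Type*} {s : Finset ι} {c : ι → M → ℝ}
    {A : ι → M → Matrix (Fin n) (Fin n) ℝ} (hc : ∀ i ∈ s, SmoothFn n U (c i))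
    (hA : ∀ i ∈ s, SmoothMat U (A i)) : SmoothMat U (fun y => ∑ i ∈ s, c i y • A i y) :=
  fun a b => by
    simp only [Matrix.sum_apply, Matrix.smul_apply, smul_eq_mul]
    exact SmoothFn.sum fun i hi => SmoothFn.mul (hc i hi) (hA i hi a b)

theorem SmoothMat.congr (hA : SmoothMat U A) (h : ∀ y ∈ U, B y = A y) : SmoothMat U B :=
  fun a b => (hA a b).congr fun y hy => by rw [h y hy]

theorem IsChartOn.smooth_transMat (he : IsChartOn e U) (hφ : IsChartOn φ U) :
    SmoothMat U (transMat e φ) := fun a i => he.smooth_pd (hφ.smooth_coordFn a) i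

theorem IsChartOn.smooth_pdMat (h : IsChartOn e U) (hA : SmoothMat U A) (i : Fin n) :
    SmoothMat U (pdMat e i A) := fun a b => h.smooth_pd (hA a b) i

theorem IsChartOn.pdMat_congr (h : IsChartOn e U) (hAB : ∀ y ∈ U, A y = B y) (hx : x ∈ U)
    (i : Fin n) : pdMat e i A x = pdMat e i B x := by
  ext a b
  exact h.pd_congr (fun y hy => by simp only [hAB y hy]) hx i

theorem IsChartOn.pdMat_mul (h : IsChartOn e U) (hA : SmoothMat U A) (hB : SmoothMat U B)
    (hx : x ∈ U) (i : Fin n) :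
    pdMat e i (fun y => A y * B y) x = pdMat e i A x * B x + A x * pdMat e i B x := by
  ext a b
  simp only [pdMat, Matrix.of_apply, Matrix.add_apply, Matrix.mul_apply]
  rw [h.pd_sum (fun c _ => SmoothFn.mul (hA a c) (hB c b)) hx, ← Finset.sum_add_distrib]
  exact Finset.sum_congr rfl fun c _ => h.pd_mul (hA a c) (hB c b) hx i

theorem IsChartOn.pdMat_add (h : IsChartOn e U) (hA : SmoothMat U A) (hB : SmoothMat U B)
    (hx : x ∈ U) (i : Fin n) :
    pdMat e i (fun y => A y + B y) x = pdMat e i A x + pdMat e i B x := by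
  ext a b
  exact h.pd_add (hA a b) (hB a b) hx i

theorem IsChartOn.pdMat_sum_smul (h : IsChartOn e U) {ι : Type*} {s : Finset ι} {c : ι → M → ℝ}
    {A : ι → M → Matrix (Fin n) (Fin n) ℝ} (hc : ∀ i ∈ s, SmoothFn n U (c i))
    (hA : ∀ i ∈ s, SmoothMat U (A i)) (hx : x ∈ U) (k : Fin n) :
    pdMat e k (fun y => ∑ i ∈ s, c i y • A i y) x =
      ∑ i ∈ s, (pd e k (c i) x • A i x + c i x • pdMat e k (A i) x) := by
  ext a b
  simp only [pdMat, Matrix.of_apply, Matrix.add_apply, Matrix.sum_apply, Matrix.smul_apply,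
    smul_eq_mul]
  rw [h.pd_sum (fun i hi => SmoothFn.mul (hc i hi) (hA i hi a b)) hx]
  exact Finset.sum_congr rfl fun i hi => h.pd_mul (hc i hi) (hA i hi a b) hx k

theorem pdMat_transpose (i : Fin n) :
    pdMat e i (fun y => (A y).transpose) x = (pdMat e i A x).transpose := rfl

theorem IsChartOn.pdMat_chain (he : IsChartOn e U) (hφ : IsChartOn φ U) (hA : SmoothMat U A)
    (hx : x ∈ U) (i : Fin n) :
    pdMat e i A x = ∑ c, transMat e φ x c i • pdMat φ c A x := by
  ext a b
  simp only [pdMat, Matrix.of_apply, Matrix.sum_apply, Matrix.smul_apply, smul_eq_mul]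
  exact he.pd_chain hφ (hA a b) hx i

theorem IsChartOn.dVec_chain (he : IsChartOn e U) (hφ : IsChartOn φ U) (hf : SmoothFn n U f)
    (hx : x ∈ U) : dVec e f x = Matrix.vecMul (dVec φ f x) (transMat e φ x) := by
  ext i
  simp only [dVec, Matrix.vecMul, dotProduct]
  rw [he.pd_chain hφ hf hx]
  exact Finset.sum_congr rfl fun a _ => mul_comm _ _

/-- Second partial derivatives commute, for the coordinates of `φ` as functions of those of `e`. -/
theorem IsChartOn.pdMat_transMat_symm (he : IsChartOn e U) (hφ : IsChartOn φ U) (hx : x ∈ U)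
    (i j a : Fin n) :
    pdMat e i (transMat e φ) x a j = pdMat e j (transMat e φ) x a i :=
  he.pd_comm (hφ.smooth_coordFn a) hx i j

/-- Second partial derivatives of a matrix-valued function commute. -/
theorem IsChartOn.pdMat_comm (he : IsChartOn e U) (hA : SmoothMat U A) (hx : x ∈ U)
    (i j : Fin n) : pdMat e i (pdMat e j A) x = pdMat e j (pdMat e i A) x := by
  ext a b
  exact he.pd_comm (hA a b) hx i j

end MatrixCalculus

/-! ### Covariance of the Levi-Civita connection and its curvature -/

section Covariance

variable {n : ℕ} {M : Type*} [TopologicalSpace M] [ChartedSpace (Model n) M]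
  [IsManifold (𝓡 n) ∞ M]

variable {e φ : OpenPartialHomeomorph M (Model n)} {U : Set M} {f f' : M → ℝ} {x : M}
  {g : BilinField (n := n) M}

/-- In the chart `e`, the components of `g` form a smooth field of invertible symmetric matrices on
`U` whose inverse is smooth. -/
structure IsMetricOn (e : OpenPartialHomeomorph M (Model n)) (g : BilinField (n := n) M)
    (U : Set M) : Prop where
  smooth : SmoothMat U (comp e g)
  smooth_inv : SmoothMat U (compInv e g)
  symm : ∀ x ∈ U, (comp e g x).transpose = comp e g x
  inv_mul : ∀ x ∈ U, compInv e g x * comp e g x = 1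

theorem IsMetricOn.mul_inv (hg : IsMetricOn e g U) (hx : x ∈ U) :
    comp e g x * compInv e g x = 1 :=
  mul_eq_one_comm.1 (hg.inv_mul x hx)

theorem IsMetricOn.comp_symm (hg : IsMetricOn e g U) (hx : x ∈ U) (i j : Fin n) :
    comp e g x i j = comp e g x j i :=
  congrFun (congrFun (hg.symm x hx) j) i

theorem IsChartOn.compInv_chain (he : IsChartOn e U) (hφ : IsChartOn φ U)
    (hg : IsMetricOn φ g U) (hx : x ∈ U) :
    compInv e g x = transMat φ e x * compInv φ g x * (transMat φ e x).transpose := by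
  have hKJ := he.transMat_mul hφ hx
  have hJK := hφ.transMat_mul he hx
  have hKJ' : (transMat e φ x).transpose * (transMat φ e x).transpose = 1 := by
    rw [← Matrix.transpose_mul, hKJ, Matrix.transpose_one]
  have hJK' : (transMat φ e x).transpose * (transMat e φ x).transpose = 1 := by
    rw [← Matrix.transpose_mul, hJK, Matrix.transpose_one]
  unfold compInv
  refine Matrix.inv_eq_left_inv ?_
  rw [he.comp_chain hφ hx]
  calc transMat φ e x * (comp φ g x)⁻¹ * (transMat φ e x).transpose *
        ((transMat e φ x).transpose * comp φ g x * transMat e φ x)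
      = transMat φ e x * (comp φ g x)⁻¹ *
        ((transMat φ e x).transpose * (transMat e φ x).transpose) *
          comp φ g x * transMat e φ x := by simp only [Matrix.mul_assoc]
    _ = transMat φ e x * ((comp φ g x)⁻¹ * comp φ g x) * transMat e φ x := by
        rw [hJK']; simp only [Matrix.mul_assoc, Matrix.one_mul]
    _ = 1 := by
        have := hg.inv_mul x hx
        unfold compInv at this
        rw [this, Matrix.mul_one, hKJ]

theorem IsMetricOn.change (he : IsChartOn e U) (hφ : IsChartOn φ U) (hg : IsMetricOn φ g U) :
    IsMetricOn e g U := by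
  have hc : ∀ x ∈ U, comp e g x = _ := fun x hx => he.comp_chain hφ hx
  have hi : ∀ x ∈ U, compInv e g x = _ := fun x hx => he.compInv_chain hφ hg hx
  refine ⟨?_, ?_, fun x hx => ?_, fun x hx => ?_⟩
  · exact (((he.smooth_transMat hφ).transpose.mul hg.smooth).mul
      (he.smooth_transMat hφ)).congr hc
  · exact (((hφ.smooth_transMat he).mul hg.smooth_inv).mul
      (hφ.smooth_transMat he).transpose).congr hi
  · rw [hc x hx]
    simp only [Matrix.transpose_mul, Matrix.transpose_transpose, hg.symm x hx, Matrix.mul_assoc]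
  · have h1 : IsUnit (comp e g x).det := by
      rw [hc x hx, Matrix.det_mul, Matrix.det_mul, Matrix.det_transpose]
      exact ((he.isUnit_transMat hφ hx).mul
        (Matrix.isUnit_det_of_left_inverse (hg.inv_mul x hx))).mul (he.isUnit_transMat hφ hx)
    exact Matrix.nonsing_inv_mul _ h1

/-- The matrix `(Γ_i)^k_j = Γ^k_{ij}` of the connection. -/
def connMat (e : OpenPartialHomeomorph M (Model n)) (g : BilinField (n := n) M) (i : Fin n)
    (x : M) : Matrix (Fin n) (Fin n) ℝ :=
  Matrix.of fun k j => christoffel e g k i j x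

theorem IsMetricOn.smooth_connMat (he : IsChartOn e U) (hg : IsMetricOn e g U) (i : Fin n) :
    SmoothMat U (connMat e g i) := fun k j => by
  have h : ∀ a b c, SmoothFn n U (pd e a (fun y => comp e g y b c)) :=
    fun a b c => he.smooth_pd (hg.smooth b c) a
  simp only [connMat, Matrix.of_apply, christoffel]
  exact SmoothFn.mul (SmoothFn.const _) (SmoothFn.sum fun l _ =>
    SmoothFn.mul (hg.smooth_inv k l) (SmoothFn.sub (SmoothFn.add (h _ _ _) (h _ _ _)) (h _ _ _)))

theorem IsMetricOn.christoffel_symm (he : IsChartOn e U) (hg : IsMetricOn e g U) (hx : x ∈ U)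
    (k i j : Fin n) : christoffel e g k i j x = christoffel e g k j i x := by
  have h : ∀ l, pd e l (fun y => comp e g y i j) x = pd e l (fun y => comp e g y j i) x :=
    fun l => he.pd_congr (fun y hy => hg.comp_symm hy i j) hx l
  simp only [christoffel, h]
  congr 1
  exact Finset.sum_congr rfl fun l _ => by ring

/-- The Levi-Civita connection is compatible with the metric. -/
theorem IsMetricOn.pdMat_comp (he : IsChartOn e U) (hg : IsMetricOn e g U) (hx : x ∈ U)
    (i : Fin n) :
    pdMat e i (comp e g) x =
      (connMat e g i x).transpose * comp e g x + comp e g x * connMat e g i x := by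
  -- The Christoffel symbols with the upper index lowered.
  have key : ∀ l i j, (comp e g x * connMat e g i x) l j = (1 / 2 : ℝ) *
      (pd e i (fun y => comp e g y j l) x + pd e j (fun y => comp e g y i l) x
        - pd e l (fun y => comp e g y i j) x) := by
    intro l i j
    set v : Fin n → ℝ := fun l => (1 / 2 : ℝ) * (pd e i (fun y => comp e g y j l) x
      + pd e j (fun y => comp e g y i l) x - pd e l (fun y => comp e g y i j) x) with hv
    have h1 : (fun k => connMat e g i x k j) = (compInv e g x).mulVec v := by
      ext k
      simp only [connMat, Matrix.of_apply, christoffel, Matrix.mulVec, dotProduct, hv,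
        Finset.mul_sum]
      exact Finset.sum_congr rfl fun l _ => by ring
    have h2 : (comp e g x * connMat e g i x) l j
        = (comp e g x).mulVec (fun k => connMat e g i x k j) l := rfl
    rw [h2, h1, Matrix.mulVec_mulVec, hg.mul_inv hx, Matrix.one_mulVec]
  have ht : (connMat e g i x).transpose * comp e g x =
      (comp e g x * connMat e g i x).transpose := by
    rw [Matrix.transpose_mul, hg.symm x hx]
  have hs : ∀ a b c, pd e a (fun y => comp e g y b c) x = pd e a (fun y => comp e g y c b) x :=
    fun a b c => he.pd_congr (fun y hy => hg.comp_symm hy b c) hx a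
  ext a b
  rw [ht, Matrix.add_apply, Matrix.transpose_apply, key, key]
  simp only [pdMat, Matrix.of_apply]
  rw [hs i b a]
  rw [hs b i a, hs a i b]
  ring

/-- Uniqueness of the Levi-Civita connection: a symmetric connection compatible with the metric
is given by the Christoffel symbols. -/
theorem IsMetricOn.connMat_eq (hg : IsMetricOn e g U) (hx : x ∈ U)
    (C : Fin n → Matrix (Fin n) (Fin n) ℝ) (hC : ∀ i j k, C i k j = C j k i)
    (hcomp : ∀ i, pdMat e i (comp e g) x = (C i).transpose * comp e g x + comp e g x * C i)
    (i : Fin n) : connMat e g i x = C i := by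
  have hT : ∀ i j l, pd e i (fun y => comp e g y j l) x =
      (comp e g x * C i) l j + (comp e g x * C i) j l := by
    intro i j l
    have h1 := congrFun (congrFun (hcomp i) j) l
    have ht : (C i).transpose * comp e g x = (comp e g x * C i).transpose := by
      rw [Matrix.transpose_mul, hg.symm x hx]
    rw [ht] at h1
    exact h1
  have hS : ∀ i j l, (comp e g x * C i) l j = (comp e g x * C j) l i := by
    intro i j l
    simp only [Matrix.mul_apply, hC i j]
  ext k j
  have h2 : connMat e g i x k j = (compInv e g x * (comp e g x * C i)) k j := by
    simp only [connMat, Matrix.of_apply, christoffel, hT]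
    rw [Matrix.mul_apply, Finset.mul_sum]
    refine Finset.sum_congr rfl fun l _ => ?_
    rw [hS l j i, hS l i j, hS j i l]
    ring
  rw [h2, ← Matrix.mul_assoc, hg.inv_mul x hx, Matrix.one_mul]

/-- The connection matrix of the chart `φ` in the direction of the `i`-th coordinate of `e`. -/
def pullConn (e φ : OpenPartialHomeomorph M (Model n)) (g : BilinField (n := n) M) (i : Fin n)
    (x : M) : Matrix (Fin n) (Fin n) ℝ :=
  ∑ c, transMat e φ x c i • connMat φ g c x

/-- The transformation law of the connection under a change of chart. -/
theorem IsMetricOn.transMat_mul_connMat (he : IsChartOn e U) (hφ : IsChartOn φ U)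
    (hg : IsMetricOn φ g U) (hx : x ∈ U) (i : Fin n) :
    transMat e φ x * connMat e g i x =
      pdMat e i (transMat e φ) x + pullConn e φ g i x * transMat e φ x := by
  set J := transMat e φ with hJ
  set K := transMat φ e with hK
  have hKJ : K x * J x = 1 := he.transMat_mul hφ hx
  have hJK : J x * K x = 1 := hφ.transMat_mul he hx
  have hge : IsMetricOn e g U := hg.change he hφ
  have hsJ : SmoothMat U J := he.smooth_transMat hφ
  -- The candidate for the connection in the chart `e`: it is symmetric and compatible with the
  -- metric, so it is the Levi-Civita connection.
  set C : Fin n → Matrix (Fin n) (Fin n) ℝ :=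
    fun i => K x * (pdMat e i J x + pullConn e φ g i x * J x) with hCdef
  have hJC : ∀ i, J x * C i = pdMat e i J x + pullConn e φ g i x * J x := by
    intro i
    rw [hCdef]
    simp only
    rw [← Matrix.mul_assoc, hJK, Matrix.one_mul]
  have hCs : ∀ i j k, C i k j = C j k i := by
    intro i j k
    simp only [hCdef, Matrix.mul_apply]
    refine Finset.sum_congr rfl fun a _ => ?_
    congr 1
    rw [Matrix.add_apply, Matrix.add_apply, hJ, he.pdMat_transMat_symm hφ hx i j a]
    congr 1
    simp only [Matrix.mul_apply, pullConn, Matrix.sum_apply, Matrix.smul_apply, smul_eq_mul,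
      Finset.sum_mul, connMat, Matrix.of_apply]
    rw [Finset.sum_comm]
    refine Finset.sum_congr rfl fun c _ => Finset.sum_congr rfl fun b _ => ?_
    rw [hg.christoffel_symm hφ hx a b c]
    ring
  have hpull : ∀ i, pdMat e i (comp φ g) x =
      (pullConn e φ g i x).transpose * comp φ g x + comp φ g x * pullConn e φ g i x := by
    intro i
    rw [he.pdMat_chain hφ hg.smooth hx]
    simp only [hg.pdMat_comp hφ hx, pullConn, Matrix.transpose_sum, Matrix.transpose_smul,
      Matrix.sum_mul, Matrix.mul_sum, Matrix.smul_mul, Matrix.mul_smul, smul_add,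
      Finset.sum_add_distrib]
  have hcomp : ∀ i, pdMat e i (comp e g) x = (C i).transpose * comp e g x + comp e g x * C i := by
    intro i
    have h1 : pdMat e i (comp e g) x =
        pdMat e i (fun y => (J y).transpose * comp φ g y * J y) x :=
      he.pdMat_congr (fun y hy => he.comp_chain hφ hy) hx i
    rw [h1, he.pdMat_mul (hsJ.transpose.mul hg.smooth) hsJ hx,
      he.pdMat_mul hsJ.transpose hg.smooth hx, pdMat_transpose, hpull, he.comp_chain hφ hx]
    have h2 : (C i).transpose * (J x).transpose =
        (pdMat e i J x).transpose + (J x).transpose * (pullConn e φ g i x).transpose := by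
      rw [← Matrix.transpose_mul, hJC, Matrix.transpose_add, Matrix.transpose_mul]
    have h3 : (C i).transpose * ((J x).transpose * comp φ g x * J x) =
        ((C i).transpose * (J x).transpose) * comp φ g x * J x := by
      simp only [Matrix.mul_assoc]
    have h4 : (J x).transpose * comp φ g x * J x * C i =
        (J x).transpose * comp φ g x * (J x * C i) := by
      simp only [Matrix.mul_assoc]
    rw [h3, h4, h2, hJC]
    noncomm_ring
  rw [hge.connMat_eq hx C hCs hcomp i, hJC]

/-- The curvature matrix `R_{ki} = ∂_k Γ_i - ∂_i Γ_k + [Γ_k, Γ_i]`. -/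
def curvMat (e : OpenPartialHomeomorph M (Model n)) (g : BilinField (n := n) M) (k i : Fin n)
    (x : M) : Matrix (Fin n) (Fin n) ℝ :=
  pdMat e k (connMat e g i) x - pdMat e i (connMat e g k) x
    + (connMat e g k x * connMat e g i x - connMat e g i x * connMat e g k x)

/-- The curvature is a tensor. The equation is the integrability condition obtained by
differentiating the transformation law of the connection once more. -/
theorem IsMetricOn.transMat_mul_curvMat (he : IsChartOn e U) (hφ : IsChartOn φ U)
    (hg : IsMetricOn φ g U) (hx : x ∈ U) (k i : Fin n) :
    transMat e φ x * curvMat e g k i x =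
      (∑ d, ∑ c, (transMat e φ x d k * transMat e φ x c i) • curvMat φ g d c x)
        * transMat e φ x := by
  set J := transMat e φ with hJ
  have hge : IsMetricOn e g U := hg.change he hφ
  have hsJ : SmoothMat U J := he.smooth_transMat hφ
  have hsA : ∀ i, SmoothMat U (pullConn e φ g i) := fun i =>
    SmoothMat.sum_smul (fun c _ => hsJ c i) (fun c _ => hg.smooth_connMat hφ c)
  have hlaw : ∀ i, ∀ y ∈ U, J y * connMat e g i y = pdMat e i J y + pullConn e φ g i y * J y :=
    fun i y hy => hg.transMat_mul_connMat he hφ hy i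
  have hd : ∀ k i, pdMat e k J x * connMat e g i x + J x * pdMat e k (connMat e g i) x =
      pdMat e k (pdMat e i J) x + (pdMat e k (pullConn e φ g i) x * J x
        + pullConn e φ g i x * pdMat e k J x) := by
    intro k i
    rw [← he.pdMat_mul hsJ (hge.smooth_connMat he i) hx, he.pdMat_congr (hlaw i) hx,
      he.pdMat_add (he.smooth_pdMat hsJ i) ((hsA i).mul hsJ) hx, he.pdMat_mul (hsA i) hsJ hx]
  -- The curvature of the pulled back connection is the pulled back curvature.
  have hF : pdMat e k (pullConn e φ g i) x - pdMat e i (pullConn e φ g k) x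
      + (pullConn e φ g k x * pullConn e φ g i x - pullConn e φ g i x * pullConn e φ g k x)
      = ∑ d, ∑ c, (J x d k * J x c i) • curvMat φ g d c x := by
    have h1 : ∀ k i, pdMat e k (pullConn e φ g i) x =
        ∑ c, pdMat e k J x c i • connMat φ g c x
          + ∑ d, ∑ c, (J x d k * J x c i) • pdMat φ d (connMat φ g c) x := by
      intro k i
      have := he.pdMat_sum_smul (fun c _ => hsJ c i) (fun c _ => hg.smooth_connMat hφ c) hx k
        (s := Finset.univ)
      rw [show pullConn e φ g i = fun y => ∑ c, J y c i • connMat φ g c y from rfl, this,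
        Finset.sum_add_distrib]
      congr 1
      rw [Finset.sum_comm]
      refine Finset.sum_congr rfl fun c _ => ?_
      rw [he.pdMat_chain hφ (hg.smooth_connMat hφ c) hx, Finset.smul_sum]
      exact Finset.sum_congr rfl fun d _ => by rw [smul_smul, mul_comm]
    have h2 : ∑ c, pdMat e k J x c i • connMat φ g c x = ∑ c, pdMat e i J x c k • connMat φ g c x :=
      Finset.sum_congr rfl fun c _ => by rw [hJ, he.pdMat_transMat_symm hφ hx k i c]
    have h3 : ∀ k i, pullConn e φ g k x * pullConn e φ g i x =
        ∑ d, ∑ c, (J x d k * J x c i) • (connMat φ g d x * connMat φ g c x) := by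
      intro k i
      simp only [pullConn, Matrix.sum_mul, Matrix.mul_sum, Matrix.smul_mul, Matrix.mul_smul,
        Finset.smul_sum, smul_smul]
      rw [Finset.sum_comm]
      exact Finset.sum_congr rfl fun d _ => Finset.sum_congr rfl fun c _ => by rw [mul_comm]
    have h4 : ∀ T : Fin n → Fin n → Matrix (Fin n) (Fin n) ℝ,
        ∑ d, ∑ c, (J x d i * J x c k) • T d c = ∑ d, ∑ c, (J x d k * J x c i) • T c d := by
      intro T
      rw [Finset.sum_comm]
      exact Finset.sum_congr rfl fun d _ => Finset.sum_congr rfl fun c _ => by rw [mul_comm]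
    rw [h1, h1, h2, h3, h3, h4, h4 (fun d c => connMat φ g d x * connMat φ g c x)]
    simp only [curvMat, smul_add, smul_sub, Finset.sum_add_distrib, Finset.sum_sub_distrib]
    abel
  have e1 := hd k i
  have e2 := hd i k
  have e3 := he.pdMat_comm hsJ hx k i
  have l1 : pdMat e k J x = J x * connMat e g k x - pullConn e φ g k x * J x := by
    rw [hlaw k x hx]; abel
  have l2 : pdMat e i J x = J x * connMat e g i x - pullConn e φ g i x * J x := by
    rw [hlaw i x hx]; abel
  rw [l1] at e1
  rw [l2] at e2
  have f1 : J x * pdMat e k (connMat e g i) x = pdMat e k (pdMat e i J) x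
      + (pdMat e k (pullConn e φ g i) x * J x
        + pullConn e φ g i x * (J x * connMat e g k x - pullConn e φ g k x * J x))
      - (J x * connMat e g k x - pullConn e φ g k x * J x) * connMat e g i x := by
    rw [← e1]; abel
  have f2 : J x * pdMat e i (connMat e g k) x = pdMat e k (pdMat e i J) x
      + (pdMat e i (pullConn e φ g k) x * J x
        + pullConn e φ g k x * (J x * connMat e g i x - pullConn e φ g i x * J x))
      - (J x * connMat e g i x - pullConn e φ g i x * J x) * connMat e g k x := by
    rw [e3, ← e2]; abel
  rw [← hF]
  unfold curvMat
  rw [mul_add, mul_sub, f1, f2]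
  noncomm_ring

end Covariance

/-! ### Covariance of the remaining tensors -/

section Tensors

variable {n : ℕ} {M : Type*} [TopologicalSpace M] [ChartedSpace (Model n) M]
  [IsManifold (𝓡 n) ∞ M]

variable {e φ : OpenPartialHomeomorph M (Model n)} {U : Set M} {f f' : M → ℝ} {x : M}
  {g : BilinField (n := n) M}

/-- The entries of `Jᵀ S J`. With `J` the Jacobian matrix of a change of chart this is the
transformation law of covariant tensors of rank two. -/
theorem conj_apply {S J : Matrix (Fin n) (Fin n) ℝ} (i j : Fin n) :
    (J.transpose * S * J) i j = ∑ a, ∑ b, J a i * J b j * S a b := by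
  simp only [Matrix.mul_apply, Matrix.transpose_apply, Finset.sum_mul]
  rw [Finset.sum_comm]
  exact Finset.sum_congr rfl fun a _ => Finset.sum_congr rfl fun b _ => by ring

/-- The Ricci tensor as a matrix-valued function. -/
def ricciMat (e : OpenPartialHomeomorph M (Model n)) (g : BilinField (n := n) M) (x : M) :
    Matrix (Fin n) (Fin n) ℝ :=
  Matrix.of fun i j => ricci e g i j x

/-- The Ricci tensor is a trace of the curvature. -/
theorem IsMetricOn.ricci_eq_sum_curvMat (he : IsChartOn e U) (hg : IsMetricOn e g U) (hx : x ∈ U)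
    (i j : Fin n) : ricci e g i j x = ∑ k, curvMat e g k j x k i := by
  unfold ricci
  refine Finset.sum_congr rfl fun k _ => ?_
  have hs := fun {y} (hy : y ∈ U) => hg.christoffel_symm he hy
  simp only [curvMat, Matrix.add_apply, Matrix.sub_apply, pdMat, Matrix.mul_apply, connMat,
    Matrix.of_apply]
  rw [he.pd_congr (fun y hy => hs hy k i j) hx k, he.pd_congr (fun y hy => hs hy k i k) hx j,
    Finset.sum_sub_distrib]
  simp only [hs hx _ i]

theorem IsMetricOn.ricciMat_chain (he : IsChartOn e U) (hφ : IsChartOn φ U)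
    (hg : IsMetricOn φ g U) (hx : x ∈ U) :
    ricciMat e g x = (transMat e φ x).transpose * ricciMat φ g x * transMat e φ x := by
  have hge := hg.change he hφ
  set J := transMat e φ x with hJ
  set K := transMat φ e x with hK
  have hKJ : K * J = 1 := he.transMat_mul hφ hx
  have hJK : J * K = 1 := hφ.transMat_mul he hx
  have hR : ∀ k i, curvMat e g k i x =
      K * ((∑ d, ∑ c, (J d k * J c i) • curvMat φ g d c x) * J) := by
    intro k i
    rw [hJ, ← hg.transMat_mul_curvMat he hφ hx, ← Matrix.mul_assoc, ← hJ, hKJ, Matrix.one_mul]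
  have hδ : ∀ d a, ∑ k, J d k * K k a = if d = a then 1 else 0 := by
    intro d a
    rw [← Matrix.mul_apply, hJK, Matrix.one_apply]
  ext i j
  rw [conj_apply]
  simp only [ricciMat, Matrix.of_apply]
  rw [hge.ricci_eq_sum_curvMat he hx]
  simp only [hg.ricci_eq_sum_curvMat hφ hx, hR]
  calc ∑ k, (K * ((∑ d, ∑ c, (J d k * J c j) • curvMat φ g d c x) * J)) k i
      = ∑ k, ∑ a, ∑ d, ∑ c, ∑ b, (J d k * K k a) * (J b i * J c j * curvMat φ g d c x a b) := by
        simp only [Matrix.mul_apply, Matrix.sum_apply, Matrix.smul_apply, smul_eq_mul,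
          Finset.sum_mul, Finset.mul_sum]
        refine Finset.sum_congr rfl fun k _ => Finset.sum_congr rfl fun a _ => ?_
        refine Finset.sum_congr rfl fun d _ => ?_
        exact Finset.sum_congr rfl fun c _ => Finset.sum_congr rfl fun b _ => by ring
    _ = ∑ a, ∑ d, ∑ c, ∑ b, (∑ k, J d k * K k a) * (J b i * J c j * curvMat φ g d c x a b) := by
        rw [Finset.sum_comm]
        refine Finset.sum_congr rfl fun a _ => ?_
        rw [Finset.sum_comm]
        refine Finset.sum_congr rfl fun d _ => ?_
        rw [Finset.sum_comm]
        refine Finset.sum_congr rfl fun c _ => ?_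
        rw [Finset.sum_comm]
        refine Finset.sum_congr rfl fun b _ => ?_
        rw [Finset.sum_mul]
    _ = ∑ a, ∑ c, ∑ b, J b i * J c j * curvMat φ g a c x a b := by
        simp only [hδ, ite_mul, one_mul, zero_mul]
        refine Finset.sum_congr rfl fun a _ => ?_
        rw [Finset.sum_eq_single a (fun d _ hd => by simp [hd]) (by simp)]
        simp
    _ = ∑ b, ∑ c, J b i * J c j * ∑ k, curvMat φ g k c x k b := by
        simp only [Finset.mul_sum]
        rw [Finset.sum_comm]
        calc ∑ c, ∑ a, ∑ b, J b i * J c j * curvMat φ g a c x a b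
            = ∑ c, ∑ b, ∑ a, J b i * J c j * curvMat φ g a c x a b :=
              Finset.sum_congr rfl fun c _ => Finset.sum_comm
          _ = _ := Finset.sum_comm

theorem scal_eq_trace : scal e g x = (compInv e g x * (ricciMat e g x).transpose).trace := by
  simp only [scal, Matrix.trace, Matrix.diag_apply, Matrix.mul_apply, Matrix.transpose_apply,
    ricciMat, Matrix.of_apply]

theorem IsMetricOn.scal_chain (he : IsChartOn e U) (hφ : IsChartOn φ U)
    (hg : IsMetricOn φ g U) (hx : x ∈ U) : scal e g x = scal φ g x := by
  rw [scal_eq_trace, scal_eq_trace, hg.ricciMat_chain he hφ hx, he.compInv_chain hφ hg hx]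
  set J := transMat e φ x
  set K := transMat φ e x
  have hKJ : K * J = 1 := he.transMat_mul hφ hx
  have hJK : J * K = 1 := hφ.transMat_mul he hx
  have hKJ' : K.transpose * J.transpose = 1 := by
    rw [← Matrix.transpose_mul, hJK, Matrix.transpose_one]
  simp only [Matrix.transpose_mul, Matrix.transpose_transpose]
  calc (K * compInv φ g x * K.transpose *
        (J.transpose * ((ricciMat φ g x).transpose * J))).trace
      = (K * (compInv φ g x * (K.transpose * J.transpose) *
          (ricciMat φ g x).transpose * J)).trace := by simp only [Matrix.mul_assoc]
    _ = ((compInv φ g x * (ricciMat φ g x).transpose) * (J * K)).trace := by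
        rw [hKJ', Matrix.trace_mul_comm]; simp only [Matrix.mul_assoc, Matrix.one_mul]
    _ = _ := by rw [hJK, Matrix.mul_one]

/-- The Schouten tensor as a matrix-valued function. -/
def schoutenMat (e : OpenPartialHomeomorph M (Model n)) (g : BilinField (n := n) M) (x : M) :
    Matrix (Fin n) (Fin n) ℝ :=
  Matrix.of fun i j => schouten e g i j x

theorem schoutenMat_eq : schoutenMat e g x = (1 / ((n : ℝ) - 2)) •
    (ricciMat e g x - (scal e g x / (2 * ((n : ℝ) - 1))) • comp e g x) := rfl

theorem IsMetricOn.schoutenMat_chain (he : IsChartOn e U) (hφ : IsChartOn φ U)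
    (hg : IsMetricOn φ g U) (hx : x ∈ U) :
    schoutenMat e g x = (transMat e φ x).transpose * schoutenMat φ g x * transMat e φ x := by
  rw [schoutenMat_eq, schoutenMat_eq, hg.ricciMat_chain he hφ hx, hg.scal_chain he hφ hx,
    he.comp_chain hφ hx]
  simp only [Matrix.mul_smul, Matrix.smul_mul, Matrix.mul_sub, Matrix.sub_mul]

/-- The Hessian as a matrix-valued function. -/
def hessMat (e : OpenPartialHomeomorph M (Model n)) (g : BilinField (n := n) M) (f : M → ℝ)
    (x : M) : Matrix (Fin n) (Fin n) ℝ :=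
  Matrix.of fun i j => hess e g f i j x

theorem IsMetricOn.hessMat_chain (he : IsChartOn e U) (hφ : IsChartOn φ U)
    (hg : IsMetricOn φ g U) (hf : SmoothFn n U f) (hx : x ∈ U) :
    hessMat e g f x = (transMat e φ x).transpose * hessMat φ g f x * transMat e φ x := by
  have hsJ := he.smooth_transMat hφ
  ext i j
  rw [conj_apply]
  simp only [hessMat, Matrix.of_apply, hess]
  have h1 : pd e i (pd e j f) x = ∑ a, (pdMat e i (transMat e φ) x a j * pd φ a f x
      + transMat e φ x a j * ∑ b, transMat e φ x b i * pd φ b (pd φ a f) x) := by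
    rw [he.pd_congr (f' := fun y => ∑ a, transMat e φ y a j * pd φ a f y)
      (fun y hy => he.pd_chain hφ hf hy j) hx,
      he.pd_sum (fun a _ => SmoothFn.mul (hsJ a j) (hφ.smooth_pd hf a)) hx]
    refine Finset.sum_congr rfl fun a _ => ?_
    rw [he.pd_mul (hsJ a j) (hφ.smooth_pd hf a) hx, he.pd_chain hφ (hφ.smooth_pd hf a) hx i]
    rfl
  have h2 : ∑ k, christoffel e g k i j x * pd e k f x =
      ∑ a, (transMat e φ x * connMat e g i x) a j * pd φ a f x := by
    simp only [he.pd_chain hφ hf hx, Matrix.mul_apply, connMat, Matrix.of_apply, Finset.mul_sum,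
      Finset.sum_mul]
    rw [Finset.sum_comm]
    exact Finset.sum_congr rfl fun a _ => Finset.sum_congr rfl fun b _ => by ring
  have h3 : ∀ a, (pullConn e φ g i x * transMat e φ x) a j =
      ∑ c, ∑ b, transMat e φ x c i * transMat e φ x b j * christoffel φ g a c b x := by
    intro a
    simp only [pullConn, Matrix.sum_apply, Matrix.smul_apply,
      smul_eq_mul, Matrix.mul_apply, connMat, Matrix.of_apply, Finset.sum_mul]
    rw [Finset.sum_comm]
    exact Finset.sum_congr rfl fun a _ => Finset.sum_congr rfl fun b _ => by ring
  rw [h1, h2, hg.transMat_mul_connMat he hφ hx]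
  simp only [Matrix.add_apply, h3, add_mul, Finset.sum_add_distrib]
  rw [add_sub_add_left_eq_sub]
  simp only [mul_sub, Finset.sum_sub_distrib]
  congr 1
  · simp only [Finset.mul_sum]
    rw [Finset.sum_comm]
    exact Finset.sum_congr rfl fun a _ => Finset.sum_congr rfl fun b _ => by ring
  · simp only [Finset.mul_sum, Finset.sum_mul]
    rw [Finset.sum_comm]
    refine Finset.sum_congr rfl fun c _ => ?_
    rw [Finset.sum_comm]
    exact Finset.sum_congr rfl fun a _ => Finset.sum_congr rfl fun b _ => by ring

theorem gradInner_eq :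
    gradInner e g f f' x = dVec e f x ⬝ᵥ (compInv e g x).mulVec (dVec e f' x) := by
  simp only [gradInner, dVec, dotProduct, Matrix.mulVec, Finset.mul_sum]
  exact Finset.sum_congr rfl fun a _ => Finset.sum_congr rfl fun b _ => by ring

theorem IsMetricOn.mulVec_dVec_chain (he : IsChartOn e U) (hφ : IsChartOn φ U)
    (hg : IsMetricOn φ g U) (hf : SmoothFn n U f) (hx : x ∈ U) :
    (compInv e g x).mulVec (dVec e f x) =
      (transMat φ e x).mulVec ((compInv φ g x).mulVec (dVec φ f x)) := by
  have hJK := hφ.transMat_mul he hx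
  rw [he.dVec_chain hφ hf hx, he.compInv_chain hφ hg hx, ← Matrix.mulVec_transpose,
    Matrix.mulVec_mulVec, Matrix.mulVec_mulVec, Matrix.mul_assoc, ← Matrix.transpose_mul, hJK,
    Matrix.transpose_one, Matrix.mul_one]

theorem IsMetricOn.gradInner_chain (he : IsChartOn e U) (hφ : IsChartOn φ U)
    (hg : IsMetricOn φ g U) (hf : SmoothFn n U f) (hf' : SmoothFn n U f') (hx : x ∈ U) :
    gradInner e g f f' x = gradInner φ g f f' x := by
  rw [gradInner_eq, gradInner_eq, hg.mulVec_dVec_chain he hφ hf' hx, he.dVec_chain hφ hf hx,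
    ← Matrix.dotProduct_mulVec, Matrix.mulVec_mulVec, hφ.transMat_mul he hx, Matrix.one_mulVec]

theorem IsChartOn.vecComp_grad (he : IsChartOn e U) (hx : x ∈ U) (i : Fin n) :
    vecComp e (grad e g f) i x = (compInv e g x).mulVec (dVec e f x) i :=
  he.vecComp_sum_coordVec hx (fun i y => ∑ j, compInv e g y i j * pd e j f y) i

theorem IsMetricOn.grad_chain (he : IsChartOn e U) (hφ : IsChartOn φ U)
    (hg : IsMetricOn φ g U) (hf : SmoothFn n U f) (hx : x ∈ U) :
    grad e g f x = grad φ g f x := by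
  refine he.ext_vecComp hx fun i => ?_
  rw [he.vecComp_grad hx, hg.mulVec_dVec_chain he hφ hf hx, hφ.vecComp_chain he hx]
  simp only [hφ.vecComp_grad hx]
  rfl

/-- The Lie derivative of the metric is a tensor. -/
theorem IsMetricOn.lieMetric_chain (he : IsChartOn e U) (hφ : IsChartOn φ U)
    (hg : IsMetricOn φ g U) {ξ : VectorField (n := n) M} (hξ : SmoothField U ξ) (hx : x ∈ U)
    (i j : Fin n) : lieMetric e g ξ i j x =
      ∑ a, ∑ b, transMat e φ x a i * transMat e φ x b j * lieMetric φ g ξ a b x := by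
  have hge := hg.change he hφ
  -- The Lie derivative in matrix notation, `D` being the matrix `∂_i ξ^k` of partial derivatives.
  have hmat : ∀ {e : OpenPartialHomeomorph M (Model n)}, ∀ i j, lieMetric e g ξ i j x =
      ((∑ k, vecComp e ξ k x • pdMat e k (comp e g) x)
        + (Matrix.of fun k i => pd e i (vecComp e ξ k) x).transpose * comp e g x
        + comp e g x * (Matrix.of fun k i => pd e i (vecComp e ξ k) x)) i j := by
    intro e i j
    simp only [lieMetric, Finset.sum_add_distrib, Matrix.add_apply, Matrix.sum_apply,
      Matrix.smul_apply, Matrix.mul_apply, Matrix.transpose_apply, Matrix.of_apply, pdMat,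
      smul_eq_mul]
    simp only [mul_comm (comp e g x _ j)]
  rw [hmat]
  simp only [hmat]
  rw [← conj_apply]
  set J := transMat e φ with hJ
  have hsJ : SmoothMat U J := he.smooth_transMat hφ
  set D : Matrix (Fin n) (Fin n) ℝ := Matrix.of fun k i => pd e i (vecComp e ξ k) x with hD
  set D' : Matrix (Fin n) (Fin n) ℝ := Matrix.of fun k i => pd φ i (vecComp φ ξ k) x with hD'
  have hDD : J x * D + ∑ k, vecComp e ξ k x • pdMat e k J x = D' * J x := by
    ext a i
    have h1 : pd e i (vecComp φ ξ a) x = ∑ k, (pd e i (fun y => J y a k) x * vecComp e ξ k x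
        + J x a k * pd e i (vecComp e ξ k) x) := by
      rw [he.pd_congr (f' := fun y => ∑ k, J y a k * vecComp e ξ k y)
        (fun y hy => he.vecComp_chain hφ hy ξ a) hx,
        he.pd_sum (fun k _ => SmoothFn.mul (hsJ a k) (he.smooth_vecComp hξ k)) hx]
      exact Finset.sum_congr rfl fun k _ => he.pd_mul (hsJ a k) (he.smooth_vecComp hξ k) hx i
    have h2 : (D' * J x) a i = pd e i (vecComp φ ξ a) x := by
      rw [he.pd_chain hφ (hφ.smooth_vecComp hξ a) hx, Matrix.mul_apply]
      exact Finset.sum_congr rfl fun b _ => mul_comm _ _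
    rw [h2, h1, Finset.sum_add_distrib, add_comm, Matrix.add_apply, Matrix.sum_apply]
    congr 1
    refine Finset.sum_congr rfl fun k _ => ?_
    rw [Matrix.smul_apply, smul_eq_mul, mul_comm, hJ, he.pdMat_transMat_symm hφ hx k i a]
    rfl
  have hG : ∀ k, pdMat e k (comp e g) x = (pdMat e k J x).transpose * comp φ g x * J x
      + (J x).transpose * (∑ c, J x c k • pdMat φ c (comp φ g) x) * J x
      + (J x).transpose * comp φ g x * pdMat e k J x := by
    intro k
    rw [he.pdMat_congr (fun y hy => he.comp_chain hφ hy) hx k,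
      he.pdMat_mul (hsJ.transpose.mul hg.smooth) hsJ hx,
      he.pdMat_mul hsJ.transpose hg.smooth hx, pdMat_transpose, he.pdMat_chain hφ hg.smooth hx,
      Matrix.add_mul]
  have hξG : ∑ k, vecComp e ξ k x • ∑ c, J x c k • pdMat φ c (comp φ g) x =
      ∑ c, vecComp φ ξ c x • pdMat φ c (comp φ g) x := by
    simp only [Finset.smul_sum, smul_smul, he.vecComp_chain hφ hx, Finset.sum_smul]
    rw [Finset.sum_comm]
    exact Finset.sum_congr rfl fun c _ => Finset.sum_congr rfl fun k _ => by rw [mul_comm]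
  set S := ∑ k, vecComp e ξ k x • pdMat e k J x with hS
  have hsum : ∑ k, vecComp e ξ k x • pdMat e k (comp e g) x =
      S.transpose * comp φ g x * J x
      + (J x).transpose * (∑ c, vecComp φ ξ c x • pdMat φ c (comp φ g) x) * J x
      + (J x).transpose * comp φ g x * S := by
    rw [← hξG, hS]
    simp only [hG, smul_add, Finset.sum_add_distrib, Matrix.transpose_sum, Matrix.transpose_smul,
      Matrix.sum_mul, Matrix.mul_sum, Matrix.smul_mul, Matrix.mul_smul]
  have hJD : J x * D = D' * J x - S := by rw [← hDD]; abel
  have hJD' : D.transpose * (J x).transpose = (J x).transpose * D'.transpose - S.transpose := by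
    rw [← Matrix.transpose_mul, hJD, Matrix.transpose_sub, Matrix.transpose_mul]
  refine congrFun (congrFun ?_ i) j
  rw [hsum, he.comp_chain hφ hx]
  have h3 : D.transpose * ((J x).transpose * comp φ g x * J x) =
      (D.transpose * (J x).transpose) * comp φ g x * J x := by
    simp only [Matrix.mul_assoc]
  have h4 : (J x).transpose * comp φ g x * J x * D =
      (J x).transpose * comp φ g x * (J x * D) := by
    simp only [Matrix.mul_assoc]
  rw [h3, h4, hJD, hJD']
  simp only [Matrix.mul_add, Matrix.add_mul, Matrix.mul_sub, Matrix.sub_mul, Matrix.mul_assoc]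
  abel

theorem IsConformalKilling.change (he : IsChartOn e U) (hφ : IsChartOn φ U)
    (hg : IsMetricOn φ g U) {ξ : VectorField (n := n) M} {Ψ : M → ℝ}
    (h : IsConformalKilling φ g U ξ Ψ) : IsConformalKilling e g U ξ Ψ := by
  refine ⟨h.smooth, fun x hx i j => ?_⟩
  rw [hg.lieMetric_chain he hφ h.smooth hx, he.comp_chain hφ hx, conj_apply, Finset.mul_sum]
  refine Finset.sum_congr rfl fun a _ => ?_
  rw [Finset.mul_sum]
  refine Finset.sum_congr rfl fun b _ => ?_
  rw [h.lie x hx]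
  ring

theorem IsMetricOn.smooth_lower (he : IsChartOn e U) (hg : IsMetricOn e g U)
    {ξ : VectorField (n := n) M} (hξ : SmoothField U ξ) (i : Fin n) :
    SmoothFn n U (lower e g ξ i) :=
  ContMDiffOn.congr (SmoothFn.sum fun k _ => SmoothFn.mul (he.smooth_vecComp hξ k) (hg.smooth k i))
    fun _ hy => he.lower_eq hy ξ i

theorem IsMetricOn.omegaHat_chain (he : IsChartOn e U) (hφ : IsChartOn φ U)
    (hg : IsMetricOn φ g U) {ξ : VectorField (n := n) M} (hξ : SmoothField U ξ) (hx : x ∈ U)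
    (i j : Fin n) : omegaHat e g ξ x i j =
      ∑ a, ∑ b, transMat e φ x a i * transMat e φ x b j * omegaHat φ g ξ x a b := by
  have hsJ := he.smooth_transMat hφ
  have hl := hg.smooth_lower hφ hξ
  have h1 : ∀ i j, pd e i (lower e g ξ j) x = ∑ b, (pdMat e i (transMat e φ) x b j * lower φ g ξ b x
      + transMat e φ x b j * ∑ a, transMat e φ x a i * pd φ a (lower φ g ξ b) x) := by
    intro i j
    rw [he.pd_congr (f' := fun y => ∑ a, transMat e φ y a j * lower φ g ξ a y)
      (fun y hy => he.lower_chain hφ hy ξ j) hx,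
      he.pd_sum (fun a _ => SmoothFn.mul (hsJ a j) (hl a)) hx]
    refine Finset.sum_congr rfl fun a _ => ?_
    rw [he.pd_mul (hsJ a j) (hl a) hx, he.pd_chain hφ (hl a) hx i]
    rfl
  have h2 : ∀ b, pdMat e i (transMat e φ) x b j = pdMat e j (transMat e φ) x b i :=
    fun b => he.pdMat_transMat_symm hφ hx i j b
  unfold omegaHat
  rw [h1, h1]
  simp only [h2, Finset.sum_add_distrib]
  rw [add_sub_add_left_eq_sub]
  have h3 : ∑ b, transMat e φ x b j * ∑ a, transMat e φ x a i * pd φ a (lower φ g ξ b) x =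
      ∑ a, ∑ b, transMat e φ x a i * transMat e φ x b j * pd φ a (lower φ g ξ b) x := by
    simp only [Finset.mul_sum]
    rw [Finset.sum_comm]
    exact Finset.sum_congr rfl fun a _ => Finset.sum_congr rfl fun b _ => by ring
  have h4 : ∑ b, transMat e φ x b i * ∑ a, transMat e φ x a j * pd φ a (lower φ g ξ b) x =
      ∑ a, ∑ b, transMat e φ x a i * transMat e φ x b j * pd φ b (lower φ g ξ a) x := by
    simp only [Finset.mul_sum]
    exact Finset.sum_congr rfl fun a _ => Finset.sum_congr rfl fun b _ => by ring
  rw [h3, h4, ← Finset.sum_sub_distrib, Finset.mul_sum]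
  refine Finset.sum_congr rfl fun a _ => ?_
  rw [← Finset.sum_sub_distrib, Finset.mul_sum]
  exact Finset.sum_congr rfl fun b _ => by ring

theorem IsMetricOn.WHat_chain (he : IsChartOn e U) (hφ : IsChartOn φ U)
    (hg : IsMetricOn φ g U) (ξ : VectorField (n := n) M) {Ψ : M → ℝ} (hΨ : SmoothFn n U Ψ)
    (hx : x ∈ U) (i : Fin n) :
    WHat e g ξ Ψ x i = ∑ a, transMat e φ x a i * WHat φ g ξ Ψ x a := by
  have hS : ∀ i j, schouten e g i j x =
      ∑ a, ∑ b, transMat e φ x a i * transMat e φ x b j * schouten φ g a b x := by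
    intro i j
    have := congrFun (congrFun (hg.schoutenMat_chain he hφ hx) i) j
    rw [conj_apply] at this
    exact this
  have h1 : ∑ D, vecComp e ξ D x * schouten e g i D x =
      ∑ a, transMat e φ x a i * ∑ b, vecComp φ ξ b x * schouten φ g a b x := by
    simp only [hS, he.vecComp_chain hφ hx, Finset.mul_sum, Finset.sum_mul]
    rw [Finset.sum_comm]
    refine Finset.sum_congr rfl fun a _ => ?_
    rw [Finset.sum_comm]
    exact Finset.sum_congr rfl fun b _ => Finset.sum_congr rfl fun c _ => by ring
  unfold WHat
  rw [he.pd_chain hφ hΨ hx, h1, ← Finset.sum_add_distrib]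
  exact Finset.sum_congr rfl fun a _ => by ring

theorem jac_chain (he : IsChartOn e U) (hφ : IsChartOn φ U) {Y : Fin n → M → ℝ}
    (hY : ∀ A, SmoothFn n U (Y A)) (hx : x ∈ U) : jac e Y x = jac φ Y x * transMat e φ x := by
  ext A i
  simp only [jac, Matrix.of_apply, Matrix.mul_apply]
  rw [he.pd_chain hφ (hY A) hx]
  exact Finset.sum_congr rfl fun a _ => mul_comm _ _

/-- The equation for the conformal factor does not depend on the chart. -/
theorem SolvesHessEq.change (he : IsChartOn e U) (hφ : IsChartOn φ U)
    (hg : IsMetricOn φ g U) {Ω : M → ℝ} (hΩ : SmoothFn n U Ω) (h : SolvesHessEq φ g U Ω) :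
    SolvesHessEq e g U Ω := by
  intro x hx i j
  have h1 : hessMat φ g Ω x = (1 / (2 * Ω x) * gradInner φ g Ω Ω x) • comp φ g x
      - Ω x • schoutenMat φ g x := by
    ext a b
    exact h x hx a b
  have h2 : hessMat e g Ω x = (1 / (2 * Ω x) * gradInner e g Ω Ω x) • comp e g x
      - Ω x • schoutenMat e g x := by
    rw [hg.hessMat_chain he hφ hΩ hx, h1, hg.gradInner_chain he hφ hΩ hΩ hx,
      hg.schoutenMat_chain he hφ hx, he.comp_chain hφ hx]
    simp only [Matrix.mul_smul, Matrix.smul_mul, Matrix.mul_sub, Matrix.sub_mul]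
  exact congrFun (congrFun h2 i) j

end Tensors

/-! ### Conformally flat coordinates -/

section Algebra

variable {n : ℕ}

/-- The diagonal entries `±1` of `eta n r`. -/
def sgn (r : ℕ) (i : Fin n) : ℝ := if (i : ℕ) < r then -1 else 1

theorem eta_apply (r : ℕ) (i j : Fin n) : eta n r i j = if i = j then sgn r i else 0 := by
  simp [eta, Matrix.diagonal_apply, sgn]

theorem sgn_mul_self (r : ℕ) (i : Fin n) : sgn r i * sgn r i = 1 := by
  unfold sgn; split_ifs <;> norm_num

theorem sgn_ne_zero (r : ℕ) (i : Fin n) : sgn r i ≠ 0 := by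
  unfold sgn; split_ifs <;> norm_num

theorem eta_symm (r : ℕ) (i j : Fin n) : eta n r i j = eta n r j i := by
  simp only [eta_apply]
  split_ifs with h1 h2 h2
  · rw [h1]
  · exact absurd h1.symm h2
  · exact absurd h2.symm h1
  · rfl

theorem eta_self (r : ℕ) (i : Fin n) : eta n r i i = sgn r i := by simp [eta_apply]

theorem eta_transpose (r : ℕ) : (eta n r).transpose = eta n r := by
  ext i j; exact eta_symm r j i

theorem eta_mul_eta (n r : ℕ) : eta n r * eta n r = 1 := by
  ext i j
  simp only [Matrix.mul_apply, eta_apply, Matrix.one_apply]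
  by_cases h : i = j <;> simp [h, sgn_mul_self]

theorem sum_eta_mul (r : ℕ) (i : Fin n) (f : Fin n → ℝ) :
    ∑ j, eta n r i j * f j = sgn r i * f i := by
  simp [eta_apply]

/-- The scalar product of the pseudo-Euclidean space. -/
def etaInner (r : ℕ) (a b : Fin n → ℝ) : ℝ := ∑ k, sgn r k * a k * b k

/-- The Christoffel symbols `Γ^k_{ij} = δ^k_i υ_j + δ^k_j υ_i - η_{ij} υ^k` of a conformally flat
metric, with `υ = d log Ω`. -/
def confChr (r : ℕ) (υ : Fin n → ℝ) (k i j : Fin n) : ℝ :=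
  (if k = i then υ j else 0) + (if k = j then υ i else 0) - eta n r i j * (sgn r k * υ k)

theorem confChr_trace (r : ℕ) (υ : Fin n → ℝ) (i : Fin n) :
    ∑ k, confChr r υ k k i = n * υ i := by
  simp only [confChr, if_true, Finset.sum_add_distrib, Finset.sum_sub_distrib]
  simp only [eta_symm r _ i, sum_eta_mul]
  rw [← mul_assoc, sgn_mul_self]
  simp

theorem confChr_symm (r : ℕ) (υ : Fin n → ℝ) (k i j : Fin n) :
    confChr r υ k i j = confChr r υ k j i := by
  simp only [confChr, eta_symm r i j]
  ring

theorem sum_confChr_mul (r : ℕ) (υ a : Fin n → ℝ) (i j : Fin n) :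
    ∑ k, confChr r υ k i j * a k = a i * υ j + a j * υ i - eta n r i j * etaInner r υ a := by
  simp only [confChr, etaInner, sub_mul, add_mul, Finset.sum_add_distrib, Finset.sum_sub_distrib,
    ite_mul, zero_mul, Finset.sum_ite_eq', Finset.mem_univ, if_true, Finset.mul_sum]
  congr 1
  · ring
  · exact Finset.sum_congr rfl fun k _ => by ring

theorem sum_confChr_mul_confChr (r : ℕ) (υ : Fin n → ℝ) (i j : Fin n) :
    ∑ k, ∑ l, confChr r υ k j l * confChr r υ l i k =
      (n + 2) * υ i * υ j - 2 * eta n r i j * etaInner r υ υ := by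
  have h1 : ∀ k, ∑ l, confChr r υ k j l * confChr r υ l i k =
      ∑ l, confChr r υ l i k * confChr r υ k j l := fun k =>
    Finset.sum_congr rfl fun l _ => mul_comm _ _
  simp only [h1, sum_confChr_mul]
  have h2 : ∀ k, etaInner r υ (fun l => confChr r υ k j l) =
      (if k = j then etaInner r υ υ else 0) + sgn r k * υ k * υ j - υ j * (sgn r k * υ k) := by
    intro k
    simp only [etaInner, confChr, mul_sub, mul_add, Finset.sum_add_distrib,
      Finset.sum_sub_distrib]
    congr 1
    · congr 1
      · split_ifs
        · exact Finset.sum_congr rfl fun l _ => by ring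
        · simp
      · simp
    · have : ∀ l, sgn r l * υ l * (eta n r j l * (sgn r k * υ k)) =
          eta n r j l * (sgn r l * υ l * (sgn r k * υ k)) := fun l => by ring
      simp only [this, sum_eta_mul]
      have := sgn_mul_self r j
      linear_combination (υ j * sgn r k * υ k) * this
  simp only [h2, Finset.sum_add_distrib, Finset.sum_sub_distrib, sum_confChr_mul, sum_eta_mul,
    ← Finset.sum_mul, confChr_symm r υ _ j, confChr_trace]
  have h3 : sgn r i * ((if i = j then etaInner r υ υ else 0) + sgn r i * υ i * υ j
      - υ j * (sgn r i * υ i)) = eta n r i j * etaInner r υ υ := by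
    rw [eta_apply]
    split_ifs <;> ring
  rw [h3]
  ring

end Algebra

section ConformallyFlat

variable {n r : ℕ} {M : Type*} [TopologicalSpace M] [ChartedSpace (Model n) M]
  [IsManifold (𝓡 n) ∞ M]

variable {φ : OpenPartialHomeomorph M (Model n)} {U : Set M} {f : M → ℝ} {x : M}
  {g : BilinField (n := n) M} {Ω : M → ℝ}

/-- In the chart `φ`, whose domain contains the open set `U`, the metric is `Ω² η` on `U`. -/
structure IsConfFlatChart (r : ℕ) (φ : OpenPartialHomeomorph M (Model n))
    (g : BilinField (n := n) M) (Ω : M → ℝ) (U : Set M) : Prop extends IsChartOn φ U where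
  smooth : SmoothFn n U Ω
  pos : ∀ x ∈ U, 0 < Ω x
  comp_eq : ∀ x ∈ U, comp φ g x = Ω x ^ 2 • eta n r

theorem IsConfFlatChart.ne_zero (h : IsConfFlatChart r φ g Ω U) : ∀ x ∈ U, Ω x ≠ 0 :=
  fun x hx => (h.pos x hx).ne'

theorem IsConfFlatChart.mono (h : IsConfFlatChart r φ g Ω U) {V : Set M} (hV : IsOpen V)
    (hVU : V ⊆ U) : IsConfFlatChart r φ g Ω V :=
  ⟨h.toIsChartOn.mono hV hVU, ContMDiffOn.mono h.smooth hVU, fun x hx => h.pos x (hVU hx),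
    fun x hx => h.comp_eq x (hVU hx)⟩

theorem IsConfFlatChart.compInv_eq (h : IsConfFlatChart r φ g Ω U) (hx : x ∈ U) :
    compInv φ g x = (Ω x ^ 2)⁻¹ • eta n r := by
  have h0 := h.ne_zero x hx
  refine Matrix.inv_eq_left_inv ?_
  rw [h.comp_eq x hx, Matrix.smul_mul, Matrix.mul_smul, eta_mul_eta, smul_smul,
    inv_mul_cancel₀ (pow_ne_zero 2 h0), one_smul]

theorem IsConfFlatChart.isMetricOn (h : IsConfFlatChart r φ g Ω U) : IsMetricOn φ g U := by
  refine ⟨fun a b => ?_, fun a b => ?_, fun x hx => ?_, fun x hx => ?_⟩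
  · refine ContMDiffOn.congr (SmoothFn.mul (SmoothFn.pow h.smooth 2) (SmoothFn.const (eta n r a b)))
      fun y hy => ?_
    rw [h.comp_eq y hy]; rfl
  · refine ContMDiffOn.congr (SmoothFn.mul (SmoothFn.inv (SmoothFn.pow h.smooth 2)
      fun y hy => pow_ne_zero 2 (h.ne_zero y hy)) (SmoothFn.const (eta n r a b))) fun y hy => ?_
    rw [h.compInv_eq hy]; rfl
  · rw [h.comp_eq x hx, Matrix.transpose_smul, eta_transpose]
  · have h0 := h.ne_zero x hx
    rw [h.compInv_eq hx, h.comp_eq x hx, Matrix.smul_mul, Matrix.mul_smul, eta_mul_eta, smul_smul,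
      inv_mul_cancel₀ (pow_ne_zero 2 h0), one_smul]

/-- The components `υ_i = ∂_i Ω / Ω` of the logarithmic differential of `Ω`. -/
def dLog (φ : OpenPartialHomeomorph M (Model n)) (Ω : M → ℝ) (i : Fin n) (x : M) : ℝ :=
  pd φ i Ω x / Ω x

theorem IsConfFlatChart.smooth_dLog (h : IsConfFlatChart r φ g Ω U) (i : Fin n) :
    SmoothFn n U (dLog φ Ω i) :=
  SmoothFn.div (h.smooth_pd h.smooth i) h.smooth h.ne_zero

theorem IsConfFlatChart.pd_eq (h : IsConfFlatChart r φ g Ω U) (hx : x ∈ U) (i : Fin n) :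
    pd φ i Ω x = Ω x * dLog φ Ω i x := by
  have := h.ne_zero x hx
  unfold dLog
  field_simp

theorem IsConfFlatChart.pd_pd_eq (h : IsConfFlatChart r φ g Ω U) (hx : x ∈ U) (i j : Fin n) :
    pd φ i (pd φ j Ω) x =
      Ω x * (dLog φ Ω i x * dLog φ Ω j x + pd φ i (dLog φ Ω j) x) := by
  rw [h.pd_congr (f' := fun y => Ω y * dLog φ Ω j y) (fun y hy => h.pd_eq hy j) hx,
    h.pd_mul h.smooth (h.smooth_dLog j) hx, h.pd_eq hx]
  ring

theorem IsConfFlatChart.pd_dLog_symm (h : IsConfFlatChart r φ g Ω U) (hx : x ∈ U) (i j : Fin n) :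
    pd φ i (dLog φ Ω j) x = pd φ j (dLog φ Ω i) x := by
  have h1 := h.pd_pd_eq hx i j
  rw [h.pd_comm h.smooth hx, h.pd_pd_eq hx j i] at h1
  have := mul_left_cancel₀ (h.ne_zero x hx) h1
  linarith

theorem IsConfFlatChart.christoffel_eq (h : IsConfFlatChart r φ g Ω U) (hx : x ∈ U)
    (k i j : Fin n) : christoffel φ g k i j x = confChr r (dLog φ Ω · x) k i j := by
  have h0 := h.ne_zero x hx
  have h1 : ∀ a b c, pd φ a (fun y => comp φ g y b c) x =
      2 * Ω x ^ 2 * (dLog φ Ω a x * eta n r b c) := by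
    intro a b c
    rw [h.pd_congr (f' := fun y => Ω y ^ 2 * eta n r b c)
      (fun y hy => by simp [h.comp_eq y hy]) hx, pd_mul_const, h.pd_sq h.smooth hx, h.pd_eq hx]
    ring
  have h2 : ∀ a, sgn r k * eta n r a k = if k = a then 1 else 0 := by
    intro a
    rw [eta_apply]
    by_cases hak : a = k
    · subst hak; simp [sgn_mul_self]
    · simp [hak, Ne.symm hak]
  have h3 : ∀ l, compInv φ g x k l * (2 * Ω x ^ 2 * (dLog φ Ω i x * eta n r j l)
      + 2 * Ω x ^ 2 * (dLog φ Ω j x * eta n r i l) - 2 * Ω x ^ 2 * (dLog φ Ω l x * eta n r i j)) =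
      eta n r k l * (2 * (dLog φ Ω i x * eta n r j l + dLog φ Ω j x * eta n r i l
        - dLog φ Ω l x * eta n r i j)) := by
    intro l
    rw [h.compInv_eq hx, Matrix.smul_apply, smul_eq_mul]
    field_simp
  simp only [christoffel, h1, h3, sum_eta_mul]
  have e1 := h2 i
  have e2 := h2 j
  have h4 : confChr r (dLog φ Ω · x) k i j = (if k = i then 1 else 0) * dLog φ Ω j x
      + (if k = j then 1 else 0) * dLog φ Ω i x - eta n r i j * (sgn r k * dLog φ Ω k x) := by
    simp [confChr]
  rw [h4, ← e1, ← e2]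
  ring

theorem IsConfFlatChart.ricci_eq (h : IsConfFlatChart r φ g Ω U) (hx : x ∈ U) (i j : Fin n) :
    ricci φ g i j x = -((n : ℝ) - 2) * (pd φ i (dLog φ Ω j) x - dLog φ Ω i x * dLog φ Ω j x)
      - eta n r i j * ((∑ k, sgn r k * pd φ k (dLog φ Ω k) x)
        + ((n : ℝ) - 2) * etaInner r (dLog φ Ω · x) (dLog φ Ω · x)) := by
  have hs := h.smooth_dLog
  have h1 : ∀ k i j l, pd φ l (christoffel φ g k i j) x =
      (if k = i then pd φ l (dLog φ Ω j) x else 0) + (if k = j then pd φ l (dLog φ Ω i) x else 0)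
        - eta n r i j * (sgn r k * pd φ l (dLog φ Ω k) x) := by
    intro k i j l
    have hite : ∀ (p : Prop) [Decidable p] (f : M → ℝ), pd φ l (fun y => if p then f y else 0) x =
        if p then pd φ l f x else 0 := by
      intro p _ f
      split_ifs <;> simp
    have hsite : ∀ (p : Prop) [Decidable p] (f : M → ℝ), SmoothFn n U f →
        SmoothFn n U (fun y => if p then f y else 0) := by
      intro p _ f hf
      split_ifs
      exacts [hf, SmoothFn.const 0]
    rw [h.pd_congr (fun y hy => h.christoffel_eq hy k i j) hx]
    simp only [confChr]
    rw [h.pd_sub (SmoothFn.add (hsite _ _ (hs j)) (hsite _ _ (hs i)))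
      (SmoothFn.mul (SmoothFn.const _) (SmoothFn.mul (SmoothFn.const _) (hs k))) hx,
      h.pd_add (hsite _ _ (hs j)) (hsite _ _ (hs i)) hx, hite, hite, pd_const_mul, pd_const_mul]
  have h2 : ∑ k, ∑ l, confChr r (dLog φ Ω · x) k k l * confChr r (dLog φ Ω · x) l i j =
      n * (2 * dLog φ Ω i x * dLog φ Ω j x
        - eta n r i j * etaInner r (dLog φ Ω · x) (dLog φ Ω · x)) := by
    rw [Finset.sum_comm]
    simp only [← Finset.sum_mul, confChr_trace]
    have : ∀ l, ↑n * dLog φ Ω l x * confChr r (dLog φ Ω · x) l i j =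
        n * (confChr r (dLog φ Ω · x) l i j * dLog φ Ω l x) := fun l => by ring
    simp only [this, ← Finset.mul_sum]
    rw [sum_confChr_mul r (dLog φ Ω · x) (dLog φ Ω · x)]
    ring
  simp only [ricci, h.christoffel_eq hx, Finset.sum_sub_distrib, Finset.sum_add_distrib]
  rw [h2, sum_confChr_mul_confChr]
  simp only [h1, Finset.sum_sub_distrib, Finset.sum_add_distrib, ← Finset.mul_sum]
  simp only [Finset.sum_ite_eq', Finset.mem_univ, if_true, sum_eta_mul, Finset.sum_const,
    Finset.card_univ, Fintype.card_fin, nsmul_eq_mul]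
  rw [h.pd_dLog_symm hx j i]
  linear_combination (pd φ i (dLog φ Ω j) x) * sgn_mul_self r i

theorem IsConfFlatChart.schouten_eq (h : IsConfFlatChart r φ g Ω U) (hn : 3 ≤ n) (hx : x ∈ U)
    (i j : Fin n) : schouten φ g i j x =
      -pd φ i (dLog φ Ω j) x + dLog φ Ω i x * dLog φ Ω j x
        - 1 / 2 * eta n r i j * etaInner r (dLog φ Ω · x) (dLog φ Ω · x) := by
  have h0 := h.ne_zero x hx
  have hn' : (3 : ℝ) ≤ n := by exact_mod_cast hn
  have h2 : (n : ℝ) - 2 ≠ 0 := by linarith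
  have h1 : (n : ℝ) - 1 ≠ 0 := by linarith
  set B := ∑ k, sgn r k * pd φ k (dLog φ Ω k) x with hB
  set N := etaInner r (dLog φ Ω · x) (dLog φ Ω · x) with hN
  have hric : ∀ i j, ricci φ g i j x = -((n : ℝ) - 2) * (pd φ i (dLog φ Ω j) x
      - dLog φ Ω i x * dLog φ Ω j x) - eta n r i j * (B + ((n : ℝ) - 2) * N) := h.ricci_eq hx
  have hscal : scal φ g x = (Ω x ^ 2)⁻¹ * (-(2 * ((n : ℝ) - 1)) * B
      - ((n : ℝ) - 2) * ((n : ℝ) - 1) * N) := by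
    simp only [scal, h.compInv_eq hx, Matrix.smul_apply, smul_eq_mul, mul_assoc]
    simp only [← Finset.mul_sum, sum_eta_mul, hric, eta_self]
    congr 1
    have e1 : ∀ k, sgn r k * (-((n : ℝ) - 2) * (pd φ k (dLog φ Ω k) x
        - dLog φ Ω k x * dLog φ Ω k x) - sgn r k * (B + ((n : ℝ) - 2) * N)) =
        -((n : ℝ) - 2) * (sgn r k * pd φ k (dLog φ Ω k) x)
          + ((n : ℝ) - 2) * (sgn r k * dLog φ Ω k x * dLog φ Ω k x)
          - (B + ((n : ℝ) - 2) * N) := by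
      intro k
      linear_combination (-(B + ((n : ℝ) - 2) * N)) * sgn_mul_self r k
    simp only [e1, Finset.sum_sub_distrib, Finset.sum_add_distrib, ← Finset.mul_sum]
    rw [← hB, show ∑ k, sgn r k * dLog φ Ω k x * dLog φ Ω k x = N from rfl]
    simp
    ring
  rw [schouten, hscal, hric, h.comp_eq x hx]
  simp only [Matrix.smul_apply, smul_eq_mul]
  field_simp
  ring

theorem IsConfFlatChart.hess_eq (h : IsConfFlatChart r φ g Ω U) (hx : x ∈ U) (f : M → ℝ)
    (i j : Fin n) : hess φ g f i j x = pd φ i (pd φ j f) x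
      - (pd φ i f x * dLog φ Ω j x + pd φ j f x * dLog φ Ω i x
        - eta n r i j * etaInner r (dLog φ Ω · x) (pd φ · f x)) := by
  simp only [hess, h.christoffel_eq hx]
  rw [sum_confChr_mul r (dLog φ Ω · x) (pd φ · f x)]

theorem IsConfFlatChart.gradInner_eq (h : IsConfFlatChart r φ g Ω U) (hx : x ∈ U)
    (f f' : M → ℝ) :
    gradInner φ g f f' x = (Ω x ^ 2)⁻¹ * etaInner r (pd φ · f x) (pd φ · f' x) := by
  simp only [gradInner, h.compInv_eq hx, Matrix.smul_apply, smul_eq_mul, mul_assoc]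
  simp only [← Finset.mul_sum, etaInner]
  congr 1
  refine Finset.sum_congr rfl fun i _ => ?_
  have : ∀ j, eta n r i j * (pd φ i f x * pd φ j f' x) = pd φ i f x * (eta n r i j * pd φ j f' x) :=
    fun j => by ring
  simp only [this, ← Finset.mul_sum, sum_eta_mul]
  ring

/-- For a second conformal factor `Ω' = u Ω`, the equation for `Ω'` is an equation for `u` in the
flat coordinates. -/
theorem IsConfFlatChart.hessEq_iff (h : IsConfFlatChart r φ g Ω U) (hn : 3 ≤ n) {u : M → ℝ}
    (hu : SmoothFn n U u) (hupos : ∀ x ∈ U, 0 < u x) (hx : x ∈ U) (i j : Fin n) :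
    hess φ g (fun y => u y * Ω y) i j x =
        1 / (2 * (u x * Ω x)) * gradInner φ g (fun y => u y * Ω y) (fun y => u y * Ω y) x
          * comp φ g x i j - (u x * Ω x) * schouten φ g i j x
      ↔ pd φ i (pd φ j u) x =
        etaInner r (pd φ · u x) (pd φ · u x) / (2 * u x) * eta n r i j := by
  have h0 := h.ne_zero x hx
  have hu0 := (hupos x hx).ne'
  have h1 : ∀ y ∈ U, ∀ j, pd φ j (fun y => u y * Ω y) y =
      pd φ j u y * Ω y + u y * pd φ j Ω y := fun y hy j => h.pd_mul hu h.smooth hy j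
  have h2 : pd φ i (pd φ j (fun y => u y * Ω y)) x = pd φ i (pd φ j u) x * Ω x
      + pd φ j u x * pd φ i Ω x + (pd φ i u x * pd φ j Ω x + u x * pd φ i (pd φ j Ω) x) := by
    rw [h.pd_congr (fun y hy => h1 y hy j) hx,
      h.pd_add (SmoothFn.mul (h.smooth_pd hu j) h.smooth)
        (SmoothFn.mul hu (h.smooth_pd h.smooth j)) hx,
      h.pd_mul (h.smooth_pd hu j) h.smooth hx, h.pd_mul hu (h.smooth_pd h.smooth j) hx]
  set A := etaInner r (pd φ · u x) (pd φ · u x) with hA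
  set B := etaInner r (dLog φ Ω · x) (pd φ · u x) with hB
  set N := etaInner r (dLog φ Ω · x) (dLog φ Ω · x) with hN
  have h3 : etaInner r (dLog φ Ω · x) (pd φ · (fun y => u y * Ω y) x) = Ω x * (B + u x * N) := by
    simp only [hB, hN, etaInner, h1 x hx, h.pd_eq hx, mul_add, Finset.mul_sum,
      ← Finset.sum_add_distrib]
    exact Finset.sum_congr rfl fun k _ => by ring
  have h4 : etaInner r (pd φ · (fun y => u y * Ω y) x) (pd φ · (fun y => u y * Ω y) x) =
      Ω x ^ 2 * (A + 2 * u x * B + u x ^ 2 * N) := by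
    simp only [hA, hB, hN, etaInner, h1 x hx, h.pd_eq hx, mul_add, Finset.mul_sum,
      ← Finset.sum_add_distrib]
    exact Finset.sum_congr rfl fun k _ => by ring
  rw [h.hess_eq hx, h.gradInner_eq hx, h.schouten_eq hn hx, h.comp_eq x hx, h2, h3, h4, h1 x hx,
    h1 x hx, h.pd_pd_eq hx, h.pd_eq hx, h.pd_eq hx, ← hN]
  simp only [Matrix.smul_apply, smul_eq_mul]
  constructor
  · intro H
    field_simp at H ⊢
    linear_combination H
  · intro H
    rw [H]
    field_simp
    ring

/-- The conformal factor of a conformally flat chart solves the Hessian equation. -/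
theorem IsConfFlatChart.solvesHessEq (h : IsConfFlatChart r φ g Ω U) (hn : 3 ≤ n) :
    SolvesHessEq φ g U Ω := by
  intro x hx i j
  have := (h.hessEq_iff hn (u := fun _ => 1) (SmoothFn.const 1) (fun _ _ => one_pos) hx i j).2
    (by
      have : pd φ j (fun _ : M => (1 : ℝ)) = fun _ => 0 := by ext y; simp
      simp [this, etaInner])
  simpa using this

/-- A normalized conformal factor is determined by the Hessian equation. -/
theorem IsConfFlatChart.eq_of_solvesHessEq (h : IsConfFlatChart r φ g Ω U) (hn : 3 ≤ n)
    (hc : IsPreconnected U) {p : M} (hp : p ∈ U) {Ω' : M → ℝ} (hs' : SmoothFn n U Ω')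
    (hpos' : ∀ x ∈ U, 0 < Ω' x) (hval : Ω' p = Ω p) (hd : ∀ i, pd φ i Ω' p = pd φ i Ω p)
    (hsol : SolvesHessEq φ g U Ω') {x : M} (hx : x ∈ U) : Ω' x = Ω x := by
  set u : M → ℝ := fun y => Ω' y / Ω y with hu
  have hsu : SmoothFn n U u := SmoothFn.div hs' h.smooth h.ne_zero
  have hupos : ∀ x ∈ U, 0 < u x := fun x hx => div_pos (hpos' x hx) (h.pos x hx)
  have hΩ' : Set.EqOn Ω' (fun y => u y * Ω y) U := fun y hy => by
    have := h.ne_zero y hy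
    simp only [hu]
    field_simp
  have heq : ∀ x ∈ U, ∀ i j, pd φ i (pd φ j u) x =
      etaInner r (pd φ · u x) (pd φ · u x) / (2 * u x) * eta n r i j := by
    intro x hx i j
    rw [← h.hessEq_iff hn hsu hupos hx]
    have h1 := hsol x hx i j
    have hpd : ∀ y ∈ U, ∀ k, pd φ k (fun y => u y * Ω y) y = pd φ k Ω' y :=
      fun y hy k => (h.pd_congr hΩ' hy k).symm
    have h2 : hess φ g (fun y => u y * Ω y) i j x = hess φ g Ω' i j x := by
      simp only [hess, hpd x hx]
      rw [h.pd_congr (fun y hy => hpd y hy j) hx]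
    have h3 : gradInner φ g (fun y => u y * Ω y) (fun y => u y * Ω y) x =
        gradInner φ g Ω' Ω' x := by
      simp only [gradInner, hpd x hx]
    rw [h2, h3, h1, hΩ' hx]
  set c : M → ℝ := fun y => etaInner r (pd φ · u y) (pd φ · u y) / (2 * u y) with hcdef
  have hsu' := h.smooth_pd hsu
  have hterm : ∀ k, SmoothFn n U (fun y => sgn r k * pd φ k u y * pd φ k u y) := fun k =>
    SmoothFn.mul (SmoothFn.mul (SmoothFn.const (sgn r k)) (hsu' k)) (hsu' k)
  have hsN : SmoothFn n U (fun y => etaInner r (pd φ · u y) (pd φ · u y)) :=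
    SmoothFn.sum fun k _ => hterm k
  have hs2 : SmoothFn n U (fun y => 2 * u y) := SmoothFn.mul (SmoothFn.const 2) hsu
  have h20 : ∀ x ∈ U, 2 * u x ≠ 0 := fun x hx => by have := hupos x hx; positivity
  have hsc : SmoothFn n U c := SmoothFn.div hsN hs2 h20
  -- The coefficient `c = |du|² / (2u)` is constant because `∂_i |du|² = 2 c ∂_i u`.
  have hdc : ∀ x ∈ U, ∀ i, pd φ i c x = 0 := by
    intro x hx i
    have hdN : pd φ i (fun y => etaInner r (pd φ · u y) (pd φ · u y)) x = 2 * c x * pd φ i u x := by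
      have e1 : pd φ i (fun y => etaInner r (pd φ · u y) (pd φ · u y)) x =
          ∑ k, 2 * pd φ k u x * (sgn r k * pd φ i (pd φ k u) x) := by
        unfold etaInner
        rw [h.pd_sum (fun k _ => hterm k) hx]
        refine Finset.sum_congr rfl fun k _ => ?_
        rw [h.pd_mul (SmoothFn.mul (SmoothFn.const (sgn r k)) (hsu' k)) (hsu' k) hx, pd_const_mul]
        ring
      rw [e1]
      have e2 : ∀ k, 2 * pd φ k u x * (sgn r k * pd φ i (pd φ k u) x) =
          2 * c x * (eta n r i k * (sgn r k * pd φ k u x)) := by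
        intro k
        rw [heq x hx i k]
        ring
      simp only [e2, ← Finset.mul_sum, sum_eta_mul]
      rw [← mul_assoc (sgn r i), sgn_mul_self, one_mul]
    have hN : etaInner r (pd φ · u x) (pd φ · u x) = c x * (2 * u x) := by
      simp only [hcdef]
      have := (hupos x hx).ne'
      field_simp
    simp only [hcdef]
    rw [h.pd_div hsN hs2 h20 hx, hdN, pd_const_mul, hN]
    ring
  have hup : u p = 1 := by
    have := h.ne_zero p hp
    simp [hu, hval, this]
  have hdup : ∀ i, pd φ i u p = 0 := by
    intro i
    have h0 := h.ne_zero p hp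
    simp only [hu]
    rw [h.pd_div hs' h.smooth h.ne_zero hp, hd, hval]
    ring
  have hcp : c p = 0 := by simp [hcdef, hdup, etaInner]
  have hc0 : ∀ x ∈ U, c x = 0 := fun x hx => by
    rw [h.eq_of_pd_eq_zero hc hsc hdc hx hp, hcp]
  have hdu0 : ∀ x ∈ U, ∀ j, pd φ j u x = 0 := fun x hx j => by
    rw [h.eq_of_pd_eq_zero hc (hsu' j) (fun y hy i => ?_) hx hp, hdup]
    have e1 := heq y hy i j
    have e2 := hc0 y hy
    simp only [hcdef] at e2
    rw [e2, zero_mul] at e1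
    exact e1
  have : u x = 1 := by rw [h.eq_of_pd_eq_zero hc hsu hdu0 hx hp, hup]
  rw [hΩ' hx]
  simp [this]

end ConformallyFlat

/-! ### Special conformal transformations -/

section SpecialConformal

variable {n : ℕ} (r : ℕ)

theorem etaInner_comm (v w : Fin n → ℝ) : etaInner r v w = etaInner r w v :=
  Finset.sum_congr rfl fun k _ => by ring

theorem etaInner_add_left (v v' w : Fin n → ℝ) :
    etaInner r (v + v') w = etaInner r v w + etaInner r v' w := by
  simp only [etaInner, Pi.add_apply, ← Finset.sum_add_distrib]
  exact Finset.sum_congr rfl fun k _ => by ring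

theorem etaInner_smul_left (c : ℝ) (v w : Fin n → ℝ) :
    etaInner r (c • v) w = c * etaInner r v w := by
  simp only [etaInner, Pi.smul_apply, smul_eq_mul, Finset.mul_sum]
  exact Finset.sum_congr rfl fun k _ => by ring

theorem etaInner_add_right (v w w' : Fin n → ℝ) :
    etaInner r v (w + w') = etaInner r v w + etaInner r v w' := by
  rw [etaInner_comm, etaInner_add_left, etaInner_comm r w, etaInner_comm r w']

theorem etaInner_smul_right (c : ℝ) (v w : Fin n → ℝ) :
    etaInner r v (c • w) = c * etaInner r v w := by
  rw [etaInner_comm, etaInner_smul_left, etaInner_comm]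

theorem etaInner_single (v : Fin n → ℝ) (i : Fin n) :
    etaInner r v (EuclideanSpace.single i (1 : ℝ) : Model n) = sgn r i * v i := by
  simp [etaInner]

/-- The denominator `1 + ⟨b, x⟩ + ¼ ⟨b, b⟩ ⟨x, x⟩` of a special conformal transformation. -/
def confDen (b : Model n) (x : Model n) : ℝ :=
  1 + etaInner r b x + 1 / 4 * etaInner r b b * etaInner r x x

/-- The special conformal transformation
`x ↦ (x + ½ ⟨x, x⟩ b) / (1 + ⟨b, x⟩ + ¼ ⟨b, b⟩ ⟨x, x⟩)`. -/
def confMap (b : Model n) (x : Model n) : Model n :=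
  (confDen r b x)⁻¹ • (x + (1 / 2 * etaInner r x x) • b)

variable {r}

theorem contDiff_etaInner {f h : Model n → Model n} (hf : ContDiff ℝ ∞ f) (hh : ContDiff ℝ ∞ h) :
    ContDiff ℝ ∞ (fun x => etaInner r (f x) (h x)) := by
  unfold etaInner
  have := contDiff_euclidean.1 hf
  have := contDiff_euclidean.1 hh
  fun_prop

theorem contDiff_confDen (b : Model n) : ContDiff ℝ ∞ (confDen r b) := by
  have h1 : ContDiff ℝ ∞ (fun x : Model n => etaInner r b x) :=
    contDiff_etaInner contDiff_const contDiff_id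
  have h2 : ContDiff ℝ ∞ (fun x : Model n => etaInner r x x) :=
    contDiff_etaInner contDiff_id contDiff_id
  unfold confDen
  fun_prop

theorem contDiffAt_confMap (b : Model n) {x : Model n} (hx : confDen r b x ≠ 0) :
    ContDiffAt ℝ ∞ (confMap r b) x := by
  have h2 : ContDiff ℝ ∞ (fun x : Model n => etaInner r x x) :=
    contDiff_etaInner contDiff_id contDiff_id
  exact ((contDiff_confDen b).contDiffAt.inv hx).smul (by fun_prop)

theorem hasDerivAt_quadratic {E : Type*} [NormedAddCommGroup E] [NormedSpace ℝ E] (α β γ : E) :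
    HasDerivAt (fun t : ℝ => α + t • β + t ^ 2 • γ) β 0 := by
  have h1 : HasDerivAt (fun t : ℝ => t • β) ((1 : ℝ) • β) 0 := (hasDerivAt_id (0 : ℝ)).smul_const β
  have h2 : HasDerivAt (fun t : ℝ => t ^ 2 • γ) (((2 : ℕ) * (0 : ℝ) ^ (2 - 1)) • γ) 0 :=
    (hasDerivAt_pow 2 (0 : ℝ)).smul_const γ
  simpa using (h1.const_add α).fun_add h2

theorem etaInner_line (x v : Model n) (t : ℝ) :
    etaInner r (x + t • v : Model n) (x + t • v : Model n) =
      etaInner r x x + t * (2 * etaInner r x v) + t ^ 2 * etaInner r v v := by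
  rw [WithLp.ofLp_add, WithLp.ofLp_smul]
  simp only [etaInner_add_left, etaInner_add_right, etaInner_smul_left, etaInner_smul_right]
  rw [etaInner_comm r v x]
  ring

/-- Directional derivatives of a special conformal transformation. -/
theorem fderiv_confMap (b : Model n) {x : Model n} (hx : confDen r b x ≠ 0) (v : Model n) :
    fderiv ℝ (confMap r b) x v = (confDen r b x)⁻¹ • (v + etaInner r x v • b)
      - ((etaInner r b v + 1 / 2 * etaInner r b b * etaInner r x v) / confDen r b x ^ 2) •
        (x + (1 / 2 * etaInner r x x) • b) := by
  have hd : HasDerivAt (fun t : ℝ => confMap r b (x + t • v)) (fderiv ℝ (confMap r b) x v) 0 :=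
    (((contDiffAt_confMap b hx).differentiableAt (by simp)).hasFDerivAt).hasLineDerivAt v
  have h1 : (fun t : ℝ => confDen r b (x + t • v)) = fun t : ℝ => confDen r b x
      + t • (etaInner r b v + 1 / 2 * etaInner r b b * etaInner r x v)
      + t ^ 2 • (1 / 4 * etaInner r b b * etaInner r v v) := by
    ext t
    simp only [confDen, etaInner_line, smul_eq_mul]
    rw [WithLp.ofLp_add, WithLp.ofLp_smul, etaInner_add_right, etaInner_smul_right]
    ring
  have h2 : (fun t : ℝ => (x + t • v) + (1 / 2 * etaInner r (x + t • v : Model n)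
      (x + t • v : Model n)) • b) = fun t : ℝ => (x + (1 / 2 * etaInner r x x) • b)
      + t • (v + etaInner r x v • b) + t ^ 2 • ((1 / 2 * etaInner r v v) • b) := by
    ext t : 1
    rw [etaInner_line]
    module
  have hd1 := hasDerivAt_quadratic (confDen r b x)
    (etaInner r b v + 1 / 2 * etaInner r b b * etaInner r x v)
    (1 / 4 * etaInner r b b * etaInner r v v)
  have hd2 := hasDerivAt_quadratic (x + (1 / 2 * etaInner r x x) • b) (v + etaInner r x v • b)
    ((1 / 2 * etaInner r v v) • b)
  rw [← h1] at hd1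
  rw [← h2] at hd2
  have hd3 := (hd1.fun_inv (by simpa using hx)).fun_smul hd2
  have := hd.unique hd3
  rw [this]
  simp only [zero_smul, add_zero]
  rw [neg_div, neg_smul]
  abel

/-- A special conformal transformation multiplies the metric by `confDen⁻²`. -/
theorem etaInner_fderiv_confMap (b : Model n) {x : Model n} (hx : confDen r b x ≠ 0)
    (v w : Model n) :
    etaInner r (fderiv ℝ (confMap r b) x v) (fderiv ℝ (confMap r b) x w) =
      (confDen r b x ^ 2)⁻¹ * etaInner r v w := by
  rw [fderiv_confMap b hx, fderiv_confMap b hx]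
  set D := confDen r b x with hD
  have hDeq : D = 1 + etaInner r b x + 1 / 4 * etaInner r b b * etaInner r x x := hD
  simp only [WithLp.ofLp_add, WithLp.ofLp_smul, sub_eq_add_neg, ← neg_smul,
    etaInner_add_left, etaInner_add_right, etaInner_smul_left, etaInner_smul_right]
  rw [etaInner_comm r v x, etaInner_comm r v b, etaInner_comm r x b]
  field_simp
  rw [hDeq]
  ring

end SpecialConformal

/-! ### Normalized conformally flat charts -/

section ConformalMaps

variable {n r : ℕ}

theorem eq_zero_of_etaInner (v : Model n) (h : ∀ w : Model n, etaInner r v w = 0) : v = 0 := by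
  ext i
  have := h (EuclideanSpace.single i 1)
  rw [etaInner_single] at this
  simpa using (mul_eq_zero.1 this).resolve_left (sgn_ne_zero r i)

/-- A smooth map which is conformal on an open set `S` is a diffeomorphism near each point of
`S`. -/
theorem exists_openPartialHomeomorph_of_conformal {F : Model n → Model n} {S : Set (Model n)}
    (hS : IsOpen S) (hF : ∀ y ∈ S, ContDiffAt ℝ ∞ F y) {κ : Model n → ℝ} (hκ : ∀ y ∈ S, κ y ≠ 0)
    (hconf : ∀ y ∈ S, ∀ v w : Model n,
      etaInner r (fderiv ℝ F y v) (fderiv ℝ F y w) = κ y * etaInner r v w)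
    {y₀ : Model n} (hy₀ : y₀ ∈ S) :
    ∃ ψ : OpenPartialHomeomorph (Model n) (Model n), y₀ ∈ ψ.source ∧ ψ.source ⊆ S ∧ ⇑ψ = F ∧
      ContDiffOn ℝ ∞ ψ ψ.source ∧ ContDiffOn ℝ ∞ ψ.symm ψ.target := by
  -- The differential preserves a nondegenerate form up to a factor, hence is invertible.
  have hequiv : ∀ y ∈ S, ∃ L : Model n ≃L[ℝ] Model n,
      HasFDerivAt F (L : Model n →L[ℝ] Model n) y := by
    intro y hy
    have hinj : Function.Injective (fderiv ℝ F y : Model n →ₗ[ℝ] Model n) := by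
      rw [injective_iff_map_eq_zero]
      intro v hv
      refine eq_zero_of_etaInner (r := r) v fun w => ?_
      have := hconf y hy v w
      rw [show fderiv ℝ F y v = 0 from hv] at this
      have h0 : etaInner r (0 : Model n) (fderiv ℝ F y w) = 0 := by simp [etaInner]
      rw [h0] at this
      exact (mul_eq_zero.1 this.symm).resolve_left (hκ y hy)
    refine ⟨(LinearEquiv.ofInjectiveEndo _ hinj).toContinuousLinearEquiv, ?_⟩
    have h1 : (((LinearEquiv.ofInjectiveEndo _ hinj).toContinuousLinearEquiv :
        Model n ≃L[ℝ] Model n) : Model n →L[ℝ] Model n) = fderiv ℝ F y := by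
      ext v : 1
      rfl
    rw [h1]
    exact ((hF y hy).differentiableAt (by simp)).hasFDerivAt
  obtain ⟨L, hL⟩ := hequiv y₀ hy₀
  set ψ₀ := (hF y₀ hy₀).toOpenPartialHomeomorph F hL (by simp) with hψ₀
  have hcoe : ⇑(ψ₀.restrOpen S hS) = F := rfl
  have hsrc : (ψ₀.restrOpen S hS).source = ψ₀.source ∩ S := rfl
  refine ⟨ψ₀.restrOpen S hS, ⟨(hF y₀ hy₀).mem_toOpenPartialHomeomorph_source hL (by simp), hy₀⟩,
    fun y hy => hy.2, hcoe, ?_, ?_⟩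
  · intro y hy
    exact (hF y hy.2).contDiffWithinAt
  · intro z hz
    have hy := (ψ₀.restrOpen S hS).map_target hz
    obtain ⟨L', hL'⟩ := hequiv _ hy.2
    exact ((ψ₀.restrOpen S hS).contDiffAt_symm hz hL' (hF _ hy.2)).contDiffWithinAt

variable {M : Type*} [TopologicalSpace M] [ChartedSpace (Model n) M]
  [IsManifold (𝓡 n) ∞ M] {g : BilinField (n := n) M}

/-- Near each point `p` of a conformally flat chart there is a conformally flat chart whose
conformal factor has value `1` and vanishing differential at `p`. It is obtained by composing with
a special conformal transformation, whose parameter absorbs `dΩ₀` at `p`, and a homothety, which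
absorbs `Ω₀ p`. -/
theorem IsConfFlatChart.exists_normalized {φ₀ : OpenPartialHomeomorph M (Model n)} {Ω₀ : M → ℝ}
    {U₀ : Set M} (h : IsConfFlatChart r φ₀ g Ω₀ U₀) {p : M} (hp : p ∈ U₀) :
    ∃ (φ : OpenPartialHomeomorph M (Model n)) (Ω : M → ℝ), p ∈ φ.source ∧ φ.source ⊆ U₀ ∧
      IsConfFlatChart r φ g Ω φ.source ∧ Ω p = 1 ∧ ∀ i, pd φ i Ω p = 0 := by
  have hΩ₀ := h.pos p hp
  set a : ℝ := Ω₀ p with ha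
  -- The parameter of the special conformal transformation, determined by `dΩ = 0` at `p`.
  set b : Model n := WithLp.toLp 2 fun i => -(sgn r i * pd φ₀ i Ω₀ p / a) with hb
  set y₀ : Model n := φ₀ p with hy₀
  set u : Model n → ℝ := fun y => confDen r b (y - y₀) with hu
  set F : Model n → Model n := fun y => a • confMap r b (y - y₀) with hF
  have hu0 : u y₀ = 1 := by simp [hu, confDen, etaInner]
  have husm : ContDiff ℝ ∞ u := (contDiff_confDen b).comp (contDiff_id.sub contDiff_const)
  set S : Set (Model n) := {y | 0 < u y} ∩ (φ₀.target ∩ φ₀.symm ⁻¹' U₀) with hS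
  have hSo : IsOpen S := (isOpen_lt continuous_const husm.continuous).inter
    (φ₀.isOpen_inter_preimage_symm h.isOpen)
  have hpsrc := h.subset hp
  have hSy₀ : y₀ ∈ S := by
    refine ⟨?_, φ₀.map_source hpsrc, ?_⟩
    · change 0 < u y₀
      rw [hu0]; exact one_pos
    · simpa [hy₀, φ₀.left_inv hpsrc] using hp
  have hFd : ∀ y ∈ S, ContDiffAt ℝ ∞ F y := fun y hy =>
    ((contDiffAt_confMap b (ne_of_gt hy.1)).comp y
      (contDiffAt_id.sub contDiffAt_const)).const_smul a
  have hFconf : ∀ y ∈ S, ∀ v w : Model n, etaInner r (fderiv ℝ F y v) (fderiv ℝ F y w) =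
      (a ^ 2 * (u y ^ 2)⁻¹) * etaInner r v w := by
    intro y hy v w
    have h1 : ∀ v, fderiv ℝ F y v = a • fderiv ℝ (confMap r b) (y - y₀) v := by
      intro v
      have hd : DifferentiableAt ℝ (confMap r b) (y - y₀) :=
        (contDiffAt_confMap b (ne_of_gt hy.1)).differentiableAt (by simp)
      have hd' : DifferentiableAt ℝ (fun y => confMap r b (y - y₀)) y :=
        DifferentiableAt.comp (g := confMap r b) (f := fun y => y - y₀) y hd
          (differentiableAt_id.sub_const y₀)
      rw [hF, fderiv_fun_const_smul hd', fderiv_comp_sub]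
      rfl
    rw [h1, h1, WithLp.ofLp_smul, WithLp.ofLp_smul, etaInner_smul_left, etaInner_smul_right,
      etaInner_fderiv_confMap b (ne_of_gt hy.1)]
    ring
  obtain ⟨ψ, hψ₀, hψS, hψF, hψ1, hψ2⟩ := exists_openPartialHomeomorph_of_conformal hSo hFd
    (κ := fun y => a ^ 2 * (u y ^ 2)⁻¹)
    (fun y hy => by have : 0 < u y := hy.1; positivity) hFconf hSy₀
  set φ := φ₀.trans ψ with hφdef
  have hsrc : φ.source = φ₀.source ∩ φ₀ ⁻¹' ψ.source := φ₀.trans_source ψ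
  have hsub : φ.source ⊆ U₀ := by
    intro x hx
    rw [hsrc] at hx
    have := (hψS hx.2).2.2
    simpa [φ₀.left_inv hx.1] using this
  have hmem : φ ∈ IsManifold.maximalAtlas (𝓡 n) ∞ M := by
    refine OpenPartialHomeomorph.mem_maximalAtlas_of_contMDiffOn _ ?_ ?_
    · exact (contMDiffOn_iff_contDiffOn.2 hψ1).comp
        ((contMDiffOn_of_mem_maximalAtlas h.mem).mono fun x hx => (hsrc ▸ hx).1)
        (fun x hx => (hsrc ▸ hx).2)
    · rw [φ₀.trans_target ψ]
      exact (contMDiffOn_symm_of_mem_maximalAtlas h.mem).comp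
        ((contMDiffOn_iff_contDiffOn.2 hψ2).mono fun x hx => hx.1) (fun x hx => hx.2)
  have hφ : IsChartOn φ φ.source := ⟨hmem, φ.open_source, subset_rfl⟩
  have hφ₀ : IsChartOn φ₀ φ.source := h.toIsChartOn.mono φ.open_source hsub
  have hpφ : p ∈ φ.source := by rw [hsrc]; exact ⟨hpsrc, hψ₀⟩
  have hupos : ∀ x ∈ φ.source, 0 < u (φ₀ x) := fun x hx => by
    rw [hsrc] at hx
    exact (hψS hx.2).1
  set Ω : M → ℝ := fun x => Ω₀ x * (u (φ₀ x) / a) with hΩ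
  have hsu : SmoothFn n φ.source (fun x => u (φ₀ x)) :=
    hφ₀.smooth_comp fun x _ => husm.contDiffAt
  have hsΩ₀ : SmoothFn n φ.source Ω₀ := ContMDiffOn.mono h.smooth hsub
  have hsua : SmoothFn n φ.source (fun x => u (φ₀ x) / a) := by
    simp only [div_eq_mul_inv]
    exact SmoothFn.mul hsu (SmoothFn.const _)
  have hsΩ : SmoothFn n φ.source Ω := SmoothFn.mul hsΩ₀ hsua
  refine ⟨φ, Ω, hpφ, hsub, ⟨hφ, hsΩ, fun x hx => ?_, fun x hx => ?_⟩, ?_, ?_⟩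
  · exact mul_pos (h.pos x (hsub hx)) (div_pos (hupos x hx) hΩ₀)
  · set J := transMat φ₀ φ x with hJ
    have hux := hupos x hx
    have hx' : φ₀ x ∈ S := by rw [hsrc] at hx; exact hψS hx.2
    have hJi : ∀ i c, J c i = (fderiv ℝ F (φ₀ x) (EuclideanSpace.single i 1) : Model n) c := by
      intro i c
      have hev : (coordFn φ c ∘ φ₀.symm) =ᶠ[𝓝 (φ₀ x)]
          (EuclideanSpace.proj c : Model n →L[ℝ] ℝ) ∘ F := by
        filter_upwards [φ₀.open_target.mem_nhds (φ₀.map_source (hφ₀.subset hx))] with z hz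
        simp [coordFn, hφdef, φ₀.right_inv hz, hψF]
      simp only [hJ, transMat, Matrix.of_apply, pd]
      rw [hev.fderiv_eq, fderiv_comp _ (ContinuousLinearMap.differentiableAt _)
        ((hFd _ hx').differentiableAt (by simp)), ContinuousLinearMap.fderiv]
      rfl
    have hJη : J.transpose * eta n r * J = (a ^ 2 * (u (φ₀ x) ^ 2)⁻¹) • eta n r := by
      ext i j
      have h1 := hFconf _ hx' (EuclideanSpace.single i 1) (EuclideanSpace.single j 1)
      rw [etaInner_single] at h1
      rw [conj_apply]
      have h2 : ∀ c, ∑ d, J c i * J d j * eta n r c d = sgn r c * J c i * J c j := by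
        intro c
        have : ∀ d, J c i * J d j * eta n r c d = eta n r c d * (J c i * J d j) := fun d => by ring
        simp only [this, sum_eta_mul]
        ring
      simp only [h2]
      simp only [hJi]
      refine (h1.trans ?_)
      rw [Matrix.smul_apply, smul_eq_mul, eta_apply]
      by_cases hij : i = j
      · subst hij; simp
      · simp [hij]
    have h3 := hφ₀.comp_chain hφ (g := g) hx
    rw [h.comp_eq x (hsub hx), ← hJ] at h3
    have h4 : J.transpose * (comp φ g x) * J = J.transpose * (Ω x ^ 2 • eta n r) * J := by
      rw [← h3, Matrix.mul_smul, Matrix.smul_mul, hJη, smul_smul]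
      congr 1
      simp only [hΩ]
      field_simp
    set K := transMat φ φ₀ x
    have hJK : J * K = 1 := hφ.transMat_mul hφ₀ hx
    have hJK' : K.transpose * J.transpose = 1 := by
      rw [← Matrix.transpose_mul, hJK, Matrix.transpose_one]
    have h5 := congrArg (fun X => K.transpose * X * K) h4
    simpa only [Matrix.mul_assoc, hJK, Matrix.mul_one, ← Matrix.mul_assoc K.transpose, hJK',
      Matrix.one_mul] using h5
  · have : u (φ₀ p) = 1 := hu0
    simp only [hΩ, this]
    rw [← ha]
    field_simp
  · have hdu : ∀ i, pd φ₀ i (fun x => u (φ₀ x)) p = sgn r i * b i := by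
      intro i
      have hev : ((fun x => u (φ₀ x)) ∘ φ₀.symm) =ᶠ[𝓝 (φ₀ p)] u := by
        filter_upwards [φ₀.open_target.mem_nhds (φ₀.map_source hpsrc)] with z hz
        simp [φ₀.right_inv hz]
      rw [pd, hev.fderiv_eq]
      have hd : HasDerivAt (fun t : ℝ => u (y₀ + t • EuclideanSpace.single i (1 : ℝ)))
          (fderiv ℝ u y₀ (EuclideanSpace.single i 1)) 0 :=
        ((husm.differentiable (by simp)).differentiableAt.hasFDerivAt).hasLineDerivAt _
      have hq : (fun t : ℝ => u (y₀ + t • EuclideanSpace.single i (1 : ℝ))) = fun t : ℝ => 1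
          + t • (sgn r i * b i) + t ^ 2 • (1 / 4 * etaInner r b b * sgn r i) := by
        ext t
        simp only [hu, confDen, add_sub_cancel_left, WithLp.ofLp_smul, etaInner_smul_right,
          etaInner_single, smul_eq_mul]
        simp
        ring
      rw [hq] at hd
      exact hd.unique (hasDerivAt_quadratic _ _ _)
    intro i
    rw [hφ.pd_chain hφ₀ hsΩ hpφ]
    refine Finset.sum_eq_zero fun c _ => ?_
    have : pd φ₀ c Ω p = 0 := by
      simp only [hΩ]
      rw [hφ₀.pd_mul hsΩ₀ hsua hpφ]
      simp only [div_eq_mul_inv]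
      rw [pd_mul_const, hdu, show u (φ₀ p) = 1 from hu0, hb, ← ha]
      simp only
      have := sgn_mul_self r c
      field_simp
      linear_combination (-pd φ₀ c Ω₀ p) * this
    rw [this, mul_zero]

end ConformalMaps

/-! ### Functions with prescribed second derivatives -/

section Affine

variable {n r : ℕ} {M : Type*} [TopologicalSpace M] [ChartedSpace (Model n) M]
  {φ : OpenPartialHomeomorph M (Model n)} {U : Set M} {f : M → ℝ} {x p : M}

/-- The coordinate functions of the chart `φ`, shifted so as to vanish at `p`. -/
def centered (φ : OpenPartialHomeomorph M (Model n)) (p : M) (x : M) (j : Fin n) : ℝ :=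
  coordFn φ j x - coordFn φ j p

@[simp] theorem centered_self (j : Fin n) : centered φ p p j = 0 := sub_self _

theorem IsChartOn.smooth_centered (h : IsChartOn φ U) (j : Fin n) :
    SmoothFn n U (fun x => centered φ p x j) :=
  SmoothFn.sub (h.smooth_coordFn j) (SmoothFn.const _)

theorem IsChartOn.pd_centered (h : IsChartOn φ U) (hx : x ∈ U) (i j : Fin n) :
    pd φ i (fun x => centered φ p x j) x = if j = i then 1 else 0 := by
  unfold centered
  rw [h.pd_sub (h.smooth_coordFn j) (SmoothFn.const _) hx, h.pd_coordFn hx, pd_const, sub_zero]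

theorem IsChartOn.smooth_linear (h : IsChartOn φ U) (c : Fin n → ℝ) :
    SmoothFn n U (fun x => ∑ j, c j * centered φ p x j) :=
  SmoothFn.sum fun j _ => SmoothFn.mul (SmoothFn.const (c j)) (h.smooth_centered j)

theorem IsChartOn.pd_linear (h : IsChartOn φ U) (hx : x ∈ U) (c : Fin n → ℝ) (i : Fin n) :
    pd φ i (fun x => ∑ j, c j * centered φ p x j) x = c i := by
  rw [h.pd_sum (fun j _ => SmoothFn.mul (SmoothFn.const (c j)) (h.smooth_centered j)) hx]
  simp [pd_const_mul, h.pd_centered hx]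

theorem IsChartOn.smooth_etaInner_centered (h : IsChartOn φ U) :
    SmoothFn n U (fun x => etaInner r (centered φ p x) (centered φ p x)) :=
  SmoothFn.sum fun k _ => SmoothFn.mul (SmoothFn.mul (SmoothFn.const (sgn r k))
    (h.smooth_centered k)) (h.smooth_centered k)

theorem IsChartOn.pd_etaInner_centered (h : IsChartOn φ U) (hx : x ∈ U) (i : Fin n) :
    pd φ i (fun x => etaInner r (centered φ p x) (centered φ p x)) x =
      2 * (sgn r i * centered φ p x i) := by
  unfold etaInner
  rw [h.pd_sum (fun k _ => SmoothFn.mul (SmoothFn.mul (SmoothFn.const (sgn r k))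
    (h.smooth_centered k)) (h.smooth_centered k)) hx]
  have : ∀ k, pd φ i (fun x => sgn r k * centered φ p x k * centered φ p x k) x =
      if k = i then 2 * (sgn r k * centered φ p x k) else 0 := by
    intro k
    rw [h.pd_mul (SmoothFn.mul (SmoothFn.const (sgn r k)) (h.smooth_centered k))
      (h.smooth_centered k) hx, pd_const_mul, h.pd_centered hx]
    split_ifs <;> ring
  simp [this]

/-- A function with constant differential on a connected set is affine. -/
theorem IsChartOn.eq_affine_of_pd (h : IsChartOn φ U) (hc : IsPreconnected U) (hp : p ∈ U)
    (hf : SmoothFn n U f) {c : Fin n → ℝ} (hd : ∀ x ∈ U, ∀ i, pd φ i f x = c i) (hx : x ∈ U) :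
    f x = f p + ∑ j, c j * centered φ p x j := by
  have h0 := h.eq_of_pd_eq_zero hc (SmoothFn.sub hf (h.smooth_linear (p := p) c))
    (fun y hy i => by rw [h.pd_sub hf (h.smooth_linear c) hy, hd y hy, h.pd_linear hy, sub_self])
    hx hp
  simp only [centered_self, mul_zero, Finset.sum_const_zero, sub_zero] at h0
  linarith

/-- A function with vanishing second derivatives on a connected set has constant differential. -/
theorem IsChartOn.pd_eq_of_pd_pd (h : IsChartOn φ U) (hc : IsPreconnected U) (hp : p ∈ U)
    (hf : SmoothFn n U f) (hd : ∀ x ∈ U, ∀ i j, pd φ i (pd φ j f) x = 0) (hx : x ∈ U)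
    (i : Fin n) : pd φ i f x = pd φ i f p :=
  h.eq_of_pd_eq_zero hc (h.smooth_pd hf i) (fun y hy j => hd y hy j i) hx hp

end Affine

/-! ### Liouville's theorem -/

section Liouville

variable {n r : ℕ} {M : Type*} [TopologicalSpace M] [ChartedSpace (Model n) M]
  {φ : OpenPartialHomeomorph M (Model n)} {U : Set M} {x p : M}

/-- The conformal Killing equation `∂_i v_j + ∂_j v_i = 2 σ η_{ij}` in flat coordinates determines
the second derivatives of `v` in terms of the differential of `σ`. -/
theorem IsChartOn.pd_pd_of_killing (h : IsChartOn φ U) {v : Fin n → M → ℝ} {σ : M → ℝ}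
    (hv : ∀ i, SmoothFn n U (v i))
    (hk : ∀ x ∈ U, ∀ i j, pd φ i (v j) x + pd φ j (v i) x = 2 * σ x * eta n r i j)
    (hx : x ∈ U) (i j k : Fin n) : pd φ i (pd φ j (v k)) x =
      eta n r j k * pd φ i σ x + eta n r i k * pd φ j σ x - eta n r i j * pd φ k σ x := by
  have hd : ∀ a b c, pd φ a (pd φ b (v c)) x + pd φ a (pd φ c (v b)) x =
      2 * pd φ a σ x * eta n r b c := by
    intro a b c
    rw [← h.pd_add (h.smooth_pd (hv c) b) (h.smooth_pd (hv b) c) hx,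
      h.pd_congr (fun y hy => hk y hy b c) hx, pd_mul_const, pd_const_mul]
  have h1 := hd j i k
  have h2 := hd i j k
  have h3 := hd k i j
  rw [h.pd_comm (hv k) hx j i] at h1
  rw [h.pd_comm (hv j) hx k i, h.pd_comm (hv i) hx k j] at h3
  linear_combination (1 / 2) * h1 + (1 / 2) * h2 - (1 / 2) * h3

/-- In dimension at least three the conformal Killing equation forces the second derivatives of
`σ` to vanish: this is the integrability condition `∂_l ∂_i ∂_j v_k = ∂_i ∂_l ∂_j v_k`,
contracted twice. -/
theorem IsChartOn.pd_pd_eq_zero_of_killing (h : IsChartOn φ U) (hn : 3 ≤ n) {v : Fin n → M → ℝ}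
    {σ : M → ℝ} (hv : ∀ i, SmoothFn n U (v i)) (hσ : SmoothFn n U σ)
    (hk : ∀ x ∈ U, ∀ i j, pd φ i (v j) x + pd φ j (v i) x = 2 * σ x * eta n r i j)
    (hx : x ∈ U) (l j : Fin n) : pd φ l (pd φ j σ) x = 0 := by
  have hn' : (3 : ℝ) ≤ n := by exact_mod_cast hn
  have h3 : ∀ l i j k, pd φ l (pd φ i (pd φ j (v k))) x = eta n r j k * pd φ l (pd φ i σ) x
      + eta n r i k * pd φ l (pd φ j σ) x - eta n r i j * pd φ l (pd φ k σ) x := by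
    intro l i j k
    rw [h.pd_congr (fun y hy => h.pd_pd_of_killing hv hk hy i j k) hx,
      h.pd_sub (SmoothFn.add (SmoothFn.mul (SmoothFn.const _) (h.smooth_pd hσ i))
        (SmoothFn.mul (SmoothFn.const _) (h.smooth_pd hσ j)))
        (SmoothFn.mul (SmoothFn.const _) (h.smooth_pd hσ k)) hx,
      h.pd_add (SmoothFn.mul (SmoothFn.const _) (h.smooth_pd hσ i))
        (SmoothFn.mul (SmoothFn.const _) (h.smooth_pd hσ j)) hx, pd_const_mul, pd_const_mul,
      pd_const_mul]
  have h4 : ∀ l i j k, eta n r i k * pd φ l (pd φ j σ) x - eta n r i j * pd φ l (pd φ k σ) x =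
      eta n r l k * pd φ i (pd φ j σ) x - eta n r l j * pd φ i (pd φ k σ) x := by
    intro l i j k
    have e1 := h.pd_comm (h.smooth_pd (hv k) j) hx l i
    rw [h3, h3, h.pd_comm hσ hx l i] at e1
    linarith
  set B := ∑ i, sgn r i * pd φ i (pd φ i σ) x with hB
  -- Contraction of `h4` over `i` and `k`.
  have h5 : ∀ l j, ((n : ℝ) - 2) * pd φ l (pd φ j σ) x = -(eta n r l j * B) := by
    intro l j
    have e1 := Finset.sum_congr (rfl : (Finset.univ : Finset (Fin n)) = Finset.univ)
      fun i _ => congrArg (sgn r i * ·) (h4 l i j i)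
    simp only [eta_self] at e1
    have a1 : ∀ i, sgn r i * (sgn r i * pd φ l (pd φ j σ) x - eta n r i j * pd φ l (pd φ i σ) x) =
        pd φ l (pd φ j σ) x - eta n r j i * (sgn r i * pd φ l (pd φ i σ) x) := by
      intro i
      rw [eta_symm r i j]
      linear_combination pd φ l (pd φ j σ) x * sgn_mul_self r i
    have a2 : ∀ i, sgn r i * (eta n r l i * pd φ i (pd φ j σ) x
        - eta n r l j * pd φ i (pd φ i σ) x) =
        eta n r l i * (sgn r i * pd φ i (pd φ j σ) x)
          - eta n r l j * (sgn r i * pd φ i (pd φ i σ) x) := fun i => by ring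
    simp only [a1, a2, Finset.sum_sub_distrib, sum_eta_mul, ← Finset.mul_sum, Finset.sum_const,
      Finset.card_univ, Fintype.card_fin, nsmul_eq_mul] at e1
    rw [← hB] at e1
    linear_combination e1 + pd φ l (pd φ j σ) x * sgn_mul_self r j
      + pd φ l (pd φ j σ) x * sgn_mul_self r l
  -- The trace of `h5` reads `(2 n - 2) B = 0`.
  have h6 : B = 0 := by
    have e1 := Finset.sum_congr (rfl : (Finset.univ : Finset (Fin n)) = Finset.univ)
      fun i _ => congrArg (sgn r i * ·) (h5 i i)
    simp only [eta_self] at e1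
    have a1 : ∀ i, sgn r i * (((n : ℝ) - 2) * pd φ i (pd φ i σ) x) =
        ((n : ℝ) - 2) * (sgn r i * pd φ i (pd φ i σ) x) := fun i => by ring
    have a2 : ∀ i : Fin n, sgn r i * -(sgn r i * B) = -B := fun i => by
      linear_combination (-B) * sgn_mul_self r i
    simp only [a1, a2, ← Finset.mul_sum, ← hB] at e1
    simp at e1
    have : (2 * (n : ℝ) - 2) * B = 0 := by linarith
    exact (mul_eq_zero.1 this).resolve_left (by linarith)
  have h7 := h5 l j
  rw [h6, mul_zero, neg_zero] at h7
  exact (mul_eq_zero.1 h7).resolve_left (by linarith)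

/-- Liouville's theorem: in flat coordinates, a conformal Killing vector on a connected set is the
quadratic polynomial determined by its values and those of `dv`, `σ` and `dσ` at a point. -/
theorem IsChartOn.liouville (h : IsChartOn φ U) (hn : 3 ≤ n) (hc : IsPreconnected U) (hp : p ∈ U)
    {v : Fin n → M → ℝ} {σ : M → ℝ} (hv : ∀ i, SmoothFn n U (v i)) (hσ : SmoothFn n U σ)
    (hk : ∀ x ∈ U, ∀ i j, pd φ i (v j) x + pd φ j (v i) x = 2 * σ x * eta n r i j)
    (hx : x ∈ U) (k : Fin n) : v k x = v k p
      + (∑ j, centered φ p x j * ((1 / 2 : ℝ) * (pd φ j (v k) p - pd φ k (v j) p)))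
      + (σ p + ∑ j, pd φ j σ p * centered φ p x j) * (sgn r k * centered φ p x k)
      - 1 / 2 * etaInner r (centered φ p x) (centered φ p x) * pd φ k σ p := by
  have hσ0 : ∀ y ∈ U, ∀ i, pd φ i σ y = pd φ i σ p := fun y hy i =>
    h.pd_eq_of_pd_pd hc hp hσ (fun z hz a b => h.pd_pd_eq_zero_of_killing hn hv hσ hk hz a b) hy i
  set w : Fin n → ℝ := fun i => pd φ i σ p with hw
  set X := centered φ p with hX
  have hdv : ∀ y ∈ U, ∀ j, pd φ j (v k) y = pd φ j (v k) p
      + ∑ i, (eta n r j k * w i + eta n r i k * w j - eta n r i j * w k) * X y i := by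
    intro y hy j
    refine h.eq_affine_of_pd hc hp (h.smooth_pd (hv k) j) (fun z hz i => ?_) hy
    rw [h.pd_pd_of_killing hv hk hz, hσ0 z hz, hσ0 z hz, hσ0 z hz]
  have hsX := fun j => h.smooth_centered (p := p) j
  set m : Fin n → ℝ := fun j => (1 / 2 : ℝ) * (pd φ j (v k) p - pd φ k (v j) p) with hm
  -- The right-hand side without its constant term; it has the same differential as `v k`.
  set T : M → ℝ := fun y => (∑ j, m j * X y j) + (σ p + ∑ j, w j * X y j) * (sgn r k * X y k)
    - w k * (1 / 2) * etaInner r (X y) (X y) with hT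
  have hs1 : SmoothFn n U (fun y => ∑ j, m j * X y j) := h.smooth_linear m
  have hs2 : SmoothFn n U (fun y => σ p + ∑ j, w j * X y j) :=
    SmoothFn.add (SmoothFn.const _) (h.smooth_linear w)
  have hs3 : SmoothFn n U (fun y => sgn r k * X y k) :=
    SmoothFn.mul (SmoothFn.const _) (hsX k)
  have hs4 : SmoothFn n U (fun y => w k * (1 / 2) * etaInner r (X y) (X y)) :=
    SmoothFn.mul (SmoothFn.const _) h.smooth_etaInner_centered
  have hsT : SmoothFn n U T := SmoothFn.sub (SmoothFn.add hs1 (SmoothFn.mul hs2 hs3)) hs4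
  have hdT : ∀ y ∈ U, ∀ j, pd φ j T y = m j + (w j * (sgn r k * X y k)
      + (σ p + ∑ j, w j * X y j) * eta n r j k) - w k * (sgn r j * X y j) := by
    intro y hy j
    simp only [hT]
    rw [h.pd_sub (SmoothFn.add hs1 (SmoothFn.mul hs2 hs3)) hs4 hy,
      h.pd_add hs1 (SmoothFn.mul hs2 hs3) hy, h.pd_linear hy, h.pd_mul hs2 hs3 hy,
      h.pd_add (SmoothFn.const _) (h.smooth_linear w) hy, pd_const, h.pd_linear hy,
      pd_const_mul, pd_const_mul, h.pd_centered hy, h.pd_etaInner_centered hy, eta_symm r j k,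
      eta_apply]
    split_ifs <;> ring
  have hdiff := h.eq_of_pd_eq_zero hc (SmoothFn.sub (hv k) hsT) (fun y hy j => by
    rw [h.pd_sub (hv k) hsT hy, hdv y hy j, hdT y hy j]
    have e1 : ∑ i, (eta n r j k * w i + eta n r i k * w j - eta n r i j * w k) * X y i =
        eta n r j k * (∑ i, w i * X y i) + w j * (∑ i, eta n r k i * X y i)
          - w k * ∑ i, eta n r j i * X y i := by
      simp only [Finset.mul_sum, ← Finset.sum_add_distrib, ← Finset.sum_sub_distrib]
      refine Finset.sum_congr rfl fun i _ => ?_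
      rw [eta_symm r i k, eta_symm r i j]
      ring
    rw [e1, sum_eta_mul, sum_eta_mul]
    have e2 := hk p hp j k
    simp only [hm]
    linear_combination (1 / 2) * e2) hx hp
  have hTp : T p = 0 := by simp [hT, hX, etaInner]
  rw [hTp, sub_zero] at hdiff
  have : ∑ j, X x j * m j = ∑ j, m j * X x j := Finset.sum_congr rfl fun j _ => mul_comm _ _
  rw [this]
  simp only [hT] at hdiff
  linear_combination hdiff

end Liouville

/-! ### The functions `Y^α` in flat coordinates -/

section AffineSystem

variable {n r : ℕ} {M : Type*} [TopologicalSpace M] [ChartedSpace (Model n) M]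
  [IsManifold (𝓡 n) ∞ M]

variable {e φ : OpenPartialHomeomorph M (Model n)} {U : Set M} {x p : M}
  {g gE : BilinField (n := n) M} {Ω : M → ℝ} {Y : Fin n → M → ℝ}

theorem comp_rescale : comp e (rescale Ω g) x = (Ω x ^ 2)⁻¹ • comp e g x := rfl

theorem compInv_rescale (h0 : Ω x ≠ 0) :
    compInv e (rescale Ω g) x = Ω x ^ 2 • compInv e g x := by
  unfold compInv
  rw [comp_rescale]
  have h : (Ω x ^ 2)⁻¹ ≠ 0 := inv_ne_zero (pow_ne_zero 2 h0)
  by_cases hdet : IsUnit (comp e g x).det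
  · have h2 := Matrix.inv_smul' (comp e g x) (Units.mk0 _ h) hdet
    rw [Units.smul_def, Units.val_mk0] at h2
    rw [h2]
    simp [Units.smul_def]
  · have h2 : ¬ IsUnit ((Ω x ^ 2)⁻¹ • comp e g x).det := by
      rw [Matrix.det_smul]
      intro h3
      exact hdet (isUnit_of_mul_isUnit_right h3)
    rw [Matrix.nonsing_inv_apply_not_isUnit _ hdet, Matrix.nonsing_inv_apply_not_isUnit _ h2,
      smul_zero]

/-- The gradient of the rescaled metric. -/
theorem grad_rescale (h0 : Ω x ≠ 0) (f : M → ℝ) :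
    grad e (rescale Ω g) f x = Ω x ^ 2 • grad e g f x := by
  simp only [grad, compInv_rescale h0, Matrix.smul_apply, smul_eq_mul, Finset.smul_sum, smul_smul,
    Finset.mul_sum, mul_assoc]

/-- A conformally flat chart for `g` with factor `Ω` is a flat chart for `Ω⁻² g`. -/
theorem IsConfFlatChart.rescaled (h : IsConfFlatChart r φ g Ω U) :
    IsConfFlatChart r φ (rescale Ω g) (fun _ => 1) U := by
  refine ⟨h.toIsChartOn, SmoothFn.const 1, fun _ _ => one_pos, fun x hx => ?_⟩
  have := h.ne_zero x hx
  rw [comp_rescale, h.comp_eq x hx, smul_smul, inv_mul_cancel₀ (pow_ne_zero 2 this)]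
  simp

theorem IsConfFlatChart.hess_flat (h : IsConfFlatChart r φ gE (fun _ => 1) U) (hx : x ∈ U)
    (f : M → ℝ) (i j : Fin n) : hess φ gE f i j x = pd φ i (pd φ j f) x := by
  rw [h.hess_eq hx]
  simp [dLog, etaInner]

theorem IsConfFlatChart.vecComp_grad_flat (h : IsConfFlatChart r φ gE (fun _ => 1) U) (hx : x ∈ U)
    (f : M → ℝ) (k : Fin n) : vecComp φ (grad φ gE f) k x = sgn r k * pd φ k f x := by
  rw [h.vecComp_grad hx, h.compInv_eq hx]
  simp only [one_pow, inv_one, one_smul, Matrix.mulVec, dotProduct, sum_eta_mul]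
  rfl

theorem IsAffineSystem.pd_eq (hY : IsAffineSystem φ gE U p Y)
    (h : IsConfFlatChart r φ gE (fun _ => 1) U) (hc : IsPreconnected U) (hp : p ∈ U) (hx : x ∈ U)
    (A j : Fin n) : pd φ j (Y A) x = jac φ Y p A j :=
  h.pd_eq_of_pd_pd hc hp (hY.smooth A)
    (fun y hy a b => by rw [← h.hess_flat hy, hY.hess_eq_zero A y hy]) hx j

theorem IsAffineSystem.eq_linear (hY : IsAffineSystem φ gE U p Y)
    (h : IsConfFlatChart r φ gE (fun _ => 1) U) (hc : IsPreconnected U) (hp : p ∈ U) (hx : x ∈ U)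
    (A : Fin n) : Y A x = ∑ j, jac φ Y p A j * centered φ p x j := by
  rw [h.eq_affine_of_pd hc hp (hY.smooth A) (fun y hy j => hY.pd_eq h hc hp hy A j) hx,
    hY.zero_at A, zero_add]

theorem IsAffineSystem.isUnit_jac (hY : IsAffineSystem φ gE U p Y)
    (h : IsConfFlatChart r φ gE (fun _ => 1) U) (hc : IsPreconnected U) (hp : p ∈ U) :
    IsUnit (jac φ Y p) := by
  rw [← Matrix.linearIndependent_rows_iff_isUnit, Fintype.linearIndependent_iff]
  intro c hc0
  refine Fintype.linearIndependent_iff.1 hY.linearIndependent c ?_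
  ext ⟨x, hx⟩
  simp only [Finset.sum_apply, Pi.smul_apply, smul_eq_mul, Pi.zero_apply]
  simp only [hY.eq_linear h hc hp hx, Finset.mul_sum]
  rw [Finset.sum_comm]
  refine Finset.sum_eq_zero fun j _ => ?_
  have : ∑ a, c a * jac φ Y p a j = 0 := by
    simpa [Finset.sum_apply] using congrFun hc0 j
  calc ∑ a, c a * (jac φ Y p a j * centered φ p x j)
      = (∑ a, c a * jac φ Y p a j) * centered φ p x j := by
        rw [Finset.sum_mul]
        exact Finset.sum_congr rfl fun a _ => by ring
    _ = 0 := by rw [this, zero_mul]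

theorem IsAffineSystem.hMat_eq (hY : IsAffineSystem φ gE U p Y)
    (h : IsConfFlatChart r φ gE (fun _ => 1) U) (hc : IsPreconnected U) (hp : p ∈ U) (hx : x ∈ U) :
    hMat φ gE Y x = jac φ Y p * eta n r * (jac φ Y p).transpose := by
  ext A B
  simp only [hMat, Matrix.of_apply]
  rw [h.gradInner_eq hx]
  simp only [hY.pd_eq h hc hp hx, etaInner, Matrix.mul_apply, Matrix.transpose_apply,
    Finset.sum_mul, one_pow, inv_one, one_mul]
  refine Finset.sum_congr rfl fun k _ => ?_
  have : ∀ l, jac φ Y p A l * eta n r l k * jac φ Y p B k =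
      eta n r k l * (jac φ Y p A l * jac φ Y p B k) := fun l => by rw [eta_symm r l k]; ring
  simp only [this, sum_eta_mul]
  ring

/-- A statement about the indices `0, 1, …, n + 1` may be checked on `0`, on `1, …, n` and on
`n + 1`. -/
theorem forall_index {P : Fin (n + 2) → Prop} (h0 : P 0) (hmid : ∀ A : Fin n, P (mid A))
    (hlast : P (Fin.last (n + 1))) (α : Fin (n + 2)) : P α := by
  refine Fin.cases h0 (fun β => ?_) α
  exact Fin.lastCases (motive := fun β => P β.succ) hlast hmid β

theorem sum_index {E : Type*} [AddCommMonoid E] (G : Fin (n + 2) → E) :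
    ∑ α, G α = G 0 + (∑ A : Fin n, G (mid A) + G (Fin.last (n + 1))) := by
  rw [Fin.sum_univ_succ, Fin.sum_univ_castSucc]
  rfl

@[simp] theorem extend_zero : extend e gE Y 0 = fun _ => 1 := rfl

@[simp] theorem extend_mid (A : Fin n) : extend e gE Y (mid A) = Y A := by
  unfold extend mid
  rw [Fin.cons_succ, Fin.snoc_castSucc]

theorem extend_last (x : M) : extend e gE Y (Fin.last (n + 1)) x =
    (1 / 2 : ℝ) * ∑ A, ∑ B, (hMat e gE Y x)⁻¹ A B * Y A x * Y B x := by
  unfold extend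
  rw [← Fin.succ_last, Fin.cons_succ, Fin.snoc_last]

/-- The function `Y^{n+1}` is half the squared distance from `p`. -/
theorem IsAffineSystem.extend_last_eq (hY : IsAffineSystem φ gE U p Y)
    (h : IsConfFlatChart r φ gE (fun _ => 1) U) (hc : IsPreconnected U) (hp : p ∈ U) (hx : x ∈ U) :
    extend φ gE Y (Fin.last (n + 1)) x =
      (1 / 2 : ℝ) * etaInner r (centered φ p x) (centered φ p x) := by
  set A := jac φ Y p with hA
  have hAu : IsUnit A.det := (Matrix.isUnit_iff_isUnit_det _).1 (hY.isUnit_jac h hc hp)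
  have hAu' : IsUnit A.transpose.det := by rwa [Matrix.det_transpose]
  set X := centered φ p x with hX
  have hYX : (fun a => Y a x) = A.mulVec X := by
    ext a
    exact hY.eq_linear h hc hp hx a
  have hinv : (hMat φ gE Y x)⁻¹ = (A⁻¹).transpose * (eta n r * A⁻¹) := by
    rw [hY.hMat_eq h hc hp hx, Matrix.mul_inv_rev, Matrix.mul_inv_rev, Matrix.transpose_nonsing_inv,
      Matrix.inv_eq_left_inv (eta_mul_eta n r)]
  rw [extend_last]
  congr 1
  have h1 : ∑ a, ∑ b, (hMat φ gE Y x)⁻¹ a b * Y a x * Y b x =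
      (fun a => Y a x) ⬝ᵥ ((hMat φ gE Y x)⁻¹).mulVec (fun a => Y a x) := by
    simp only [dotProduct, Matrix.mulVec, Finset.mul_sum]
    exact Finset.sum_congr rfl fun a _ => Finset.sum_congr rfl fun b _ => by ring
  rw [h1, hYX, hinv, Matrix.mulVec_mulVec, Matrix.dotProduct_mulVec, Matrix.vecMul_mulVec,
    ← Matrix.dotProduct_mulVec]
  have h2 : A.transpose * ((A⁻¹).transpose * (eta n r * A⁻¹) * A) = eta n r := by
    rw [Matrix.transpose_nonsing_inv, Matrix.mul_assoc, Matrix.mul_assoc,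
      Matrix.nonsing_inv_mul _ hAu, Matrix.mul_one,
      ← Matrix.mul_assoc, Matrix.mul_nonsing_inv _ hAu', Matrix.one_mul]
  rw [h2]
  simp only [dotProduct, Matrix.mulVec, sum_eta_mul, etaInner]
  exact Finset.sum_congr rfl fun a _ => by ring

theorem IsAffineSystem.smooth_extend (hY : IsAffineSystem φ gE U p Y)
    (h : IsConfFlatChart r φ gE (fun _ => 1) U) (hc : IsPreconnected U) (hp : p ∈ U)
    (α : Fin (n + 2)) : SmoothFn n U (extend φ gE Y α) := by
  refine forall_index (P := fun α => SmoothFn n U (extend φ gE Y α)) ?_ (fun A => ?_) ?_ α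
  · rw [extend_zero]; exact SmoothFn.const 1
  · rw [extend_mid]; exact hY.smooth A
  · exact ContMDiffOn.congr (SmoothFn.mul (SmoothFn.const _) h.smooth_etaInner_centered)
      fun y hy => hY.extend_last_eq h hc hp hy

theorem IsAffineSystem.pd_extend_last (hY : IsAffineSystem φ gE U p Y)
    (h : IsConfFlatChart r φ gE (fun _ => 1) U) (hc : IsPreconnected U) (hp : p ∈ U) (hx : x ∈ U)
    (i : Fin n) : pd φ i (extend φ gE Y (Fin.last (n + 1))) x = sgn r i * centered φ p x i := by
  rw [h.pd_congr (fun y hy => hY.extend_last_eq h hc hp hy) hx, pd_const_mul,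
    h.pd_etaInner_centered hx]
  ring

/-- The Hessian of each of the functions `Y^α` is a constant multiple of the flat metric. -/
theorem IsAffineSystem.exists_pd_pd_extend (hY : IsAffineSystem φ gE U p Y)
    (h : IsConfFlatChart r φ gE (fun _ => 1) U) (hc : IsPreconnected U) (hp : p ∈ U)
    (α : Fin (n + 2)) : ∃ c : ℝ, ∀ x ∈ U, ∀ i j,
      pd φ i (pd φ j (extend φ gE Y α)) x = c * eta n r i j := by
  refine forall_index (P := fun α => ∃ c : ℝ, ∀ x ∈ U, ∀ i j,
    pd φ i (pd φ j (extend φ gE Y α)) x = c * eta n r i j) ⟨0, ?_⟩ (fun A => ⟨0, ?_⟩) ⟨1, ?_⟩ α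
  · intro x hx i j
    have : pd φ j (fun _ : M => (1 : ℝ)) = fun _ => 0 := by ext y; simp
    simp [this]
  · intro x hx i j
    rw [extend_mid, ← h.hess_flat hx, hY.hess_eq_zero A x hx, zero_mul]
  · intro x hx i j
    rw [h.pd_congr (fun y hy => hY.pd_extend_last h hc hp hy j) hx, pd_const_mul,
      h.pd_centered hx, eta_symm, eta_apply]
    split_ifs <;> ring

end AffineSystem

/-! ### Conformal Killing vectors in flat coordinates -/

section KillingFlat

variable {n r : ℕ} {M : Type*} [TopologicalSpace M] [ChartedSpace (Model n) M]
  [IsManifold (𝓡 n) ∞ M]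

variable {φ : OpenPartialHomeomorph M (Model n)} {U : Set M} {x p : M}
  {g : BilinField (n := n) M} {Ω Ψ : M → ℝ} {Y : Fin n → M → ℝ} {ξ : VectorField (n := n) M}

/-- The components `ξ_k` of a vector field with the index lowered by means of `eta n r`. -/
def flatComp (r : ℕ) (φ : OpenPartialHomeomorph M (Model n)) (ξ : VectorField (n := n) M)
    (k : Fin n) (x : M) : ℝ :=
  sgn r k * vecComp φ ξ k x

theorem vecComp_eq_flatComp (k : Fin n) (x : M) :
    vecComp φ ξ k x = sgn r k * flatComp r φ ξ k x := by
  unfold flatComp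
  rw [← mul_assoc, sgn_mul_self, one_mul]

theorem IsChartOn.smooth_flatComp (h : IsChartOn φ U) (hξ : SmoothField U ξ) (k : Fin n) :
    SmoothFn n U (flatComp r φ ξ k) :=
  SmoothFn.mul (SmoothFn.const _) (h.smooth_vecComp hξ k)

/-- The derivative `ξ(log Ω)`. -/
def logDeriv (φ : OpenPartialHomeomorph M (Model n)) (Ω : M → ℝ) (ξ : VectorField (n := n) M)
    (x : M) : ℝ :=
  ∑ k, vecComp φ ξ k x * dLog φ Ω k x

theorem IsConfFlatChart.smooth_logDeriv (h : IsConfFlatChart r φ g Ω U) (hξ : SmoothField U ξ) :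
    SmoothFn n U (logDeriv φ Ω ξ) :=
  SmoothFn.sum fun k _ => SmoothFn.mul (h.smooth_vecComp hξ k) (h.smooth_dLog k)

theorem IsConfFlatChart.lieMetric_eq (h : IsConfFlatChart r φ g Ω U) (hx : x ∈ U) (i j : Fin n) :
    lieMetric φ g ξ i j x = Ω x ^ 2 * (2 * logDeriv φ Ω ξ x * eta n r i j
      + pd φ i (flatComp r φ ξ j) x + pd φ j (flatComp r φ ξ i) x) := by
  have h1 : ∀ a, pd φ a (fun y => comp φ g y i j) x =
      2 * Ω x ^ 2 * dLog φ Ω a x * eta n r i j := by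
    intro a
    rw [h.pd_congr (f' := fun y => Ω y ^ 2 * eta n r i j)
      (fun y hy => by simp [h.comp_eq y hy]) hx, pd_mul_const, h.pd_sq h.smooth hx, h.pd_eq hx]
    ring
  have h2 : ∀ a b, pd φ a (flatComp r φ ξ b) x = sgn r b * pd φ a (vecComp φ ξ b) x :=
    fun a b => pd_const_mul _ _
  have e1 : ∀ k, eta n r k j * pd φ i (vecComp φ ξ k) x = eta n r j k * pd φ i (vecComp φ ξ k) x :=
    fun k => by rw [eta_symm r k j]
  simp only [lieMetric, h1, h2, h.comp_eq x hx, Matrix.smul_apply, smul_eq_mul, mul_assoc,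
    Finset.sum_add_distrib, ← Finset.mul_sum, e1, sum_eta_mul]
  have e2 : ∑ k, vecComp φ ξ k x * (2 * (Ω x ^ 2 * (dLog φ Ω k x * eta n r i j))) =
      2 * Ω x ^ 2 * logDeriv φ Ω ξ x * eta n r i j := by
    rw [logDeriv, Finset.mul_sum, Finset.sum_mul]
    exact Finset.sum_congr rfl fun k _ => by ring
  rw [e2]
  ring

/-- The conformal Killing equation in flat coordinates. -/
theorem IsConfFlatChart.lieMetric_eq_iff (h : IsConfFlatChart r φ g Ω U) (hx : x ∈ U)
    (i j : Fin n) (c : ℝ) : lieMetric φ g ξ i j x = 2 * c * comp φ g x i j ↔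
      pd φ i (flatComp r φ ξ j) x + pd φ j (flatComp r φ ξ i) x =
        2 * (c - logDeriv φ Ω ξ x) * eta n r i j := by
  have h0 := pow_ne_zero 2 (h.ne_zero x hx)
  rw [h.lieMetric_eq hx, h.comp_eq x hx, Matrix.smul_apply, smul_eq_mul]
  constructor
  · intro H
    have := mul_left_cancel₀ h0 (H.trans (by ring : 2 * c * (Ω x ^ 2 * eta n r i j) =
      Ω x ^ 2 * (2 * c * eta n r i j)))
    linarith
  · intro H
    linear_combination Ω x ^ 2 * H

theorem IsConfFlatChart.lower_eq (h : IsConfFlatChart r φ g Ω U) (hx : x ∈ U) (i : Fin n) :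
    lower φ g ξ i x = Ω x ^ 2 * flatComp r φ ξ i x := by
  rw [h.toIsChartOn.lower_eq hx, h.comp_eq x hx]
  have : ∀ k, vecComp φ ξ k x * (Ω x ^ 2 • eta n r) k i =
      Ω x ^ 2 * (eta n r i k * vecComp φ ξ k x) := fun k => by
    rw [Matrix.smul_apply, smul_eq_mul, eta_symm r k i]; ring
  simp only [this, ← Finset.mul_sum, sum_eta_mul]
  rfl

/-- The conformal factor of a conformal Killing vector is smooth. -/
theorem IsConformalKilling.smooth_factor (h : IsConfFlatChart r φ g Ω U) (hn : 3 ≤ n)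
    (hξ : IsConformalKilling φ g U ξ Ψ) : SmoothFn n U Ψ := by
  -- Any diagonal component of the conformal Killing equation expresses `Ψ` in terms of `ξ`.
  let i₀ : Fin n := ⟨0, by omega⟩
  have hv := h.smooth_flatComp (r := r) hξ.smooth
  refine ContMDiffOn.congr (SmoothFn.add (h.smooth_logDeriv hξ.smooth)
    (SmoothFn.mul (SmoothFn.const (sgn r i₀)) (h.smooth_pd (hv i₀) i₀))) fun x hx => ?_
  have h1 := (h.lieMetric_eq_iff hx i₀ i₀ (Ψ x)).1 (hξ.lie x hx i₀ i₀)
  rw [eta_self] at h1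
  have h2 := sgn_mul_self r i₀
  linear_combination (-1 / 2 * sgn r i₀) * h1 - (Ψ x - logDeriv φ Ω ξ x) * h2

theorem vecComp_sub {ξ ζ : VectorField (n := n) M} (k : Fin n) :
    vecComp φ (fun y => ξ y - ζ y) k x = vecComp φ ξ k x - vecComp φ ζ k x := by
  unfold vecComp
  rw [map_sub]
  rfl

theorem vecComp_smul (f : M → ℝ) (k : Fin n) :
    vecComp φ (fun y => f y • ξ y) k x = f x * vecComp φ ξ k x := by
  unfold vecComp
  rw [map_smul]
  rfl

theorem IsConfFlatChart.flatComp_zeta (h : IsConfFlatChart r φ g Ω U) (hx : x ∈ U)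
    (α β : Fin (n + 2)) (k : Fin n) :
    flatComp r φ (zeta φ (rescale Ω g) Y α β) k x =
      extend φ (rescale Ω g) Y α x * pd φ k (extend φ (rescale Ω g) Y β) x
        - extend φ (rescale Ω g) Y β x * pd φ k (extend φ (rescale Ω g) Y α) x := by
  unfold flatComp zeta
  rw [vecComp_sub, vecComp_smul, vecComp_smul, h.rescaled.vecComp_grad_flat hx,
    h.rescaled.vecComp_grad_flat hx]
  have := sgn_mul_self r k
  linear_combination (extend φ (rescale Ω g) Y α x * pd φ k (extend φ (rescale Ω g) Y β) x
        - extend φ (rescale Ω g) Y β x * pd φ k (extend φ (rescale Ω g) Y α) x) * this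

theorem IsMetricOn.smooth_grad (h : IsChartOn φ U) (hg : IsMetricOn φ g U) {f : M → ℝ}
    (hf : SmoothFn n U f) : SmoothField U (grad φ g f) :=
  h.smoothField_sum fun i => SmoothFn.sum fun j _ =>
    SmoothFn.mul (hg.smooth_inv i j) (h.smooth_pd hf j)

/-- The vector fields `ζ^{αβ}` are conformal Killing vectors. -/
theorem IsAffineSystem.isConformalKilling_zeta (h : IsConfFlatChart r φ g Ω U)
    (hY : IsAffineSystem φ (rescale Ω g) U p Y) (hc : IsPreconnected U) (hp : p ∈ U)
    (α β : Fin (n + 2)) :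
    ∃ Ψ : M → ℝ, IsConformalKilling φ g U (zeta φ (rescale Ω g) Y α β) Ψ := by
  obtain ⟨a, ha⟩ := hY.exists_pd_pd_extend h.rescaled hc hp α
  obtain ⟨b, hb⟩ := hY.exists_pd_pd_extend h.rescaled hc hp β
  have hs := hY.smooth_extend h.rescaled hc hp
  set Z := extend φ (rescale Ω g) Y with hZ
  refine ⟨fun x => (Z α x * b - Z β x * a) + logDeriv φ Ω (zeta φ (rescale Ω g) Y α β) x,
    ?_, fun x hx i j => ?_⟩
  · have hg := fun γ => h.rescaled.isMetricOn.smooth_grad h.toIsChartOn (hs γ)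
    exact ((hs α).smul_section (hg β)).sub_section ((hs β).smul_section (hg α))
  · rw [h.lieMetric_eq_iff hx]
    have hd : ∀ i k, pd φ i (flatComp r φ (zeta φ (rescale Ω g) Y α β) k) x =
        (pd φ i (Z α) x * pd φ k (Z β) x + Z α x * (b * eta n r i k))
          - (pd φ i (Z β) x * pd φ k (Z α) x + Z β x * (a * eta n r i k)) := by
      intro i k
      rw [h.pd_congr (fun y hy => h.flatComp_zeta hy α β k) hx,
        h.pd_sub (SmoothFn.mul (hs α) (h.smooth_pd (hs β) k))
          (SmoothFn.mul (hs β) (h.smooth_pd (hs α) k)) hx,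
        h.pd_mul (hs α) (h.smooth_pd (hs β) k) hx, h.pd_mul (hs β) (h.smooth_pd (hs α) k) hx,
        ha x hx, hb x hx]
    rw [hd, hd, eta_symm r j i]
    ring

end KillingFlat

/-! ### The coefficients of a conformal Killing vector -/

section Coefficients

variable {n : ℕ}

/-- The family indexed by `0, 1, …, n + 1` with the entries `a`, `b 1, …, b n`, `c`. -/
def indexFamily {E : Type*} (a : E) (b : Fin n → E) (c : E) : Fin (n + 2) → E :=
  Fin.cons a (Fin.snoc (α := fun _ => E) b c)

@[simp] theorem indexFamily_zero {E : Type*} (a : E) (b : Fin n → E) (c : E) :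
    indexFamily a b c 0 = a := rfl

@[simp] theorem indexFamily_mid {E : Type*} (a : E) (b : Fin n → E) (c : E) (A : Fin n) :
    indexFamily a b c (mid A) = b A := by
  unfold indexFamily mid
  rw [Fin.cons_succ, Fin.snoc_castSucc]

@[simp] theorem indexFamily_last {E : Type*} (a : E) (b : Fin n → E) (c : E) :
    indexFamily a b c (Fin.last (n + 1)) = c := by
  unfold indexFamily
  rw [← Fin.succ_last, Fin.cons_succ, Fin.snoc_last]

/-- The skew matrix with the entries `F_{0B} = ρ_B`, `F_{AB} = θ_{AB}`, `F_{A,n+1} = μ_A` and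
`F_{0,n+1} = ψ`. -/
def skewCoeff (ρ : Fin n → ℝ) (θ : Matrix (Fin n) (Fin n) ℝ) (μ : Fin n → ℝ) (ψ : ℝ) :
    Matrix (Fin (n + 2)) (Fin (n + 2)) ℝ :=
  indexFamily (indexFamily 0 ρ ψ) (fun A => indexFamily (-ρ A) (θ A) (μ A))
    (indexFamily (-ψ) (fun A => -μ A) 0)

variable {ρ μ : Fin n → ℝ} {θ : Matrix (Fin n) (Fin n) ℝ} {ψ : ℝ}

theorem skewCoeff_zero : skewCoeff ρ θ μ ψ 0 = indexFamily 0 ρ ψ := rfl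

theorem skewCoeff_mid (A : Fin n) :
    skewCoeff ρ θ μ ψ (mid A) = indexFamily (-ρ A) (θ A) (μ A) := by
  unfold skewCoeff
  rw [indexFamily_mid]

theorem skewCoeff_last :
    skewCoeff ρ θ μ ψ (Fin.last (n + 1)) = indexFamily (-ψ) (fun A => -μ A) 0 := by
  unfold skewCoeff
  rw [indexFamily_last]

theorem skewCoeff_skew (hθ : ∀ A B, θ A B = -θ B A) (α β : Fin (n + 2)) :
    skewCoeff ρ θ μ ψ α β = -skewCoeff ρ θ μ ψ β α := by
  revert β
  refine forall_index (P := fun α => ∀ β, skewCoeff ρ θ μ ψ α β = -skewCoeff ρ θ μ ψ β α)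
    (fun β => ?_) (fun A β => ?_) (fun β => ?_) α
  · refine forall_index (P := fun β => skewCoeff ρ θ μ ψ 0 β = -skewCoeff ρ θ μ ψ β 0)
      ?_ (fun B => ?_) ?_ β <;>
    simp [skewCoeff_zero, skewCoeff_mid, skewCoeff_last]
  · refine forall_index
      (P := fun β => skewCoeff ρ θ μ ψ (mid A) β = -skewCoeff ρ θ μ ψ β (mid A))
      ?_ (fun B => ?_) ?_ β <;>
    simp [skewCoeff_zero, skewCoeff_mid, skewCoeff_last]
    exact hθ A B
  · refine forall_index (P := fun β => skewCoeff ρ θ μ ψ (Fin.last (n + 1)) β =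
      -skewCoeff ρ θ μ ψ β (Fin.last (n + 1))) ?_ (fun B => ?_) ?_ β <;>
    simp [skewCoeff_zero, skewCoeff_mid, skewCoeff_last]

/-- The contraction of the coefficients with the functions `Y^α` and one of their partial
derivatives, when `Y^1, …, Y^n` are linear functions of the flat coordinates `X`. -/
theorem sum_skewCoeff {A B : Matrix (Fin n) (Fin n) ℝ} (hBA : B * A = 1) (X v W : Fin n → ℝ)
    (w : Matrix (Fin n) (Fin n) ℝ) (ψ N d : ℝ) (k : Fin n) {Z D : Fin (n + 2) → ℝ}
    (hZ0 : Z 0 = 1) (hZ : ∀ a, Z (mid a) = A.mulVec X a) (hZl : Z (Fin.last (n + 1)) = N)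
    (hD0 : D 0 = 0) (hD : ∀ a, D (mid a) = A a k) (hDl : D (Fin.last (n + 1)) = d) :
    ∑ α, ∑ β, skewCoeff (Matrix.vecMul v B) (B.transpose * w * B) (Matrix.vecMul W B) ψ α β *
      (Z α * D β) = v k + Matrix.vecMul X w k + (ψ + W ⬝ᵥ X) * d - N * W k := by
  have hv : ∀ u : Fin n → ℝ, ∑ b, Matrix.vecMul u B b * A b k = u k := fun u => by
    have : Matrix.vecMul (Matrix.vecMul u B) A k = u k := by
      rw [Matrix.vecMul_vecMul, hBA, Matrix.vecMul_one]
    exact this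
  have hW : ∑ a, Matrix.vecMul W B a * A.mulVec X a = W ⬝ᵥ X := by
    have : Matrix.vecMul W B ⬝ᵥ A.mulVec X = W ⬝ᵥ X := by
      rw [← Matrix.dotProduct_mulVec, Matrix.mulVec_mulVec, hBA, Matrix.one_mulVec]
    exact this
  have hw : ∑ a, ∑ b, (B.transpose * w * B) a b * (A.mulVec X a * A b k) =
      Matrix.vecMul X w k := by
    have : Matrix.vecMul (A.mulVec X) ((B.transpose * w * B) * A) k = Matrix.vecMul X w k := by
      rw [Matrix.mul_assoc, hBA, Matrix.mul_one, ← Matrix.vecMul_vecMul, Matrix.vecMul_transpose,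
        Matrix.mulVec_mulVec, hBA, Matrix.one_mulVec]
    rw [← this]
    simp only [Matrix.vecMul, dotProduct, Matrix.mul_apply (N := A), Finset.mul_sum]
    exact Finset.sum_congr rfl fun a _ => Finset.sum_congr rfl fun b _ => by ring
  simp only [sum_index, skewCoeff_zero, skewCoeff_mid, skewCoeff_last,
    indexFamily_mid, indexFamily_last, hZ0, hZ, hZl, hD0, hD, hDl, mul_zero, zero_mul, zero_add,
    one_mul, add_zero, Finset.sum_add_distrib, hv, hw]
  have e1 : ∑ a, Matrix.vecMul W B a * (A.mulVec X a * d) = (W ⬝ᵥ X) * d := by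
    rw [← hW, Finset.sum_mul]
    exact Finset.sum_congr rfl fun a _ => by ring
  have e2 : ∑ a, -Matrix.vecMul W B a * (N * A a k) = -(N * W k) := by
    rw [← hv W, Finset.mul_sum, ← Finset.sum_neg_distrib]
    exact Finset.sum_congr rfl fun a _ => by ring
  rw [e1, e2]
  ring

/-- Contraction of `½ F_{αβ}` with `a^α G^β - a^β G^α`, for a skew `F`. -/
theorem half_sum_skew {ι E : Type*} [Fintype ι] [AddCommGroup E] [Module ℝ E]
    {F : Matrix ι ι ℝ} (hF : ∀ α β, F α β = -F β α) (a : ι → ℝ) (G : ι → E) :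
    (1 / 2 : ℝ) • ∑ α, ∑ β, F α β • (a α • G β - a β • G α) =
      ∑ α, ∑ β, (F α β * a α) • G β := by
  have h1 : ∑ α, ∑ β, (F α β * a β) • G α = -∑ α, ∑ β, (F α β * a α) • G β := by
    rw [Finset.sum_comm, ← Finset.sum_neg_distrib]
    refine Finset.sum_congr rfl fun α _ => ?_
    rw [← Finset.sum_neg_distrib]
    refine Finset.sum_congr rfl fun β _ => ?_
    rw [hF β α, neg_mul, neg_smul]
  simp only [smul_sub, smul_smul, Finset.sum_sub_distrib, h1]
  module

end Coefficients

section Expansion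

variable {n r : ℕ} {M : Type*} [TopologicalSpace M] [ChartedSpace (Model n) M]
  [IsManifold (𝓡 n) ∞ M]

variable {φ : OpenPartialHomeomorph M (Model n)} {U : Set M} {x p : M}
  {g : BilinField (n := n) M} {Ω Ψ : M → ℝ} {Y : Fin n → M → ℝ} {ξ : VectorField (n := n) M}

theorem vecComp_sum_sum {ι κ : Type*} [Fintype ι] [Fintype κ] (c : ι → κ → ℝ)
    (X : κ → VectorField (n := n) M) (i : Fin n) :
    vecComp φ (fun y => ∑ a, ∑ b, c a b • X b y) i x = ∑ a, ∑ b, c a b * vecComp φ (X b) i x := by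
  have h := vecComp_sum (e := φ) (x := x) (Finset.univ : Finset (ι × κ)) (fun q => c q.1 q.2)
    (fun q => X q.2) i
  rw [Fintype.sum_prod_type' (fun a b => c a b * vecComp φ (X b) i x)] at h
  rw [← h]
  refine vecComp_congr ?_ i
  rw [Fintype.sum_prod_type' (fun a b => c a b • X b x)]

/-- At a point where `Ω = 1` and `dΩ = 0`, the covector `∇Ψ + L(ξ, ·)` is the differential of the
conformal factor `Ψ - ξ(log Ω)` of `ξ` with respect to the flat metric. -/
theorem IsConfFlatChart.WHat_eq (h : IsConfFlatChart r φ g Ω U) (hn : 3 ≤ n) (hp : p ∈ U)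
    (hd : ∀ i, pd φ i Ω p = 0) (hξ : IsConformalKilling φ g U ξ Ψ) (k : Fin n) :
    WHat φ g ξ Ψ p k = pd φ k (fun y => Ψ y - logDeriv φ Ω ξ y) p := by
  have hl : ∀ i, dLog φ Ω i p = 0 := fun i => by rw [dLog, hd, zero_div]
  have hv := h.smooth_vecComp hξ.smooth
  rw [h.pd_sub (hξ.smooth_factor h hn) (h.smooth_logDeriv hξ.smooth) hp, WHat]
  have h1 : pd φ k (logDeriv φ Ω ξ) p = ∑ D, vecComp φ ξ D p * pd φ k (dLog φ Ω D) p := by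
    have := h.pd_sum (s := Finset.univ) (f := fun D y => vecComp φ ξ D y * dLog φ Ω D y)
      (fun D _ => SmoothFn.mul (hv D) (h.smooth_dLog D)) hp k
    refine this.trans (Finset.sum_congr rfl fun D _ => ?_)
    rw [h.pd_mul (hv D) (h.smooth_dLog D) hp, hl]
    ring
  have h2 : ∀ D, schouten φ g k D p = -pd φ k (dLog φ Ω D) p := fun D => by
    rw [h.schouten_eq hn hp]
    simp [hl, etaInner]
  simp only [h1, h2, mul_neg, Finset.sum_neg_distrib]
  ring

/-- The expansion of a conformal Killing vector in terms of its value, its curl, its conformal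
factor and the vector `W` at `p`, in a conformally flat chart that is normalized at `p`. -/
theorem IsConformalKilling.eq_sum_grad (h : IsConfFlatChart r φ g Ω U) (hn : 3 ≤ n)
    (hc : IsPreconnected U) (hp : p ∈ U) (h1 : Ω p = 1) (hd : ∀ i, pd φ i Ω p = 0)
    (hY : IsAffineSystem φ (rescale Ω g) U p Y) (hξ : IsConformalKilling φ g U ξ Ψ) (hx : x ∈ U) :
    ξ x = ∑ α, ∑ β, (skewCoeff (Matrix.vecMul (lower φ g ξ · p) (jac φ Y p)⁻¹)
        ((jac φ Y p)⁻¹.transpose * Matrix.of (omegaHat φ g ξ p) * (jac φ Y p)⁻¹)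
        (Matrix.vecMul (WHat φ g ξ Ψ p) (jac φ Y p)⁻¹) (Ψ p) α β *
          extend φ (rescale Ω g) Y α x) • grad φ (rescale Ω g) (extend φ (rescale Ω g) Y β) x := by
  set B := (jac φ Y p)⁻¹ with hB
  have hBA : B * jac φ Y p = 1 :=
    Matrix.nonsing_inv_mul _ ((Matrix.isUnit_iff_isUnit_det _).1 (hY.isUnit_jac h.rescaled hc hp))
  have hv := h.smooth_flatComp (r := r) hξ.smooth
  have hσ := SmoothFn.sub (hξ.smooth_factor h hn) (h.smooth_logDeriv hξ.smooth)
  have hσp : Ψ p - logDeriv φ Ω ξ p = Ψ p := by simp [logDeriv, dLog, hd]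
  have hlow : ∀ k, lower φ g ξ k p = flatComp r φ ξ k p := fun k => by
    rw [h.lower_eq hp, h1]; ring
  have hdlow : ∀ j k, pd φ j (lower φ g ξ k) p = pd φ j (flatComp r φ ξ k) p := fun j k => by
    rw [h.pd_congr (fun y hy => h.lower_eq hy k) hp, h.pd_mul (SmoothFn.pow h.smooth 2) (hv k) hp,
      h.pd_sq h.smooth hp, h1, hd]
    ring
  refine h.ext_vecComp hx (ζ := fun y => ∑ α, ∑ β, (skewCoeff (Matrix.vecMul (lower φ g ξ · p) B)
        (B.transpose * Matrix.of (omegaHat φ g ξ p) * B) (Matrix.vecMul (WHat φ g ξ Ψ p) B) (Ψ p)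
        α β * extend φ (rescale Ω g) Y α x) •
          grad φ (rescale Ω g) (extend φ (rescale Ω g) Y β) y) fun k => ?_
  rw [vecComp_sum_sum, vecComp_eq_flatComp (r := r)]
  simp only [h.rescaled.vecComp_grad_flat hx]
  have hL := h.liouville hn hc hp hv hσ
    (fun y hy i j => (h.lieMetric_eq_iff hy i j _).1 (hξ.lie y hy i j)) hx k
  have hS := sum_skewCoeff hBA (centered φ p x) (lower φ g ξ · p) (WHat φ g ξ Ψ p)
    (Matrix.of (omegaHat φ g ξ p)) (Ψ p)
    ((1 / 2 : ℝ) * etaInner r (centered φ p x) (centered φ p x)) (sgn r k * centered φ p x k) k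
    (Z := fun α => extend φ (rescale Ω g) Y α x)
    (D := fun β => pd φ k (extend φ (rescale Ω g) Y β) x)
    rfl (fun a => by rw [extend_mid]; exact hY.eq_linear h.rescaled hc hp hx a)
    (hY.extend_last_eq h.rescaled hc hp hx) (by simp)
    (fun a => by rw [extend_mid]; exact hY.pd_eq h.rescaled hc hp hx a k)
    (hY.pd_extend_last h.rescaled hc hp hx k)
  have hfin : flatComp r φ ξ k x = ∑ α, ∑ β, skewCoeff (Matrix.vecMul (lower φ g ξ · p) B)
      (B.transpose * Matrix.of (omegaHat φ g ξ p) * B) (Matrix.vecMul (WHat φ g ξ Ψ p) B) (Ψ p)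
      α β * (extend φ (rescale Ω g) Y α x * pd φ k (extend φ (rescale Ω g) Y β) x) := by
    rw [hS, hL, hσp]
    simp only [Matrix.vecMul, dotProduct, Matrix.of_apply, omegaHat, hdlow, hlow,
      h.WHat_eq hn hp hd hξ]
  rw [hfin, Finset.mul_sum]
  refine Finset.sum_congr rfl fun α _ => ?_
  rw [Finset.mul_sum]
  exact Finset.sum_congr rfl fun β _ => by ring

end Expansion

/-! ### Flatness and the Hessian equation -/

section Flat

variable {n r : ℕ} {M : Type*} [TopologicalSpace M] [ChartedSpace (Model n) M]
  [IsManifold (𝓡 n) ∞ M]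

variable {e φ : OpenPartialHomeomorph M (Model n)} {U V : Set M} {x p : M}
  {g gE : BilinField (n := n) M} {Ω : M → ℝ} {Y : Fin n → M → ℝ}

/-- The charts provided by the flatness of `Ω⁻² g` are conformally flat charts for `g`. -/
theorem IsFlatOn.exists_isConfFlatChart (h : IsFlatOn r (rescale Ω g) V)
    (hΩ : IsConformalFactor (n := n) V Ω) (hx : x ∈ V) :
    ∃ φ : OpenPartialHomeomorph M (Model n), x ∈ φ.source ∧ φ.source ⊆ V ∧
      IsConfFlatChart r φ g Ω φ.source := by
  obtain ⟨φ, hφ, hxφ, hsub, hc⟩ := h x hx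
  refine ⟨φ, hxφ, hsub, ⟨hφ, φ.open_source, subset_rfl⟩, hΩ.smooth.mono hsub,
    fun y hy => hΩ.pos y (hsub hy), fun y hy => ?_⟩
  have h0 : Ω y ^ 2 ≠ 0 := pow_ne_zero 2 (hΩ.pos y (hsub hy)).ne'
  rw [← hc y hy, comp_rescale, smul_smul, mul_inv_cancel₀ h0, one_smul]

/-- The metric `Ω⁻² g` is flat on `U`: the restriction of the chart to `U` is an isometry. -/
theorem IsConfFlatChart.isFlatOn (h : IsConfFlatChart r φ g Ω U) :
    IsFlatOn r (CKV.rescale Ω g) U := by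
  intro q hq
  have hs : (φ.restr U).source = U := by
    rw [φ.restr_source' U h.isOpen, Set.inter_eq_right.2 h.subset]
  refine ⟨φ.restr U, restr_mem_maximalAtlas (contDiffGroupoid ∞ (𝓡 n)) h.mem h.isOpen, hs.symm ▸ hq,
    hs.subset, fun x hx => ?_⟩
  rw [hs] at hx
  have := h.rescaled.comp_eq x hx
  rw [one_pow, one_smul] at this
  exact this

/-- Every conformal factor that makes the metric flat solves the Hessian equation, since it does so
in the flat charts of `Ω⁻² g`. -/
theorem IsFlatOn.solvesHessEq (h : IsFlatOn r (rescale Ω g) U) (hn : 3 ≤ n)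
    (hΩ : IsConformalFactor (n := n) U Ω) (he : IsChartOn e U) : SolvesHessEq e g U Ω := by
  intro x hx
  obtain ⟨ψ, hxψ, hsub, hψ⟩ := h.exists_isConfFlatChart hΩ hx
  exact (hψ.solvesHessEq hn).change (he.mono ψ.open_source hsub) hψ.toIsChartOn hψ.isMetricOn
    hψ.smooth x hxψ

/-! ### Independence of the chart -/

theorem IsAffineSystem.change (he : IsChartOn e U) (hφ : IsChartOn φ U) (hg : IsMetricOn φ gE U)
    (h : IsAffineSystem φ gE U p Y) : IsAffineSystem e gE U p Y := by
  refine ⟨h.smooth, h.linearIndependent, fun A x hx i j => ?_, h.zero_at⟩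
  have h0 : hessMat φ gE (Y A) x = 0 := by
    ext a b
    exact h.hess_eq_zero A x hx a b
  have h1 := hg.hessMat_chain he hφ (h.smooth A) hx
  rw [h0, Matrix.mul_zero, Matrix.zero_mul] at h1
  exact congrFun (congrFun h1 i) j

theorem IsConfFlatChart.isAffineSystem_centered (h : IsConfFlatChart r φ gE (fun _ => 1) U)
    (hp : p ∈ U) : IsAffineSystem φ gE U p fun A x => centered φ p x A := by
  refine ⟨h.smooth_centered, ?_, fun A x hx i j => ?_, fun A => centered_self A⟩
  · rw [Fintype.linearIndependent_iff]
    intro c hc i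
    have h1 : Set.EqOn (fun x => ∑ j, c j * centered φ p x j) (fun _ => 0) U := fun x hx => by
      simpa [Finset.sum_apply] using congrFun hc ⟨x, hx⟩
    rw [← h.pd_linear hp c i, h.pd_congr h1 hp, pd_const]
  · rw [h.hess_flat hx, h.pd_congr (fun y hy => h.pd_centered hy j A) hx, pd_const]

theorem IsMetricOn.hMat_chain (he : IsChartOn e U) (hφ : IsChartOn φ U) (hg : IsMetricOn φ gE U)
    (hY : ∀ A, SmoothFn n U (Y A)) (hx : x ∈ U) : hMat e gE Y x = hMat φ gE Y x := by
  ext A B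
  exact hg.gradInner_chain he hφ (hY A) (hY B) hx

theorem IsMetricOn.extend_chain (he : IsChartOn e U) (hφ : IsChartOn φ U) (hg : IsMetricOn φ gE U)
    (hY : ∀ A, SmoothFn n U (Y A)) (α : Fin (n + 2)) (hx : x ∈ U) :
    extend e gE Y α x = extend φ gE Y α x := by
  refine forall_index (P := fun α => extend e gE Y α x = extend φ gE Y α x) ?_ (fun A => ?_) ?_ α
  · rw [extend_zero, extend_zero]
  · rw [extend_mid, extend_mid]
  · rw [extend_last, extend_last, hg.hMat_chain he hφ hY hx]

theorem IsMetricOn.grad_extend_chain (he : IsChartOn e U) (hφ : IsChartOn φ U)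
    (hg : IsMetricOn φ gE U) (hY : ∀ A, SmoothFn n U (Y A)) {α : Fin (n + 2)}
    (hs : SmoothFn n U (extend φ gE Y α)) (hx : x ∈ U) :
    grad e gE (extend e gE Y α) x = grad φ gE (extend φ gE Y α) x := by
  rw [← hg.grad_chain he hφ hs hx]
  unfold grad
  simp only [he.pd_congr (fun y hy => hg.extend_chain he hφ hY α hy) hx]

theorem IsConformalKilling.congr (he : IsChartOn e U) {ξ ζ : VectorField (n := n) M} {Ψ : M → ℝ}
    (h : IsConformalKilling e g U ξ Ψ) (hζ : ∀ x ∈ U, ζ x = ξ x) :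
    IsConformalKilling e g U ζ Ψ := by
  refine ⟨h.smooth.congr fun x hx => by rw [hζ x hx], fun x hx i j => ?_⟩
  rw [← h.lie x hx i j]
  have hv : ∀ k, Set.EqOn (vecComp e ζ k) (vecComp e ξ k) U := fun k y hy =>
    vecComp_congr (hζ y hy) k
  unfold lieMetric
  simp only [he.pd_congr (hv _) hx, hv _ hx]

/-- The coefficients `F_{αβ}` do not depend on the chart in which they are computed. -/
theorem IsMetricOn.coeff_chain (he : IsChartOn e U) (hφ : IsChartOn φ U) (hg : IsMetricOn φ g U)
    (hY : ∀ A, SmoothFn n U (Y A)) {ξ : VectorField (n := n) M} (hξ : SmoothField U ξ) {Ψ : M → ℝ}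
    (hΨ : SmoothFn n U Ψ) (hp : p ∈ U) :
    skewCoeff (Matrix.vecMul (lower e g ξ · p) (jac e Y p)⁻¹)
        ((jac e Y p)⁻¹.transpose * Matrix.of (omegaHat e g ξ p) * (jac e Y p)⁻¹)
        (Matrix.vecMul (WHat e g ξ Ψ p) (jac e Y p)⁻¹) (Ψ p) =
      skewCoeff (Matrix.vecMul (lower φ g ξ · p) (jac φ Y p)⁻¹)
        ((jac φ Y p)⁻¹.transpose * Matrix.of (omegaHat φ g ξ p) * (jac φ Y p)⁻¹)
        (Matrix.vecMul (WHat φ g ξ Ψ p) (jac φ Y p)⁻¹) (Ψ p) := by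
  set J := transMat e φ p with hJ
  have hB : J * (jac e Y p)⁻¹ = (jac φ Y p)⁻¹ := by
    rw [jac_chain he hφ hY hp, Matrix.mul_inv_rev, ← Matrix.mul_assoc,
      Matrix.mul_nonsing_inv _ (he.isUnit_transMat hφ hp), Matrix.one_mul]
  have h1 : (lower e g ξ · p) = Matrix.vecMul (lower φ g ξ · p) J := by
    ext i
    rw [he.lower_chain hφ hp]
    exact Finset.sum_congr rfl fun a _ => mul_comm _ _
  have h2 : WHat e g ξ Ψ p = Matrix.vecMul (WHat φ g ξ Ψ p) J := by
    ext i
    rw [hg.WHat_chain he hφ ξ hΨ hp]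
    exact Finset.sum_congr rfl fun a _ => mul_comm _ _
  have h3 : Matrix.of (omegaHat e g ξ p) =
      J.transpose * Matrix.of (omegaHat φ g ξ p) * J := by
    ext i j
    rw [conj_apply]
    exact hg.omegaHat_chain he hφ hξ hp i j
  rw [h1, h2, h3, Matrix.vecMul_vecMul, Matrix.vecMul_vecMul, hB]
  congr 1
  rw [← hB, Matrix.transpose_mul]
  simp only [Matrix.mul_assoc]

theorem omegaHat_skew (ξ : VectorField (n := n) M) (C D : Fin n) :
    omegaHat e g ξ p C D = -omegaHat e g ξ p D C := by
  unfold omegaHat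
  ring

theorem conj_skew {w B : Matrix (Fin n) (Fin n) ℝ} (hw : w.transpose = -w) (i j : Fin n) :
    (B.transpose * w * B) i j = -(B.transpose * w * B) j i := by
  have h : (B.transpose * w * B).transpose = -(B.transpose * w * B) := by
    rw [Matrix.transpose_mul, Matrix.transpose_mul, Matrix.transpose_transpose, hw,
      Matrix.neg_mul, Matrix.mul_neg, Matrix.mul_assoc]
  exact congrFun (congrFun h j) i

end Flat

end CKV

end

open CKV in
theorem mainTheorem2 (n r s : ℕ) (hrs : r + s = n) (hn : 3 ≤ n)
    {M : Type*} [TopologicalSpace M] [ChartedSpace (CKV.Model n) M] [IsManifold (𝓡 n) ∞ M]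
    (g : CKV.BilinField (n := n) M) (hg : CKV.IsSemiRiemannianMetric r g)
    (hflat : CKV.IsLocallyConformallyFlat r g)
    (p : M) (e : OpenPartialHomeomorph M (CKV.Model n))
    (he : e ∈ IsManifold.maximalAtlas (𝓡 n) ∞ M) (hp : p ∈ e.source) :
    ∃ U₀ : Set M, IsOpen U₀ ∧ p ∈ U₀ ∧ U₀ ⊆ e.source ∧
      ∀ U : Set M, IsOpen U → IsConnected U → p ∈ U → U ⊆ U₀ →
        ∃ Ω : M → ℝ,
          CKV.IsNormalizedFactor e U p Ω ∧
          CKV.SolvesHessEq e g U Ω ∧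
          CKV.IsFlatOn r (CKV.rescale Ω g) U ∧
          (∀ Ω' : M → ℝ, CKV.IsNormalizedFactor e U p Ω' →
            (CKV.SolvesHessEq e g U Ω' ∨ CKV.IsFlatOn r (CKV.rescale Ω' g) U) →
            ∀ x ∈ U, Ω' x = Ω x) ∧
          (∃ Y : Fin n → M → ℝ, CKV.IsAffineSystem e (CKV.rescale Ω g) U p Y) ∧
          ∀ Y : Fin n → M → ℝ, CKV.IsAffineSystem e (CKV.rescale Ω g) U p Y →
            (∀ x ∈ U, CKV.hMat e (CKV.rescale Ω g) Y x = CKV.hMat e (CKV.rescale Ω g) Y p) ∧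
            IsUnit (CKV.hMat e (CKV.rescale Ω g) Y p).det ∧
            IsUnit (CKV.jac e Y p).det ∧
            (∀ α β, ∃ Ψ : M → ℝ,
              CKV.IsConformalKilling e g U (CKV.zeta e (CKV.rescale Ω g) Y α β) Ψ) ∧
            ∀ (ξ : CKV.VectorField (n := n) M) (Ψ : M → ℝ),
              CKV.IsConformalKilling e g U ξ Ψ →
              ∃ F : Matrix (Fin (n + 2)) (Fin (n + 2)) ℝ,
                (∀ α β, F α β = -F β α) ∧
                (∀ B, F 0 (CKV.mid B) =
                  ∑ C, (CKV.jac e Y p)⁻¹ C B * CKV.lower e g ξ C p) ∧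
                (∀ A B, F (CKV.mid A) (CKV.mid B) =
                  ∑ C, ∑ D, CKV.omegaHat e g ξ p C D *
                    (CKV.jac e Y p)⁻¹ C A * (CKV.jac e Y p)⁻¹ D B) ∧
                (∀ A, F (CKV.mid A) (Fin.last (n + 1)) =
                  ∑ C, CKV.WHat e g ξ Ψ p C * (CKV.jac e Y p)⁻¹ C A) ∧
                F 0 (Fin.last (n + 1)) = Ψ p ∧
                (∀ x ∈ U, ξ x = (1 / 2 : ℝ) • ∑ α, ∑ β,
                  F α β • CKV.zeta e (CKV.rescale Ω g) Y α β x) ∧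
                (∀ x ∈ U, ξ x = ∑ α, ∑ β,
                  (F α β * Ω x ^ 2 * CKV.extend e (CKV.rescale Ω g) Y α x) •
                    CKV.grad e g (CKV.extend e (CKV.rescale Ω g) Y β) x) := by
  obtain ⟨V, -, hpV, Ω₀, hΩ₀, hV⟩ := hflat p
  obtain ⟨φ₀, hp₀, -, h₀⟩ := hV.exists_isConfFlatChart hΩ₀ hpV
  obtain ⟨φ, Ω, hpφ, -, hφ, hΩp, hdΩ⟩ := h₀.exists_normalized hp₀
  refine ⟨φ.source ∩ e.source, φ.open_source.inter e.open_source, ⟨hpφ, hp⟩,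
    Set.inter_subset_right, fun U hU hUc hpU hUU₀ => ⟨Ω, ?_⟩⟩
  have hc := hUc.isPreconnected
  have h : IsConfFlatChart r φ g Ω U := hφ.mono hU (hUU₀.trans Set.inter_subset_left)
  have heU : IsChartOn e U := ⟨he, hU, hUU₀.trans Set.inter_subset_right⟩
  have hφU := h.toIsChartOn
  have hgφ := h.isMetricOn
  have hge := hgφ.change heU hφU
  have hEφ := h.rescaled.isMetricOn
  have hEe := hEφ.change heU hφU
  have hN : IsNormalizedFactor e U p Ω := by
    refine ⟨⟨h.smooth, h.pos⟩, hΩp, fun i => ?_⟩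
    rw [heU.pd_chain hφU h.smooth hpU]
    simp [hdΩ]
  refine ⟨hN, (h.solvesHessEq hn).change heU hφU hgφ h.smooth, h.isFlatOn, ?_,
    ⟨_, (h.rescaled.isAffineSystem_centered hpU).change heU hφU hEφ⟩, fun Y hYe => ?_⟩
  · intro Ω' hΩ' hor x hx
    have hsol : SolvesHessEq e g U Ω' :=
      hor.elim id fun hf => hf.solvesHessEq hn hΩ'.toIsConformalFactor heU
    refine h.eq_of_solvesHessEq hn hc hpU hΩ'.smooth hΩ'.pos (hΩ'.value.trans hΩp.symm)
      (fun i => ?_) (hsol.change hφU heU hge hΩ'.smooth) hx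
    rw [hφU.pd_chain heU hΩ'.smooth hpU, hdΩ]
    simp [hΩ'.deriv]
  have hY : IsAffineSystem φ (rescale Ω g) U p Y := hYe.change hφU heU hEe
  have hA := (Matrix.isUnit_iff_isUnit_det _).1 (hY.isUnit_jac h.rescaled hc hpU)
  have hh : ∀ x ∈ U, hMat e (rescale Ω g) Y x = jac φ Y p * eta n r * (jac φ Y p).transpose :=
    fun x hx => by rw [hEφ.hMat_chain heU hφU hY.smooth hx, hY.hMat_eq h.rescaled hc hpU hx]
  have hext := fun α {x} (hx : x ∈ U) => hEφ.extend_chain heU hφU hY.smooth α hx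
  have hgrad := fun α {x} (hx : x ∈ U) => hEφ.grad_extend_chain heU hφU hY.smooth
    (hY.smooth_extend h.rescaled hc hpU α) hx
  refine ⟨fun x hx => by rw [hh x hx, hh p hpU], ?_, ?_, fun α β => ?_, fun ξ Ψ hξe => ?_⟩
  · rw [hh p hpU, Matrix.det_mul, Matrix.det_mul, Matrix.det_transpose]
    exact (hA.mul (Matrix.isUnit_det_of_left_inverse (eta_mul_eta n r))).mul hA
  · rw [jac_chain heU hφU hY.smooth hpU, Matrix.det_mul]
    exact hA.mul (heU.isUnit_transMat hφU hpU)
  · obtain ⟨Ψ, hΨ⟩ := hY.isConformalKilling_zeta h hc hpU α β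
    refine ⟨Ψ, (hΨ.change heU hφU hgφ).congr heU fun x hx => ?_⟩
    simp only [zeta, hext _ hx, hgrad _ hx]
  have hξ : IsConformalKilling φ g U ξ Ψ := hξe.change hφU heU hge
  set B := (jac e Y p)⁻¹ with hB
  set F := skewCoeff (Matrix.vecMul (lower e g ξ · p) B)
    (B.transpose * Matrix.of (omegaHat e g ξ p) * B) (Matrix.vecMul (WHat e g ξ Ψ p) B) (Ψ p)
    with hF
  have hskew : ∀ α β, F α β = -F β α :=
    skewCoeff_skew (conj_skew (by ext C D; exact omegaHat_skew ξ D C))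
  have hexp : ∀ x ∈ U, ξ x = ∑ α, ∑ β, (F α β * extend e (rescale Ω g) Y α x) •
      grad e (rescale Ω g) (extend e (rescale Ω g) Y β) x := fun x hx => by
    rw [hξ.eq_sum_grad h hn hc hpU hΩp hdΩ hY hx, hF,
      hgφ.coeff_chain heU hφU hY.smooth hξ.smooth (hξ.smooth_factor h hn) hpU]
    simp only [hext _ hx, hgrad _ hx]
  refine ⟨F, hskew, fun b => ?_, fun a b => ?_, fun a => ?_, ?_, fun x hx => ?_, fun x hx => ?_⟩
  · rw [hF, skewCoeff_zero, indexFamily_mid]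
    simp only [Matrix.vecMul, dotProduct]
    exact Finset.sum_congr rfl fun C _ => mul_comm _ _
  · rw [hF, skewCoeff_mid, indexFamily_mid, conj_apply]
    exact Finset.sum_congr rfl fun C _ => Finset.sum_congr rfl fun D _ => by
      rw [Matrix.of_apply]; ring
  · rw [hF, skewCoeff_mid, indexFamily_last]
    rfl
  · rw [hF, skewCoeff_zero, indexFamily_last]
  · rw [hexp x hx]
    exact (half_sum_skew hskew (fun α => extend e (rescale Ω g) Y α x)
      fun β => grad e (rescale Ω g) (extend e (rescale Ω g) Y β) x).symm
  · rw [hexp x hx]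
    refine Finset.sum_congr rfl fun α _ => Finset.sum_congr rfl fun β _ => ?_
    rw [grad_rescale (h.ne_zero x hx), smul_smul]
    congr 1
    ring
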